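/- \textbf{Theorem.} A \emph{market} consists of $m$ buyers $B$, $n$ stores $S$ and $l$ couriers $D$, nonnegative valuations $v_b(s)$ ($b\in B$, $s\in S$) and nonnegative delivery costs $c_d(b,s)$ ($d\in D$, $b\in B$, $s\in S$). A feasible allocation is an $x\in\{0,1\}^{B\times S\times D}$ with $\sum_{s,d}x_{bsd}\le 1$ for every $b$, $\sum_{b,d}x_{bsd}\le 1$ for every $s$, and $\sum_{b,s}x_{bsd}\le 1$ for every $d$. Its welfare is $W(x)=\sum_{b,s,d}x_{bsd}\,(v_b(s)-c_d(b,s))$, and the optimal welfare of the market is the maximum of $W$ over all feasible allocations. There is an algorithm that, given a market with rational data (the numbers $m,n,l$ and the tables of all $v_b(s)$ and all $c_d(b,s)$, written in binary), computes its optimal welfare in time polynomial in the bit length of the input, whenever the costs are of one of the following two forms: (i) $c_d(b,s)=c(b,s)+c_d(s)$ for all $d,b,s$, with a buyer--store part $c(b,s)$ and a courier--store part $c_d(s)$; or (ii) $c_d(b,s)=c(b,s)+c_d(b)$ for all $d,b,s$, with a buyer--store part $c(b,s)$ and a courier--buyer part $c_d(b)$. Here time is measured on a random access machine with logarithmic cost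 (each operation is charged the bit lengths of the numbers involved), which is polynomially equivalent to a Turing machine. -/

import Mathlib

namespace Delivery

/-! ### Random access programs with bit-length (logarithmic) cost

Programs act on integer variables and on integer arrays with computed addresses. Every evaluation
of an expression node is charged the bit length of its value (and hence of every operand and of
every address that is used), so that, as for Turing machines, arithmetic on long numbers is not
free. -/

/-- The length of an integer in binary, plus one for its sign. -/
def bitLength (z : ℤ) : ℕ := Nat.size z.natAbs + 1

/-- The memory: the variables `var 0, var 1, …` and the arrays `arr 0, arr 1, …`. A program
mentions only finitely many of them. -/
structure State where
  var : ℕ → ℤ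
  arr : ℕ → ℤ → ℤ

/-- Integer expressions; `get a i` reads the array `a` at the address `i`. -/
inductive Expr where
  | const (z : ℤ)
  | var (x : ℕ)
  | get (a : ℕ) (i : Expr)
  | add (e f : Expr)
  | sub (e f : Expr)
  | mul (e f : Expr)

/-- The value of an expression. -/
def Expr.eval (σ : State) : Expr → ℤ
  | .const z => z
  | .var x => σ.var x
  | .get a i => σ.arr a (i.eval σ)
  | .add e f => e.eval σ + f.eval σ
  | .sub e f => e.eval σ - f.eval σ
  | .mul e f => e.eval σ * f.eval σ

/-- The cost of evaluating an expression: the sum of the bit lengths of the values of all its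
nodes. -/
def Expr.cost (σ : State) : Expr → ℕ
  | .const z => bitLength z
  | .var x => bitLength (σ.var x)
  | .get a i => i.cost σ + bitLength (σ.arr a (i.eval σ))
  | .add e f => e.cost σ + f.cost σ + bitLength (e.eval σ + f.eval σ)
  | .sub e f => e.cost σ + f.cost σ + bitLength (e.eval σ - f.eval σ)
  | .mul e f => e.cost σ + f.cost σ + bitLength (e.eval σ * f.eval σ)

/-- Boolean tests on integers. -/
inductive Test where
  | le (e f : Expr)
  | eq (e f : Expr)
  | not (b : Test)
  | and (b c : Test)

/-- The truth value of a test. -/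
def Test.Holds (σ : State) : Test → Prop
  | .le e f => e.eval σ ≤ f.eval σ
  | .eq e f => e.eval σ = f.eval σ
  | .not b => ¬ b.Holds σ
  | .and b c => b.Holds σ ∧ c.Holds σ

/-- The cost of a test. -/
def Test.cost (σ : State) : Test → ℕ
  | .le e f => e.cost σ + f.cost σ + 1
  | .eq e f => e.cost σ + f.cost σ + 1
  | .not b => b.cost σ + 1
  | .and b c => b.cost σ + c.cost σ + 1

/-- Programs: `assign x e` is `x := e`, `store a i e` is `a[i] := e`, `cond` is if-then-else and
`loop b p` is "while `b` do `p`". -/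
inductive Program where
  | skip
  | assign (x : ℕ) (e : Expr)
  | store (a : ℕ) (i e : Expr)
  | seq (p q : Program)
  | cond (b : Test) (p q : Program)
  | loop (b : Test) (p : Program)

/-- The memory after `x := z`. -/
def State.setVar (σ : State) (x : ℕ) (z : ℤ) : State :=
  { σ with var := Function.update σ.var x z }

/-- The memory after `a[i] := z`. -/
def State.setArr (σ : State) (a : ℕ) (i z : ℤ) : State :=
  { σ with arr := Function.update σ.arr a (Function.update (σ.arr a) i z) }

/-- `Run p σ τ t`: the program `p`, started in the memory `σ`, halts with the memory `τ` after
time `t`. -/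
inductive Run : Program → State → State → ℕ → Prop where
  | skip (σ : State) : Run .skip σ σ 1
  | assign (x : ℕ) (e : Expr) (σ : State) :
      Run (.assign x e) σ (σ.setVar x (e.eval σ)) (e.cost σ + 1)
  | store (a : ℕ) (i e : Expr) (σ : State) :
      Run (.store a i e) σ (σ.setArr a (i.eval σ) (e.eval σ)) (i.cost σ + e.cost σ + 1)
  | seq {p q : Program} {σ τ υ : State} {t u : ℕ} :
      Run p σ τ t → Run q τ υ u → Run (.seq p q) σ υ (t + u)
  | cond_true {b : Test} {p q : Program} {σ τ : State} {t : ℕ} :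
      b.Holds σ → Run p σ τ t → Run (.cond b p q) σ τ (b.cost σ + t)
  | cond_false {b : Test} {p q : Program} {σ τ : State} {t : ℕ} :
      ¬ b.Holds σ → Run q σ τ t → Run (.cond b p q) σ τ (b.cost σ + t)
  | loop_true {b : Test} {p : Program} {σ τ υ : State} {t u : ℕ} :
      b.Holds σ → Run p σ τ t → Run (.loop b p) τ υ u →
        Run (.loop b p) σ υ (b.cost σ + t + u)
  | loop_false {b : Test} {p : Program} {σ : State} :
      ¬ b.Holds σ → Run (.loop b p) σ σ (b.cost σ)

/-- The initial memory on the input `L`: the list `L` stands in the array `arr 0`, from address `0`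
on, and everything else is `0`. -/
def initialState (L : List ℤ) : State where
  var _ := 0
  arr a k := if a = 0 ∧ 0 ≤ k then L.getD k.toNat 0 else 0

/-- The size of an input: its total length in bits. -/
def inputSize (L : List ℤ) : ℕ := (L.map bitLength).sum

/-- A rational quantity, specified by `IsValue x r` ("the answer on the instance `x` is `r`"), is
computable in polynomial time on the instances in `S`, encoded by `enc`: a single program outputs
the answer as a fraction, with numerator `var 0` and positive denominator `var 1`, on each of these
instances, within a time that is bounded by a polynomial in the bit size of the instance. -/
def PolyTimeComputableOn {α : Type} (enc : α → List ℤ) (S : Set α) (IsValue : α → ℚ → Prop) :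
    Prop :=
  ∃ (P : Program) (T : Polynomial ℕ), ∀ x ∈ S, ∃ (τ : State) (t : ℕ),
    Run P (initialState (enc x)) τ t ∧ t ≤ T.eval (inputSize (enc x)) ∧
      0 < τ.var 1 ∧ IsValue x ((τ.var 0 : ℚ) / (τ.var 1 : ℚ))

/-! ### Delivery markets -/

/-- A market with `m` unit-demand buyers, `n` unit-supply stores and `l` unit-capacity couriers:
`val b s` is the valuation of buyer `b` for store `s`, and `cost d b s` is the cost of courier `d`
for delivering from store `s` to buyer `b`. The numbers are rational because they are the input of
an algorithm. -/
structure Market where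
  m : ℕ
  n : ℕ
  l : ℕ
  val : Fin m → Fin n → ℚ
  cost : Fin l → Fin m → Fin n → ℚ
  val_nonneg : ∀ b s, 0 ≤ val b s
  cost_nonneg : ∀ d b s, 0 ≤ cost d b s

namespace Market

/-- An allocation (three-sided matching): `x b s d` says that buyer `b` buys from store `s` and
courier `d` serves the delivery. -/
abbrev Allocation (M : Market) : Type := Fin M.m → Fin M.n → Fin M.l → Bool

/-- Feasibility: unit demand, unit supply and unit capacity. -/
def Feasible (M : Market) (x : M.Allocation) : Prop :=
  (∀ b, ∑ s, ∑ d, (x b s d).toNat ≤ 1) ∧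
  (∀ s, ∑ b, ∑ d, (x b s d).toNat ≤ 1) ∧
  (∀ d, ∑ b, ∑ s, (x b s d).toNat ≤ 1)

/-- The welfare of an allocation. -/
def welfare (M : Market) (x : M.Allocation) : ℚ :=
  ∑ b, ∑ s, ∑ d, ((x b s d).toNat : ℚ) * (M.val b s - M.cost d b s)

/-- `w` is the optimal welfare: the maximum of the welfare over all feasible allocations. -/
def IsOptimalWelfare (M : Market) (w : ℚ) : Prop :=
  IsGreatest {w | ∃ x : M.Allocation, M.Feasible x ∧ w = M.welfare x} w

/-- Costs that decompose into a buyer–store part and a courier–store part. -/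
def DecomposesCourierStore (M : Market) : Prop :=
  ∃ (f : Fin M.m → Fin M.n → ℚ) (g : Fin M.l → Fin M.n → ℚ),
    ∀ d b s, M.cost d b s = f b s + g d s

/-- Costs that decompose into a buyer–store part and a courier–buyer part. -/
def DecomposesCourierBuyer (M : Market) : Prop :=
  ∃ (f : Fin M.m → Fin M.n → ℚ) (g : Fin M.l → Fin M.m → ℚ),
    ∀ d b s, M.cost d b s = f b s + g d b

/-- The input that describes a market: the numbers `m, n, l`, then the numerators of the valuations,
their denominators, the numerators of the costs, and their denominators. The entry `(b, s)` of a
table stands at the place `b * n + s`, and the entry `(d, b, s)` at `d * (m * n) + (b * n + s)`.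
The parts of a decomposition of the costs are not given. -/
def encode (M : Market) : List ℤ :=
  [(M.m : ℤ), (M.n : ℤ), (M.l : ℤ)] ++
  List.ofFn (fun k : Fin (M.m * M.n) => (M.val k.divNat k.modNat).num) ++
  List.ofFn (fun k : Fin (M.m * M.n) => ((M.val k.divNat k.modNat).den : ℤ)) ++
  List.ofFn (fun k : Fin (M.l * (M.m * M.n)) =>
    (M.cost k.divNat k.modNat.divNat k.modNat.modNat).num) ++
  List.ofFn (fun k : Fin (M.l * (M.m * M.n)) =>
    ((M.cost k.divNat k.modNat.divNat k.modNat.modNat).den : ℤ))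

end Market

end Delivery

namespace Delivery

/-! Reduction to layers. Take buyer, store and courier number 0 as references. In form (i) the costs
satisfy c_d(b,s) + c_0(0,s) = c_0(b,s) + c_d(0,s), so the gain v_b(s) - c_d(b,s) equals A(b,s) +
B(s,d) with A(b,s) = v_b(s) - c_0(b,s) and B(s,d) = c_0(0,s) - c_d(0,s). These weights come from the
costs alone, without a decomposition. Form (ii) is treated in the same way, with reference store 0
and the buyers as the middle layer. Testing the first identity on all triples tells which layer
belongs in the middle: if it fails, (i) is impossible and the hypothesis leaves (ii)
(`checkCosts_spec`, `Market.cost_eq_of_store`, `Market.cost_eq_of_buyer`).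

Reduction to assignment. It remains to choose disjoint paths i → j → d through three layers, with
weight A(i,j) + B(j,d). Consider permutations of all nodes that fix nodes or step cyclically from
layer to layer. If i goes to j, then j cannot be fixed, so it goes to some d; likewise every j that
goes to some d is reached from some i. Hence the steps between the first two gaps group into full
paths, and the way in which the third layer returns to the first is irrelevant. With cost V minus
the weight of a step, and a prohibitive cost F for other steps, the optimum is a minimum cost
permutation (`isGreatest_tripleWeight`). If V bounds all weights, the matrix is nonnegative, and F
may be any number above the cost of the identity.

Assignment. The Hungarian method adds the rows one at a time. A search grows a tree of tight cells,
shifting the dual variables by the least slack, until it meets a free column (`Search.step`); the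
matching is then shifted along the path back to the root (`Augment.step`). A perfect tight matching
is optimal by duality (`Matched.isLeast`). Every search step rescans the whole matrix, which is good
enough for a polynomial bound.

Running time. All loops are counted, with bounds that depend only on the input, and in every product
the second factor is an input entry. Each operation therefore lengthens numbers by at most about the
input size, and repeated squaring is impossible. A polynomial number of operations then has
polynomial bit cost (`Cmd.runsWithin`). The loop bounds are at most the input length once no side is
empty; an empty side must be treated separately, since m may be exponential in the input length when
n = 0. -/

/-! ### Structured programs with bounded loops -/

/-- Programs whose loops run a number of times that is known on entry: `rep x c p` is
"for `x = 0, …, c - 1` do `p`". -/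
inductive Cmd where
  | skip
  | assign (x : ℕ) (e : Expr)
  | store (a : ℕ) (i e : Expr)
  | seq (p q : Cmd)
  | cond (b : Test) (p q : Cmd)
  | rep (x : ℕ) (c : Expr) (p : Cmd)

/-- The memory after `i` rounds of "for `x = 0, 1, …` do `f`". -/
def State.iter (f : State → State) (x : ℕ) (σ : State) : ℕ → State
  | 0 => σ.setVar x 0
  | i + 1 => (f (State.iter f x σ i)).setVar x ((i : ℤ) + 1)

open Classical in
/-- The memory after a structured program. -/
noncomputable def Cmd.exec : Cmd → State → State
  | .skip => fun σ => σ
  | .assign x e => fun σ => σ.setVar x (e.eval σ)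
  | .store a i e => fun σ => σ.setArr a (i.eval σ) (e.eval σ)
  | .seq p q => fun σ => q.exec (p.exec σ)
  | .cond b p q => fun σ => if b.Holds σ then p.exec σ else q.exec σ
  | .rep x c p => fun σ => State.iter p.exec x σ (c.eval σ).toNat

/-- The test of the `while` loop that implements `rep x c p`. -/
def loopTest (x : ℕ) (c : Expr) : Test := .not (.le c (.var x))

/-- The increment of the loop counter. -/
def incr (x : ℕ) : Expr := .add (.var x) (.const 1)

/-- Structured programs as programs. -/
def Cmd.toProgram : Cmd → Program
  | .skip => .skip
  | .assign x e => .assign x e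
  | .store a i e => .store a i e
  | .seq p q => .seq p.toProgram q.toProgram
  | .cond b p q => .cond b p.toProgram q.toProgram
  | .rep x c p => .seq (.assign x (.const 0))
      (.loop (loopTest x c) (.seq p.toProgram (.assign x (incr x))))

/-- Does the program write to the variable `y`? -/
def Cmd.setsVar (y : ℕ) : Cmd → Bool
  | .skip => false
  | .assign x _ => x == y
  | .store _ _ _ => false
  | .seq p q => p.setsVar y || q.setsVar y
  | .cond _ p q => p.setsVar y || q.setsVar y
  | .rep x _ p => x == y || p.setsVar y

/-- Does the program write to the array `a`? -/
def Cmd.setsArr (a : ℕ) : Cmd → Bool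
  | .skip => false
  | .assign _ _ => false
  | .store b _ _ => b == a
  | .seq p q => p.setsArr a || q.setsArr a
  | .cond _ p q => p.setsArr a || q.setsArr a
  | .rep _ _ p => p.setsArr a

/-! ### Frame properties of structured programs. -/

@[simp] theorem State.setVar_var (σ : State) (x y : ℕ) (z : ℤ) :
    (σ.setVar x z).var y = if y = x then z else σ.var y := by
  simp [State.setVar, Function.update_apply]

@[simp] theorem State.setVar_arr (σ : State) (x : ℕ) (z : ℤ) : (σ.setVar x z).arr = σ.arr := rfl

@[simp] theorem State.setArr_var (σ : State) (a : ℕ) (i z : ℤ) : (σ.setArr a i z).var = σ.var := rfl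

@[simp] theorem State.setArr_arr (σ : State) (a b : ℕ) (i z : ℤ) :
    (σ.setArr a i z).arr b = if b = a then Function.update (σ.arr a) i z else σ.arr b := by
  simp [State.setArr, Function.update_apply]

theorem State.iter_counter (f : State → State) (x : ℕ) (σ : State) (i : ℕ) :
    (State.iter f x σ i).var x = i := by
  cases i <;> simp [State.iter]

/-- Frame rule. The syntactic check is decidable by computation, so for concrete programs its
hypothesis is usually closed by `rfl`. -/
theorem Cmd.exec_var {y : ℕ} {p : Cmd} (h : p.setsVar y = false) (σ : State) :
    (p.exec σ).var y = σ.var y := by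
  induction p generalizing σ with
  | skip => rfl
  | assign x e =>
    have : y ≠ x := by rintro rfl; simp [Cmd.setsVar] at h
    simp [Cmd.exec, this]
  | store => rfl
  | seq p q hp hq =>
    simp only [Cmd.setsVar, Bool.or_eq_false_iff] at h
    simp [Cmd.exec, hp h.1, hq h.2]
  | cond b p q hp hq =>
    simp only [Cmd.setsVar, Bool.or_eq_false_iff] at h
    simp only [Cmd.exec]
    split_ifs
    exacts [hp h.1 σ, hq h.2 σ]
  | rep x c p hp =>
    simp only [Cmd.setsVar, Bool.or_eq_false_iff, beq_eq_false_iff_ne] at h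
    simp only [Cmd.exec]
    generalize (c.eval σ).toNat = n
    induction n with
    | zero => simp [State.iter, h.1.symm]
    | succ n ih => simp [State.iter, h.1.symm, hp h.2, ih]

theorem Cmd.exec_arr {a : ℕ} {p : Cmd} (h : p.setsArr a = false) (σ : State) :
    (p.exec σ).arr a = σ.arr a := by
  induction p generalizing σ with
  | skip => rfl
  | assign x e => rfl
  | store b i e =>
    have : a ≠ b := by rintro rfl; simp [Cmd.setsArr] at h
    simp [Cmd.exec, this]
  | seq p q hp hq =>
    simp only [Cmd.setsArr, Bool.or_eq_false_iff] at h
    simp [Cmd.exec, hp h.1, hq h.2]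
  | cond b p q hp hq =>
    simp only [Cmd.setsArr, Bool.or_eq_false_iff] at h
    simp only [Cmd.exec]
    split_ifs
    exacts [hp h.1 σ, hq h.2 σ]
  | rep x c p hp =>
    simp only [Cmd.setsArr] at h
    simp only [Cmd.exec]
    generalize (c.eval σ).toNat = n
    induction n with
    | zero => simp [State.iter]
    | succ n ih => simp [State.iter, hp h, ih]

/-- The invariant rule for loops. -/
theorem Cmd.rep_induction {x : ℕ} {c : Expr} {p : Cmd} {σ : State} {n : ℕ} (P : ℕ → State → Prop)
    (hc : c.eval σ = n) (zero : P 0 (σ.setVar x 0))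
    (succ : ∀ i < n, ∀ τ : State, τ.var x = i → P i τ → P (i + 1) ((p.exec τ).setVar x (i + 1))) :
    P n ((Cmd.rep x c p).exec σ) := by
  have key : ∀ i ≤ n, P i (State.iter p.exec x σ i) := by
    intro i
    induction i with
    | zero => exact fun _ => zero
    | succ i ih => exact fun hi => succ i hi _ (State.iter_counter _ _ _ _) (ih (by omega))
  simpa [Cmd.exec, hc] using key n le_rfl

/-! ### The running time of structured programs -/

/-- An expression of the form `get 0 i`, which reads the input. -/
def Expr.isInput : Expr → Bool
  | .get a _ => a == 0
  | _ => false

/-- Expressions in which every product has a number from the input as its second factor. -/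
def Expr.tame : Expr → Bool
  | .const _ => true
  | .var _ => true
  | .get _ i => i.tame
  | .add e f => e.tame && f.tame
  | .sub e f => e.tame && f.tame
  | .mul e f => e.tame && f.tame && f.isInput

/-- Expressions that depend on the input only. -/
def Expr.closed : Expr → Bool
  | .const _ => true
  | .var _ => false
  | .get a i => a == 0 && i.closed
  | .add e f => e.closed && f.closed
  | .sub e f => e.closed && f.closed
  | .mul e f => e.closed && f.closed

/-- A measure of the size of an expression. -/
def Expr.weight : Expr → ℕ
  | .const z => Nat.size z.natAbs + 1
  | .var _ => 1
  | .get _ i => i.weight + 1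
  | .add e f => e.weight + f.weight + 1
  | .sub e f => e.weight + f.weight + 1
  | .mul e f => e.weight + f.weight + 1

/-- Tests of tame expressions. -/
def Test.tame : Test → Bool
  | .le e f => e.tame && f.tame
  | .eq e f => e.tame && f.tame
  | .not b => b.tame
  | .and b c => b.tame && c.tame

/-- A measure of the size of a test. -/
def Test.weight : Test → ℕ
  | .le e f => e.weight + f.weight + 1
  | .eq e f => e.weight + f.weight + 1
  | .not b => b.weight + 1
  | .and b c => b.weight + c.weight + 1

/-- Programs that leave the input and their loop counters alone, in which all expressions are tame
and all loop bounds depend on the input only. -/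
def Cmd.tame : Cmd → Bool
  | .skip => true
  | .assign _ e => e.tame
  | .store a i e => !(a == 0) && i.tame && e.tame
  | .seq p q => p.tame && q.tame
  | .cond b p q => b.tame && p.tame && q.tame
  | .rep x c p => c.tame && c.closed && p.tame && !(p.setsVar x)

/-- The bounds of all loops of a program. -/
def Cmd.bounds : Cmd → List Expr
  | .skip => []
  | .assign _ _ => []
  | .store _ _ _ => []
  | .seq p q => p.bounds ++ q.bounds
  | .cond _ p q => p.bounds ++ q.bounds
  | .rep _ c p => c :: p.bounds

open Polynomial in
/-- The work of a program in terms of an upper bound for the values of its loop bounds. -/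
noncomputable def Cmd.work : Cmd → Polynomial ℕ
  | .skip => 1
  | .assign _ e => C (e.weight + 1)
  | .store _ i e => C (i.weight + e.weight + 1)
  | .seq p q => p.work + q.work
  | .cond b p q => C b.weight + (p.work + q.work)
  | .rep x c p => C ((Expr.const 0).weight + 1 + (loopTest x c).weight) +
      X * (C ((loopTest x c).weight + ((incr x).weight + 1)) + p.work)

/-! ### Bounds for bit lengths and costs of expressions. -/

/-- All numbers in the memory have at most `S` bits, those of the input have at most `s`. -/
structure State.Bounded (s S : ℕ) (σ : State) : Prop where
  var : ∀ x, (σ.var x).natAbs < 2 ^ S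
  arr : ∀ a i, (σ.arr a i).natAbs < 2 ^ S
  input : ∀ i, (σ.arr 0 i).natAbs < 2 ^ s

theorem State.Bounded.mono {s S S' : ℕ} {σ : State} (h : σ.Bounded s S) (hS : S ≤ S') :
    σ.Bounded s S' :=
  ⟨fun x => (h.var x).trans_le (Nat.pow_le_pow_right (by norm_num) hS),
    fun a i => (h.arr a i).trans_le (Nat.pow_le_pow_right (by norm_num) hS), h.input⟩

theorem State.Bounded.setVar {s S : ℕ} {σ : State} (h : σ.Bounded s S) {x : ℕ} {z : ℤ}
    (hz : z.natAbs < 2 ^ S) : (σ.setVar x z).Bounded s S := by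
  refine ⟨fun y => ?_, h.arr, h.input⟩
  rw [State.setVar_var]
  split_ifs
  exacts [hz, h.var y]

theorem State.Bounded.setArr {s S : ℕ} {σ : State} (h : σ.Bounded s S) {a : ℕ} (ha : a ≠ 0)
    {i z : ℤ} (hz : z.natAbs < 2 ^ S) : (σ.setArr a i z).Bounded s S := by
  refine ⟨h.var, fun b j => ?_, fun j => ?_⟩
  · rw [State.setArr_arr]
    split_ifs
    · rw [Function.update_apply]
      split_ifs
      exacts [hz, h.arr _ _]
    · exact h.arr _ _
  · rw [State.setArr_arr, if_neg ha.symm]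
    exact h.input j

theorem natAbs_lt_two_pow_of_le_add {x y z : ℤ} {a b c : ℕ} (hx : x.natAbs < 2 ^ a)
    (hy : y.natAbs < 2 ^ b) (hz : z.natAbs ≤ x.natAbs + y.natAbs) (ha : a < c) (hb : b < c) :
    z.natAbs < 2 ^ c := by
  obtain ⟨c, rfl⟩ : ∃ d, c = d + 1 := ⟨c - 1, by omega⟩
  have h1 : (2 : ℕ) ^ a ≤ 2 ^ c := Nat.pow_le_pow_right (by norm_num) (by omega)
  have h2 : (2 : ℕ) ^ b ≤ 2 ^ c := Nat.pow_le_pow_right (by norm_num) (by omega)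
  rw [pow_succ]
  omega

/-- A sum or difference needs one bit more than its longer operand, and a tame product at most `s`
bits more than its first factor, because the second is an input entry. So the length grows
additively, by at most `s + 1` per unit of weight. -/
theorem Expr.eval_bound {s S : ℕ} {σ : State} (h : σ.Bounded s S) {e : Expr} (he : e.tame) :
    (e.eval σ).natAbs < 2 ^ (S + e.weight * (s + 1)) := by
  induction e with
  | const z =>
    refine (Nat.lt_size_self z.natAbs).trans_le (Nat.pow_le_pow_right (by norm_num) ?_)
    simp only [Expr.weight]
    nlinarith
  | var x => exact (h.var x).trans_le (Nat.pow_le_pow_right (by norm_num) (by omega))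
  | get a i => exact (h.arr a _).trans_le (Nat.pow_le_pow_right (by norm_num) (by omega))
  | add e f ihe ihf =>
    simp only [Expr.tame, Bool.and_eq_true] at he
    refine natAbs_lt_two_pow_of_le_add (ihe he.1) (ihf he.2) (Int.natAbs_add_le _ _) ?_ ?_ <;>
    · simp only [Expr.weight]
      nlinarith
  | sub e f ihe ihf =>
    simp only [Expr.tame, Bool.and_eq_true] at he
    refine natAbs_lt_two_pow_of_le_add (ihe he.1) (ihf he.2) (Int.natAbs_sub_le _ _) ?_ ?_ <;>
    · simp only [Expr.weight]
      nlinarith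
  | mul e f ihe ihf =>
    simp only [Expr.tame, Bool.and_eq_true] at he
    have hf : (f.eval σ).natAbs < 2 ^ s := by
      cases f with
      | get a i =>
        obtain rfl : a = 0 := by simpa [Expr.isInput] using he.2
        exact h.input _
      | _ => simp [Expr.isInput] at he
    calc ((Expr.mul e f).eval σ).natAbs = (e.eval σ).natAbs * (f.eval σ).natAbs :=
          Int.natAbs_mul _ _
      _ < 2 ^ (S + e.weight * (s + 1)) * 2 ^ s := Nat.mul_lt_mul'' (ihe he.1.1) hf
      _ = 2 ^ (S + e.weight * (s + 1) + s) := (pow_add _ _ _).symm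
      _ ≤ 2 ^ (S + (Expr.mul e f).weight * (s + 1)) := by
          refine Nat.pow_le_pow_right (by norm_num) ?_
          simp only [Expr.weight]
          nlinarith

theorem bitLength_le {z : ℤ} {a : ℕ} (h : z.natAbs < 2 ^ a) : bitLength z ≤ a + 1 :=
  Nat.succ_le_succ (Nat.size_le.2 h)

/-- Every subexpression has smaller weight, so all node values have at most `R` bits; the weight is
at least the number of nodes. -/
theorem Expr.cost_le {s S R : ℕ} {σ : State} (h : σ.Bounded s S) {e : Expr} (he : e.tame)
    (hR : S + e.weight * (s + 1) + 1 ≤ R) : e.cost σ ≤ e.weight * R := by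
  have hb := (bitLength_le (e.eval_bound h he)).trans hR
  induction e with
  | const z =>
    simp only [Expr.cost, Expr.weight] at hb ⊢
    change bitLength z ≤ R at hb
    nlinarith
  | var x =>
    simp only [Expr.cost, Expr.weight] at hb ⊢
    change bitLength (σ.var x) ≤ R at hb
    nlinarith
  | get a i ih =>
    simp only [Expr.cost, Expr.weight, Expr.tame] at hb hR he ⊢
    change bitLength (σ.arr a (i.eval σ)) ≤ R at hb
    have hR' : S + i.weight * (s + 1) + 1 ≤ R := by nlinarith
    have := ih he hR' ((bitLength_le (i.eval_bound h he)).trans hR')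
    nlinarith
  | add e f ihe ihf | sub e f ihe ihf =>
    simp only [Expr.tame, Bool.and_eq_true] at he
    simp only [Expr.cost, Expr.weight, Expr.eval] at hb hR ⊢
    have hRe : S + e.weight * (s + 1) + 1 ≤ R := by nlinarith
    have hRf : S + f.weight * (s + 1) + 1 ≤ R := by nlinarith
    have h1 := ihe he.1 hRe ((bitLength_le (e.eval_bound h he.1)).trans hRe)
    have h2 := ihf he.2 hRf ((bitLength_le (f.eval_bound h he.2)).trans hRf)
    nlinarith
  | mul e f ihe ihf =>
    simp only [Expr.tame, Bool.and_eq_true] at he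
    simp only [Expr.cost, Expr.weight, Expr.eval] at hb hR ⊢
    have hRe : S + e.weight * (s + 1) + 1 ≤ R := by nlinarith
    have hRf : S + f.weight * (s + 1) + 1 ≤ R := by nlinarith
    have h1 := ihe he.1.1 hRe ((bitLength_le (e.eval_bound h he.1.1)).trans hRe)
    have h2 := ihf he.1.2 hRf ((bitLength_le (f.eval_bound h he.1.2)).trans hRf)
    nlinarith

theorem Test.cost_le {s S R : ℕ} {σ : State} (h : σ.Bounded s S) {b : Test} (hb : b.tame)
    (hR : S + b.weight * (s + 1) + 1 ≤ R) : b.cost σ ≤ b.weight * R := by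
  induction b with
  | le e f | eq e f =>
    simp only [Test.tame, Bool.and_eq_true] at hb
    simp only [Test.cost, Test.weight] at hR ⊢
    have h1 := e.cost_le (R := R) h hb.1 (by nlinarith)
    have h2 := f.cost_le (R := R) h hb.2 (by nlinarith)
    nlinarith
  | not b ih =>
    simp only [Test.tame] at hb
    simp only [Test.cost, Test.weight] at hR ⊢
    have h1 := ih hb (by nlinarith)
    nlinarith
  | and b c ihb ihc =>
    simp only [Test.tame, Bool.and_eq_true] at hb
    simp only [Test.cost, Test.weight] at hR ⊢
    have h1 := ihb hb.1 (by nlinarith)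
    have h2 := ihc hb.2 (by nlinarith)
    nlinarith

/-- The `while` loop that implements `rep` evaluates its bound anew in every round. A closed bound
reads only the input array, which tame programs never write, so it keeps its value. -/
theorem Expr.eval_eq_of_closed {e : Expr} (he : e.closed) {σ τ : State} (h : σ.arr 0 = τ.arr 0) :
    e.eval σ = e.eval τ := by
  induction e with
  | const z => rfl
  | var x => simp [Expr.closed] at he
  | get a i ih =>
    simp only [Expr.closed, Bool.and_eq_true, beq_iff_eq] at he
    obtain ⟨rfl, he⟩ := he
    simp [Expr.eval, h, ih he]
  | add e f ihe ihf | sub e f ihe ihf | mul e f ihe ihf =>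
    simp only [Expr.closed, Bool.and_eq_true] at he
    simp [Expr.eval, ihe he.1, ihf he.2]

theorem Cmd.setsArr_zero_of_tame {p : Cmd} (hp : p.tame) : p.setsArr 0 = false := by
  induction p with
  | skip => rfl
  | assign => rfl
  | store a i e =>
    simp only [Cmd.tame, Bool.and_eq_true, Bool.not_eq_true'] at hp
    exact hp.1.1
  | seq p q ihp ihq =>
    simp only [Cmd.tame, Bool.and_eq_true] at hp
    simp [Cmd.setsArr, ihp hp.1, ihq hp.2]
  | cond b p q ihp ihq =>
    simp only [Cmd.tame, Bool.and_eq_true] at hp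
    simp [Cmd.setsArr, ihp hp.1.2, ihq hp.2]
  | rep x c p ih =>
    simp only [Cmd.tame, Bool.and_eq_true] at hp
    simp [Cmd.setsArr, ih hp.1.2]

/-! ### Composition of running times. -/

/-- `p` runs from `σ` to `τ` with work at most `w`: its time and the growth of the memory
are bounded accordingly. -/
def RunsWithin (s S : ℕ) (p : Program) (σ τ : State) (w : ℕ) : Prop :=
  τ.Bounded s (S + w * (s + 1)) ∧
    ∃ t, Run p σ τ t ∧ ∀ R, S + w * (s + 1) + 1 ≤ R → t ≤ w * R

theorem RunsWithin.mono {s S : ℕ} {p : Program} {σ τ : State} {w w' : ℕ}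
    (h : RunsWithin s S p σ τ w) (hw : w ≤ w') : RunsWithin s S p σ τ w' := by
  obtain ⟨hb, t, hr, ht⟩ := h
  have := Nat.mul_le_mul_right (s + 1) hw
  exact ⟨hb.mono (by omega), t, hr, fun R hR =>
    (ht R (by omega)).trans (Nat.mul_le_mul_right R hw)⟩

/-- The second run starts from the memory bound left by the first, so the exponents telescope. Both
times are measured against the same `R`, any number above the final bound, so the works simply add.
-/
theorem RunsWithin.seq {s S : ℕ} {p q : Program} {σ τ υ : State} {v w : ℕ}
    (h : RunsWithin s S p σ τ v) (h' : RunsWithin s (S + v * (s + 1)) q τ υ w) :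
    RunsWithin s S (.seq p q) σ υ (v + w) := by
  obtain ⟨-, t, hr, ht⟩ := h
  obtain ⟨hb, t', hr', ht'⟩ := h'
  have e : S + v * (s + 1) + w * (s + 1) = S + (v + w) * (s + 1) := by ring
  rw [e] at hb ht'
  refine ⟨hb, t + t', .seq hr hr', fun R hR => ?_⟩
  have := ht R (by nlinarith)
  have := ht' R hR
  nlinarith

theorem RunsWithin.assign {s S : ℕ} {σ : State} (h : σ.Bounded s S) (x : ℕ) {e : Expr}
    (he : e.tame) :
    RunsWithin s S (.assign x e) σ (σ.setVar x (e.eval σ)) (e.weight + 1) := by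
  have hw : e.weight * (s + 1) ≤ (e.weight + 1) * (s + 1) := Nat.mul_le_mul_right _ (by omega)
  refine ⟨(h.mono (by omega)).setVar ((e.eval_bound h he).trans_le
    (Nat.pow_le_pow_right (by norm_num) (by omega))), _, .assign x e σ, fun R hR => ?_⟩
  have := e.cost_le h he (R := R) (by omega)
  nlinarith

theorem RunsWithin.store {s S : ℕ} {σ : State} (h : σ.Bounded s S) {a : ℕ} (ha : a ≠ 0)
    {i e : Expr} (hi : i.tame) (he : e.tame) :
    RunsWithin s S (.store a i e) σ (σ.setArr a (i.eval σ) (e.eval σ))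
      (i.weight + e.weight + 1) := by
  have hw : e.weight * (s + 1) ≤ (i.weight + e.weight + 1) * (s + 1) :=
    Nat.mul_le_mul_right _ (by omega)
  have hw' : i.weight * (s + 1) ≤ (i.weight + e.weight + 1) * (s + 1) :=
    Nat.mul_le_mul_right _ (by omega)
  refine ⟨(h.mono (by omega)).setArr ha ((e.eval_bound h he).trans_le
    (Nat.pow_le_pow_right (by norm_num) (by omega))), _, .store a i e σ, fun R hR => ?_⟩
  have := e.cost_le h he (R := R) (by omega)
  have := i.cost_le h hi (R := R) (by omega)
  nlinarith

theorem RunsWithin.cond_true {s S : ℕ} {σ τ : State} {w : ℕ} (h : σ.Bounded s S) {b : Test}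
    (hb : b.tame) {p q : Program} (hσ : b.Holds σ) (hp : RunsWithin s S p σ τ w) :
    RunsWithin s S (.cond b p q) σ τ (b.weight + w) := by
  obtain ⟨hB, t, hr, ht⟩ := hp
  refine ⟨hB.mono (by nlinarith), _, .cond_true hσ hr, fun R hR => ?_⟩
  have := b.cost_le h hb (R := R) (by nlinarith)
  have := ht R (by nlinarith)
  nlinarith

theorem RunsWithin.cond_false {s S : ℕ} {σ τ : State} {w : ℕ} (h : σ.Bounded s S) {b : Test}
    (hb : b.tame) {p q : Program} (hσ : ¬ b.Holds σ) (hq : RunsWithin s S q σ τ w) :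
    RunsWithin s S (.cond b p q) σ τ (b.weight + w) := by
  obtain ⟨hB, t, hr, ht⟩ := hq
  refine ⟨hB.mono (by nlinarith), _, .cond_false hσ hr, fun R hR => ?_⟩
  have := b.cost_le h hb (R := R) (by nlinarith)
  have := ht R (by nlinarith)
  nlinarith

theorem RunsWithin.loop_true {s S : ℕ} {σ τ υ : State} {v w : ℕ} (h : σ.Bounded s S) {b : Test}
    (hb : b.tame) {p : Program} (hσ : b.Holds σ) (hp : RunsWithin s S p σ τ v)
    (hq : RunsWithin s (S + v * (s + 1)) (.loop b p) τ υ w) :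
    RunsWithin s S (.loop b p) σ υ (b.weight + v + w) := by
  obtain ⟨-, t, hr, ht⟩ := hp
  obtain ⟨hB, t', hr', ht'⟩ := hq
  refine ⟨hB.mono (by nlinarith), _, .loop_true hσ hr hr', fun R hR => ?_⟩
  have := b.cost_le h hb (R := R) (by nlinarith)
  have := ht R (by nlinarith)
  have := ht' R (by nlinarith)
  nlinarith

theorem RunsWithin.loop_false {s S : ℕ} {σ : State} (h : σ.Bounded s S) {b : Test}
    (hb : b.tame) {p : Program} (hσ : ¬ b.Holds σ) :
    RunsWithin s S (.loop b p) σ σ b.weight :=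
  ⟨h.mono (by omega), _, .loop_false hσ, fun _ hR => b.cost_le h hb hR⟩

theorem Cmd.closed_of_mem_bounds {p : Cmd} (hp : p.tame) {c : Expr} (hc : c ∈ p.bounds) :
    c.closed := by
  induction p with
  | skip | assign | store => simp [Cmd.bounds] at hc
  | seq p q ihp ihq =>
    simp only [Cmd.tame, Bool.and_eq_true] at hp
    simp only [Cmd.bounds, List.mem_append] at hc
    exact hc.elim (ihp hp.1) (ihq hp.2)
  | cond b p q ihp ihq =>
    simp only [Cmd.tame, Bool.and_eq_true] at hp
    simp only [Cmd.bounds, List.mem_append] at hc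
    exact hc.elim (ihp hp.1.2) (ihq hp.2)
  | rep x c p ih =>
    simp only [Cmd.tame, Bool.and_eq_true] at hp
    simp only [Cmd.bounds, List.mem_cons] at hc
    rcases hc with rfl | hc
    exacts [hp.1.1.2, ih hp.1.2 hc]

theorem RunsWithin.rep {s S v n : ℕ} {p : Cmd} (hp : p.tame) {x : ℕ} (hx : p.setsVar x = false)
    {c : Expr} (hc : c.tame) (hc' : c.closed) {σ : State}
    (hn : (c.eval σ).toNat = n) (hσ : σ.Bounded s S)
    (ih : ∀ {S : ℕ} {τ : State}, τ.Bounded s S → τ.arr 0 = σ.arr 0 →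
      RunsWithin s S p.toProgram τ (p.exec τ) v) :
    RunsWithin s S (Cmd.rep x c p).toProgram σ (State.iter p.exec x σ n)
      ((Expr.const 0).weight + 1 +
        (n * ((loopTest x c).weight + (v + ((incr x).weight + 1))) + (loopTest x c).weight)) := by
  have htest : (loopTest x c).tame := by simp [loopTest, Test.tame, Expr.tame, hc]
  have hincr : (incr x).tame := rfl
  have harr : ∀ i, (State.iter p.exec x σ i).arr 0 = σ.arr 0 := by
    intro i
    induction i with
    | zero => rfl
    | succ i ih =>
      exact (Cmd.exec_arr (Cmd.setsArr_zero_of_tame hp) _).trans ih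
  -- Induction on the number `d` of remaining rounds, with `S` general because the memory bound
  -- grows from round to round; the last summand pays for the failing test.
  have key : ∀ d i S, i + d = n → (State.iter p.exec x σ i).Bounded s S →
      RunsWithin s S (.loop (loopTest x c) (.seq p.toProgram (.assign x (incr x))))
        (State.iter p.exec x σ i) (State.iter p.exec x σ n)
        (d * ((loopTest x c).weight + (v + ((incr x).weight + 1))) + (loopTest x c).weight) := by
    intro d
    induction d with
    | zero =>
      rintro i S rfl hi
      rw [zero_mul, zero_add]
      refine .loop_false hi htest ?_
      simp only [loopTest, Test.Holds, Expr.eval, not_not, State.iter_counter,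
        c.eval_eq_of_closed hc' (harr _)]
      omega
    | succ d IH =>
      intro i S hi hB
      have h1 := ih hB (harr i)
      -- The body leaves the counter alone, so incrementing it agrees with the value that
      -- `State.iter` prescribes.
      have h2 : RunsWithin s (S + v * (s + 1)) (.assign x (incr x))
          (p.exec (State.iter p.exec x σ i)) (State.iter p.exec x σ (i + 1))
          ((incr x).weight + 1) := by
        have := RunsWithin.assign h1.1 x hincr
        simpa [incr, Expr.eval, State.iter, Cmd.exec_var hx, State.iter_counter] using this
      have h3 := h1.seq h2
      have h4 := IH (i + 1) _ (by omega) h3.1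
      refine (RunsWithin.loop_true hB htest ?_ h3 h4).mono (le_of_eq (by ring))
      simp only [loopTest, Test.Holds, Expr.eval, State.iter_counter,
        c.eval_eq_of_closed hc' (harr _)]
      omega
  have h0 := RunsWithin.assign hσ x (e := .const 0) rfl
  exact h0.seq (key n 0 _ (by omega) h0.1)

/-- The hypothesis on the bounds is stated for the initial memory only: the bounds are closed and
the input is never overwritten, so it persists to every later point of the run. -/
theorem Cmd.runsWithin {s N : ℕ} {p : Cmd} (hp : p.tame) {S : ℕ} {σ : State}
    (h : σ.Bounded s S) (hN : ∀ c ∈ p.bounds, c.eval σ ≤ N) :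
    RunsWithin s S p.toProgram σ (p.exec σ) (p.work.eval N) := by
  induction p generalizing S σ with
  | skip =>
    simp only [Cmd.work, Polynomial.eval_one]
    exact ⟨h.mono (by omega), 1, .skip σ, fun R hR => by omega⟩
  | assign x e =>
    simp only [Cmd.work, Polynomial.eval_C]
    exact RunsWithin.assign h x hp
  | store a i e =>
    simp only [Cmd.tame, Bool.and_eq_true, Bool.not_eq_true', beq_eq_false_iff_ne] at hp
    simp only [Cmd.work, Polynomial.eval_C]
    exact RunsWithin.store h hp.1.1 hp.1.2 hp.2
  | seq p q ihp ihq =>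
    simp only [Cmd.tame, Bool.and_eq_true] at hp
    simp only [Cmd.bounds, List.mem_append] at hN
    have h1 := ihp hp.1 h fun c hc => hN c (.inl hc)
    simp only [Cmd.work, Polynomial.eval_add]
    refine h1.seq (ihq hp.2 h1.1 fun c hc => ?_)
    rw [c.eval_eq_of_closed (Cmd.closed_of_mem_bounds hp.2 hc)
      (Cmd.exec_arr (Cmd.setsArr_zero_of_tame hp.1) σ)]
    exact hN c (.inr hc)
  | cond b p q ihp ihq =>
    simp only [Cmd.tame, Bool.and_eq_true] at hp
    simp only [Cmd.bounds, List.mem_append] at hN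
    simp only [Cmd.work, Polynomial.eval_add, Polynomial.eval_C, Cmd.exec]
    split_ifs with hb
    · exact (RunsWithin.cond_true h hp.1.1 hb (ihp hp.1.2 h fun c hc => hN c (.inl hc))).mono
        (by omega)
    · exact (RunsWithin.cond_false h hp.1.1 hb (ihq hp.2 h fun c hc => hN c (.inr hc))).mono
        (by omega)
  | rep x c p ih =>
    simp only [Cmd.tame, Bool.and_eq_true, Bool.not_eq_true'] at hp
    simp only [Cmd.bounds, List.mem_cons] at hN
    refine (RunsWithin.rep (v := p.work.eval N) hp.1.2 hp.2 hp.1.1.1 hp.1.1.2 rfl h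
      fun {S τ} hτ h0 => ih hp.1.2 hτ fun c' hc' => ?_).mono ?_
    · rw [c'.eval_eq_of_closed (Cmd.closed_of_mem_bounds hp.1.2 hc') h0]
      exact hN c' (.inr hc')
    · simp only [Cmd.work, Polynomial.eval_add, Polynomial.eval_C, Polynomial.eval_mul,
        Polynomial.eval_X]
      have : (c.eval σ).toNat ≤ N := by have := hN c (.inl rfl); omega
      nlinarith

/-! ### Three-layer matchings as permutations -/

section ThreeLayer

variable {I J D : Type}

/-- The permutation makes only steps along the cyclic order of the layers and trivial steps. -/
structure Cyclic (σ : Equiv.Perm (I ⊕ J ⊕ D)) : Prop where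
  left : ∀ i, σ (.inl i) = .inl i ∨ ∃ j, σ (.inl i) = .inr (.inl j)
  mid : ∀ j, σ (.inr (.inl j)) = .inr (.inl j) ∨ ∃ d, σ (.inr (.inl j)) = .inr (.inr d)
  right : ∀ d, σ (.inr (.inr d)) = .inr (.inr d) ∨ ∃ i, σ (.inr (.inr d)) = .inl i

/-- The preimage of `j` is neither `j`, which moves, nor another node of the middle layer, which
would be fixed or go to the third layer, nor a node of the third layer. So it lies in the first
layer. -/
theorem Cyclic.exists_left {σ : Equiv.Perm (I ⊕ J ⊕ D)} (hσ : Cyclic σ) {j : J} {d : D}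
    (h : σ (.inr (.inl j)) = .inr (.inr d)) : ∃! i, σ (.inl i) = .inr (.inl j) := by
  obtain ⟨x, hx⟩ := σ.surjective (.inr (.inl j))
  rcases x with i | j' | d'
  · refine ⟨i, hx, fun i' hi' => ?_⟩
    simpa using σ.injective (hi'.trans hx.symm)
  · rcases hσ.mid j' with h' | ⟨d', h'⟩
    · rw [h'] at hx
      simp only [Sum.inr.injEq, Sum.inl.injEq] at hx
      subst hx
      simp [h] at h'
    · simp [h'] at hx
  · rcases hσ.right d' with h' | ⟨i, h'⟩ <;> simp [h'] at hx

/-- If `j` were fixed, it would have the same image as `i`. -/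
theorem Cyclic.exists_right {σ : Equiv.Perm (I ⊕ J ⊕ D)} (hσ : Cyclic σ) {i : I} {j : J}
    (h : σ (.inl i) = .inr (.inl j)) : ∃! d, σ (.inr (.inl j)) = .inr (.inr d) := by
  rcases hσ.mid j with h' | ⟨d, h'⟩
  · simpa using σ.injective (h.trans h'.symm)
  · exact ⟨d, h', fun d' hd' => by simpa using hd'.symm.trans h'⟩

/-- A permutation of `I ⊕ J ⊕ D` stands for the set of the triples `(i, j, d)` with `i ↦ j ↦ d`. The
cost of `x ↦ y` is `V` minus the weight of this step; steps that go against the cyclic order of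
the layers or stay inside a layer without being a fixed point have the cost `F`. -/
def stepCost [DecidableEq I] [DecidableEq J] [DecidableEq D] (V F : ℤ) (A : I → J → ℤ)
    (B : J → D → ℤ) : I ⊕ J ⊕ D → I ⊕ J ⊕ D → ℤ
  | .inl i, .inl i' => if i = i' then V else F
  | .inl i, .inr (.inl j) => V - A i j
  | .inl _, .inr (.inr _) => F
  | .inr (.inl _), .inl _ => F
  | .inr (.inl j), .inr (.inl j') => if j = j' then V else F
  | .inr (.inl j), .inr (.inr d) => V - B j d
  | .inr (.inr _), .inl _ => V
  | .inr (.inr _), .inr (.inl _) => F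
  | .inr (.inr d), .inr (.inr d') => if d = d' then V else F

theorem stepCost_nonneg [DecidableEq I] [DecidableEq J] [DecidableEq D] {V F : ℤ}
    {A : I → J → ℤ} {B : J → D → ℤ} (hV : 0 ≤ V) (hF : 0 ≤ F) (hA : ∀ i j, A i j ≤ V)
    (hB : ∀ j d, B j d ≤ V) (x y : I ⊕ J ⊕ D) : 0 ≤ stepCost V F A B x y := by
  rcases x with i | j | d <;> rcases y with i' | j' | d' <;> simp only [stepCost]
  case inl.inr.inl => linarith [hA i j']
  case inr.inl.inr.inr => linarith [hB j d']
  all_goals first | assumption | (split_ifs <;> assumption)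

variable [Fintype I] [Fintype J] [Fintype D]

/-- Sets of disjoint triples. -/
def DisjointTriples (x : I → J → D → Bool) : Prop :=
  (∀ i, ∑ j, ∑ d, (x i j d).toNat ≤ 1) ∧
  (∀ j, ∑ i, ∑ d, (x i j d).toNat ≤ 1) ∧
  (∀ d, ∑ i, ∑ j, (x i j d).toNat ≤ 1)

/-- The total weight of a set of triples if `(i, j, d)` has the weight `A i j + B j d`. -/
def tripleWeight (A : I → J → ℤ) (B : J → D → ℤ) (x : I → J → D → Bool) : ℤ :=
  ∑ i, ∑ j, ∑ d, ((x i j d).toNat : ℤ) * (A i j + B j d)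

/-- The triples of a permutation. -/
def triples [DecidableEq I] [DecidableEq J] [DecidableEq D] (σ : Equiv.Perm (I ⊕ J ⊕ D)) (i : I)
    (j : J) (d : D) : Bool :=
  decide (σ (.inl i) = .inr (.inl j) ∧ σ (.inr (.inl j)) = .inr (.inr d))

theorem sum_sum_toNat_le_one {P Q : Type} [Fintype P] [Fintype Q] {f : P → Q → Bool}
    (h : ∀ p q p' q', f p q → f p' q' → p = p' ∧ q = q') :
    ∑ p, ∑ q, (f p q).toNat ≤ 1 := by
  classical
  rw [← Fintype.sum_prod_type' (f := fun p q => (f p q).toNat)]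
  have : ∀ a : P × Q, (f a.1 a.2).toNat = if f a.1 a.2 then 1 else 0 := by
    intro a; cases f a.1 a.2 <;> rfl
  simp only [this, Finset.sum_boole, Nat.cast_id]
  refine Finset.card_le_one.2 fun a ha b hb => ?_
  simp only [Finset.mem_filter, Finset.mem_univ, true_and] at ha hb
  exact Prod.ext_iff.2 (h _ _ _ _ ha hb)

theorem eq_of_sum_sum_toNat_le_one {P Q : Type} [Fintype P] [Fintype Q] {f : P → Q → Bool}
    (h : ∑ p, ∑ q, (f p q).toNat ≤ 1) {p p' : P} {q q' : Q} (h1 : f p q) (h2 : f p' q') :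
    p = p' ∧ q = q' := by
  classical
  rw [← Fintype.sum_prod_type' (f := fun p q => (f p q).toNat)] at h
  have : ∀ a : P × Q, (f a.1 a.2).toNat = if f a.1 a.2 then 1 else 0 := by
    intro a; cases f a.1 a.2 <;> rfl
  simp only [this, Finset.sum_boole, Nat.cast_id] at h
  have := Finset.card_le_one.1 h (p, q) (by simpa using h1) (p', q') (by simpa using h2)
  exact Prod.ext_iff.1 this

theorem sum_ite_eq_one {P : Type} [Fintype P] {p : P → Prop} [DecidablePred p]
    (h : ∃! a, p a) : ∑ a, (if p a then (1 : ℤ) else 0) = 1 := by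
  obtain ⟨a, ha, hu⟩ := h
  rw [Finset.sum_eq_single_of_mem a (Finset.mem_univ a)]
  · simp [ha]
  · exact fun b _ hb => if_neg fun h => hb (hu b h)

variable [DecidableEq I] [DecidableEq J] [DecidableEq D]

/-- Cyclicity plays no role: `σ` being a function gives disjointness forwards, and injectivity gives
it backwards. -/
theorem disjointTriples_triples (σ : Equiv.Perm (I ⊕ J ⊕ D)) :
    DisjointTriples (triples σ) := by
  refine ⟨fun i => sum_sum_toNat_le_one ?_, fun j => sum_sum_toNat_le_one ?_,
    fun d => sum_sum_toNat_le_one ?_⟩ <;>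
  simp only [triples, decide_eq_true_eq]
  · rintro j d j' d' ⟨h1, h2⟩ ⟨h3, h4⟩
    have : j = j' := by simpa using h1.symm.trans h3
    subst this
    exact ⟨rfl, by simpa using h2.symm.trans h4⟩
  · rintro i d i' d' ⟨h1, h2⟩ ⟨h3, h4⟩
    exact ⟨by simpa using σ.injective (h1.trans h3.symm), by simpa using h2.symm.trans h4⟩
  · rintro i j i' j' ⟨h1, h2⟩ ⟨h3, h4⟩
    have : j = j' := by simpa using σ.injective (h2.trans h4.symm)
    subst this
    exact ⟨by simpa using σ.injective (h1.trans h3.symm), rfl⟩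

/-- Half paths do not occur: by `Cyclic.exists_right` and `Cyclic.exists_left` every step from the
first to the second layer, and every step from the second to the third, belongs to exactly one
triple. Thus every weight is counted once, and every node contributes `V`. -/
theorem Cyclic.sum_stepCost {σ : Equiv.Perm (I ⊕ J ⊕ D)} (hσ : Cyclic σ) (V F : ℤ)
    (A : I → J → ℤ) (B : J → D → ℤ) :
    ∑ x, stepCost V F A B x (σ x) =
      Fintype.card (I ⊕ J ⊕ D) * V - tripleWeight A B (triples σ) := by
  have hI : ∀ i, stepCost V F A B (.inl i) (σ (.inl i)) =
      V - ∑ j, (if σ (.inl i) = .inr (.inl j) then 1 else 0) * A i j := by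
    intro i
    rcases hσ.left i with h | ⟨j, h⟩ <;> simp [h, stepCost]
  have hJ : ∀ j, stepCost V F A B (.inr (.inl j)) (σ (.inr (.inl j))) =
      V - ∑ d, (if σ (.inr (.inl j)) = .inr (.inr d) then 1 else 0) * B j d := by
    intro j
    rcases hσ.mid j with h | ⟨d, h⟩ <;> simp [h, stepCost]
  have hD : ∀ d, stepCost V F A B (.inr (.inr d)) (σ (.inr (.inr d))) = V := by
    intro d
    rcases hσ.right d with h | ⟨i, h⟩ <;> simp [h, stepCost]
  have hx : ∀ i j d, ((triples σ i j d).toNat : ℤ) =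
      (if σ (.inl i) = .inr (.inl j) then 1 else 0) *
        (if σ (.inr (.inl j)) = .inr (.inr d) then 1 else 0) := by
    intro i j d
    by_cases h1 : σ (.inl i) = .inr (.inl j) <;>
    by_cases h2 : σ (.inr (.inl j)) = .inr (.inr d) <;> simp [triples, h1, h2]
  have hA : ∑ i, ∑ j, ∑ d, ((triples σ i j d).toNat : ℤ) * A i j =
      ∑ i, ∑ j, (if σ (.inl i) = .inr (.inl j) then 1 else 0) * A i j := by
    refine Finset.sum_congr rfl fun i _ => Finset.sum_congr rfl fun j _ => ?_
    simp only [hx, ← Finset.sum_mul, ← Finset.mul_sum]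
    split_ifs with h
    · rw [sum_ite_eq_one (hσ.exists_right h), mul_one]
    · simp
  have hB : ∑ i, ∑ j, ∑ d, ((triples σ i j d).toNat : ℤ) * B j d =
      ∑ j, ∑ d, (if σ (.inr (.inl j)) = .inr (.inr d) then 1 else 0) * B j d := by
    rw [Finset.sum_comm]
    refine Finset.sum_congr rfl fun j _ => ?_
    rw [Finset.sum_comm]
    refine Finset.sum_congr rfl fun d _ => ?_
    simp only [hx, ← Finset.sum_mul]
    split_ifs with h
    · rw [sum_ite_eq_one (hσ.exists_left h), one_mul]
    · simp
  simp only [tripleWeight, mul_add, Finset.sum_add_distrib, hA, hB, Fintype.sum_sum_type, hI, hJ,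
    hD, Finset.sum_sub_distrib, Finset.sum_const, Finset.card_univ, Fintype.card_sum,
    nsmul_eq_mul, Nat.cast_add]
  ring

/-- Each triple becomes a 3-cycle `i ↦ j ↦ d ↦ i`, and the uncovered nodes are fixed. Disjointness
makes this map injective, hence bijective by finiteness. -/
theorem exists_perm_of_disjointTriples {x : I → J → D → Bool} (hx : DisjointTriples x) :
    ∃ σ : Equiv.Perm (I ⊕ J ⊕ D), Cyclic σ ∧ triples σ = x := by
  obtain ⟨h1, h2, h3⟩ := hx
  replace h1 := fun i j d j' d' => eq_of_sum_sum_toNat_le_one (h1 i)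
    (p := j) (q := d) (p' := j') (q' := d')
  replace h2 := fun j i d i' d' => eq_of_sum_sum_toNat_le_one (h2 j)
    (p := i) (q := d) (p' := i') (q' := d')
  replace h3 := fun d i j i' j' => eq_of_sum_sum_toNat_le_one (h3 d)
    (p := i) (q := j) (p' := i') (q' := j')
  have hI : ∀ i, ∃ y : I ⊕ J ⊕ D, (∃ j d, x i j d ∧ y = .inr (.inl j)) ∨
      (∀ j d, x i j d = false) ∧ y = .inl i := by
    intro i
    by_cases h : ∃ j d, x i j d
    · obtain ⟨j, d, h⟩ := h
      exact ⟨_, .inl ⟨j, d, h, rfl⟩⟩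
    · simp only [not_exists, Bool.not_eq_true] at h
      exact ⟨_, .inr ⟨h, rfl⟩⟩
  have hJ : ∀ j, ∃ y : I ⊕ J ⊕ D, (∃ i d, x i j d ∧ y = .inr (.inr d)) ∨
      (∀ i d, x i j d = false) ∧ y = .inr (.inl j) := by
    intro j
    by_cases h : ∃ i d, x i j d
    · obtain ⟨i, d, h⟩ := h
      exact ⟨_, .inl ⟨i, d, h, rfl⟩⟩
    · simp only [not_exists, Bool.not_eq_true] at h
      exact ⟨_, .inr ⟨h, rfl⟩⟩
  have hD : ∀ d, ∃ y : I ⊕ J ⊕ D, (∃ i j, x i j d ∧ y = .inl i) ∨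
      (∀ i j, x i j d = false) ∧ y = .inr (.inr d) := by
    intro d
    by_cases h : ∃ i j, x i j d
    · obtain ⟨i, j, h⟩ := h
      exact ⟨_, .inl ⟨i, j, h, rfl⟩⟩
    · simp only [not_exists, Bool.not_eq_true] at h
      exact ⟨_, .inr ⟨h, rfl⟩⟩
  choose fI hI using hI
  choose fJ hJ using hJ
  choose fD hD using hD
  let f : I ⊕ J ⊕ D → I ⊕ J ⊕ D := Sum.elim fI (Sum.elim fJ fD)
  have hf : Function.Injective f := by
    rintro (i | j | d) (i' | j' | d') h <;> simp only [f, Sum.elim_inl, Sum.elim_inr] at h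
    · rcases hI i with ⟨j, d, h, e⟩ | ⟨h, e⟩ <;> rcases hI i' with ⟨j', d', h', e'⟩ | ⟨h', e'⟩ <;>
      grind
    · rcases hI i with ⟨j, d, h, e⟩ | ⟨h, e⟩ <;> rcases hJ j' with ⟨i', d', h', e'⟩ | ⟨h', e'⟩ <;>
      grind
    · rcases hI i with ⟨j, d, h, e⟩ | ⟨h, e⟩ <;> rcases hD d' with ⟨i', j', h', e'⟩ | ⟨h', e'⟩ <;>
      grind
    · rcases hJ j with ⟨i, d, h, e⟩ | ⟨h, e⟩ <;> rcases hI i' with ⟨j', d', h', e'⟩ | ⟨h', e'⟩ <;>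
      grind
    · rcases hJ j with ⟨i, d, h, e⟩ | ⟨h, e⟩ <;> rcases hJ j' with ⟨i', d', h', e'⟩ | ⟨h', e'⟩ <;>
      grind
    · rcases hJ j with ⟨i, d, h, e⟩ | ⟨h, e⟩ <;> rcases hD d' with ⟨i', j', h', e'⟩ | ⟨h', e'⟩ <;>
      grind
    · rcases hD d with ⟨i, j, h, e⟩ | ⟨h, e⟩ <;> rcases hI i' with ⟨j', d', h', e'⟩ | ⟨h', e'⟩ <;>
      grind
    · rcases hD d with ⟨i, j, h, e⟩ | ⟨h, e⟩ <;> rcases hJ j' with ⟨i', d', h', e'⟩ | ⟨h', e'⟩ <;>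
      grind
    · rcases hD d with ⟨i, j, h, e⟩ | ⟨h, e⟩ <;> rcases hD d' with ⟨i', j', h', e'⟩ | ⟨h', e'⟩ <;>
      grind
  refine ⟨Equiv.ofBijective f (Finite.injective_iff_bijective.1 hf), ⟨fun i => ?_, fun j => ?_,
    fun d => ?_⟩, ?_⟩
  · rcases hI i with ⟨j, d, h, e⟩ | ⟨h, e⟩ <;> simp [f, e]
  · rcases hJ j with ⟨j, d, h, e⟩ | ⟨h, e⟩ <;> simp [f, e]
  · rcases hD d with ⟨j, d, h, e⟩ | ⟨h, e⟩ <;> simp [f, e]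
  -- The images of `i` and `j` might come from two different triples; both contain `j`, so
  -- disjointness in the middle layer identifies them.
  · have hf' : ∀ i j d, x i j d = true ↔ fI i = .inr (.inl j) ∧ fJ j = .inr (.inr d) := by
      intro i j d
      rcases hI i with ⟨j', d', h, e⟩ | ⟨h, e⟩ <;>
      rcases hJ j with ⟨i'', d'', h', e'⟩ | ⟨h', e'⟩ <;>
      simp only [e, e', Sum.inr.injEq, Sum.inl.injEq, reduceCtorEq, false_and, and_false,
        h, h', Bool.false_eq_true]
      constructor
      · intro hx
        exact ⟨(h1 _ _ _ _ _ h hx).1, (h2 _ _ _ _ _ h' hx).2⟩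
      · rintro ⟨rfl, rfl⟩
        obtain ⟨-, rfl⟩ := h2 _ _ _ _ _ h h'
        exact h
    ext i j d
    simp only [triples, f, Equiv.ofBijective_apply, Sum.elim_inl, Sum.elim_inr]
    rw [Bool.eq_iff_iff, decide_eq_true_iff, hf']

/-- The identity costs less than `F`, hence so does the minimum. All summands are nonnegative, so
none of them can be `F`, and a minimal permutation is cyclic. Among cyclic permutations, cost and
weight add up to a constant. -/
theorem isGreatest_tripleWeight {V F z : ℤ} {A : I → J → ℤ} {B : J → D → ℤ} (hV : 0 ≤ V)
    (hA : ∀ i j, A i j ≤ V) (hB : ∀ j d, B j d ≤ V) (hF : Fintype.card (I ⊕ J ⊕ D) * V < F)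
    (hz : IsLeast {c | ∃ σ : Equiv.Perm (I ⊕ J ⊕ D), c = ∑ x, stepCost V F A B x (σ x)} z) :
    IsGreatest {w | ∃ x : I → J → D → Bool, DisjointTriples x ∧ w = tripleWeight A B x}
      (Fintype.card (I ⊕ J ⊕ D) * V - z) := by
  have hF' : 0 ≤ F := (by positivity : (0 : ℤ) ≤ Fintype.card (I ⊕ J ⊕ D) * V).trans hF.le
  have hnonneg := stepCost_nonneg hV hF' hA hB
  obtain ⟨⟨σ, rfl⟩, hmin⟩ := hz
  have hle : ∑ x, stepCost V F A B x (σ x) < F := by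
    refine (hmin ⟨1, rfl⟩).trans_lt (lt_of_eq_of_lt ?_ hF)
    have : ∀ x, stepCost V F A B x ((1 : Equiv.Perm (I ⊕ J ⊕ D)) x) = V := by
      rintro (i | j | d) <;> simp [stepCost]
    simp only [this, Finset.sum_const, Finset.card_univ, nsmul_eq_mul]
  have hlt : ∀ x, stepCost V F A B x (σ x) < F := fun x =>
    (Finset.single_le_sum (fun y _ => hnonneg y (σ y)) (Finset.mem_univ x)).trans_lt hle
  have hσ : Cyclic σ := by
    constructor
    · intro i
      have := hlt (.inl i)
      rcases h : σ (.inl i) with i' | j' | d' <;> simp [h, stepCost] at this ⊢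
      by_contra hne
      simp [Ne.symm hne] at this
    · intro j
      have := hlt (.inr (.inl j))
      rcases h : σ (.inr (.inl j)) with i' | j' | d' <;> simp [h, stepCost] at this ⊢
      by_contra hne
      simp [Ne.symm hne] at this
    · intro d
      have := hlt (.inr (.inr d))
      rcases h : σ (.inr (.inr d)) with i' | j' | d' <;> simp [h, stepCost] at this ⊢
      by_contra hne
      simp [Ne.symm hne] at this
  refine ⟨⟨triples σ, disjointTriples_triples σ, ?_⟩, ?_⟩
  · rw [hσ.sum_stepCost]
    ring
  · rintro w ⟨x, hx, rfl⟩
    obtain ⟨ρ, hρ, rfl⟩ := exists_perm_of_disjointTriples hx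
    have := hmin ⟨ρ, rfl⟩
    rw [hρ.sum_stepCost] at this
    linarith

end ThreeLayer

/-! ### The Hungarian method: invariants

Rows and columns are numbered from `1` to `N`. `C i j` is the cost of the cell `(i, j)`, `u` and `v` are
the dual variables, and `p j` is the row that is matched with the column `j`, or `0`. The virtual
column `0` carries the row from which the search for an augmenting path starts. -/

/-- A dual feasible pair, together with a matching of the rows `1, …, k` into tight columns. -/
structure Matched (N : ℕ) (C : ℤ → ℤ → ℤ) (k : ℤ) (u v p : ℤ → ℤ) : Prop where
  feasible : ∀ i j : ℤ, 1 ≤ i → i ≤ N → 1 ≤ j → j ≤ N → u i + v j ≤ C i j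
  range : ∀ j : ℤ, 1 ≤ j → j ≤ N → 0 ≤ p j ∧ p j ≤ k
  inj : ∀ j j' : ℤ, 1 ≤ j → j ≤ N → 1 ≤ j' → j' ≤ N → p j = p j' → p j ≠ 0 → j = j'
  surj : ∀ i : ℤ, 1 ≤ i → i ≤ k → ∃ j : ℤ, 1 ≤ j ∧ j ≤ N ∧ p j = i
  tight : ∀ j : ℤ, 1 ≤ j → j ≤ N → p j ≠ 0 → u (p j) + v j = C (p j) j

/-- The state of the search from the row `r`: the columns `q 0, …, q (t - 1)` have been
scanned, the column `q t` has been reached, and `way` leads back to the column `0` along tight cells. -/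
structure Search (N : ℕ) (C : ℤ → ℤ → ℤ) (r : ℤ) (u v p used way : ℤ → ℤ) (t : ℕ)
    (q : ℕ → ℤ) : Prop where
  feasible : ∀ i j : ℤ, 1 ≤ i → i ≤ N → 1 ≤ j → j ≤ N → u i + v j ≤ C i j
  range : ∀ j : ℤ, 0 ≤ j → j ≤ N → 0 ≤ p j ∧ p j ≤ r
  inj : ∀ j j' : ℤ, 0 ≤ j → j ≤ N → 0 ≤ j' → j' ≤ N → p j = p j' → p j ≠ 0 → j = j'
  surj : ∀ i : ℤ, 1 ≤ i → i ≤ r → ∃ j : ℤ, 0 ≤ j ∧ j ≤ N ∧ p j = i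
  tight : ∀ j : ℤ, 1 ≤ j → j ≤ N → p j ≠ 0 → u (p j) + v j = C (p j) j
  zero : q 0 = 0
  q_range : ∀ a ≤ t, 0 ≤ q a ∧ q a ≤ N
  q_inj : ∀ a ≤ t, ∀ b ≤ t, q a = q b → a = b
  used_iff : ∀ j : ℤ, 0 ≤ j → j ≤ N → (used j = r ↔ ∃ a < t, q a = j)
  matched : ∀ a < t, p (q a) ≠ 0
  tree : ∀ a, 1 ≤ a → a ≤ t → ∃ b < a, way (q a) = q b ∧
    u (p (q b)) + v (q a) = C (p (q b)) (q a)

/-- `(bi, bj)` is a pair with the property `P` for which `slack` takes its minimum `best`, or `bj = 0` if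
there is no such pair. -/
def IsBest (P : ℤ → ℤ → Prop) (slack : ℤ → ℤ → ℤ) (bi bj best : ℤ) : Prop :=
  (bj = 0 ∧ ∀ i j, ¬ P i j) ∨
    (bj ≠ 0 ∧ P bi bj ∧ best = slack bi bj ∧ ∀ i j, P i j → best ≤ slack i j)

/-- The new row is put into the virtual column 0. Marks are row numbers: those of earlier searches
are at most `k`, so none equals `k + 1` and the marks need no reset. -/
theorem Matched.search {N : ℕ} {C : ℤ → ℤ → ℤ} {k : ℤ} {u v p used way : ℤ → ℤ}
    (h : Matched N C k u v p) (hk : 0 ≤ k) (hused : ∀ j : ℤ, 0 ≤ j → j ≤ N → used j ≤ k) :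
    Search N C (k + 1) u v (Function.update p 0 (k + 1)) used way 0 fun _ => 0 := by
  have hp : ∀ j : ℤ, 1 ≤ j → Function.update p 0 (k + 1) j = p j := fun j hj =>
    Function.update_of_ne (by omega) _ _
  have h0 : Function.update p 0 (k + 1) 0 = k + 1 := Function.update_self ..
  constructor
  · exact h.feasible
  · intro j hj hj'
    rcases eq_or_lt_of_le hj with rfl | hj
    · rw [h0]; omega
    · rw [hp j hj]
      have := h.range j hj hj'
      omega
  · intro j j' hj hjN hj' hjN' e hne
    rcases eq_or_lt_of_le hj with rfl | hj <;> rcases eq_or_lt_of_le hj' with rfl | hj'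
    · rfl
    · rw [h0, hp j' hj'] at e
      have := h.range j' hj' hjN'
      omega
    · rw [h0, hp j hj] at e
      have := h.range j hj hjN
      omega
    · rw [hp j hj, hp j' hj'] at e
      rw [hp j hj] at hne
      exact h.inj j j' hj hjN hj' hjN' e hne
  · intro i hi hi'
    rcases eq_or_lt_of_le hi' with rfl | hi'
    · exact ⟨0, le_rfl, by omega, h0⟩
    · obtain ⟨j, hj, hjN, e⟩ := h.surj i hi (by omega)
      exact ⟨j, by omega, hjN, by rw [hp j hj, e]⟩
  · intro j hj hjN
    rw [hp j hj]
    exact h.tight j hj hjN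
  · rfl
  · intro a _
    omega
  · intro a ha b hb _
    omega
  · intro j hj hjN
    have := hused j hj hjN
    simp only [not_lt_zero, false_and, exists_false, iff_false]
    omega
  · intro a ha
    omega
  · intro a ha ha'
    omega

/-- If all the columns reached so far are matched then they are as many as the rows matched. -/
theorem Search.lt_of_ne {N : ℕ} {C : ℤ → ℤ → ℤ} {r : ℤ} {u v p used way : ℤ → ℤ} {t : ℕ}
    {q : ℕ → ℤ} (h : Search N C r u v p used way t q) (ht : p (q t) ≠ 0) : (t : ℤ) < r := by
  have hm : ∀ a ≤ t, p (q a) ≠ 0 := fun a ha => by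
    rcases ha.lt_or_eq with ha | rfl
    exacts [h.matched a ha, ht]
  have hcard : (Finset.range (t + 1)).card ≤ (Finset.Icc 1 r).card := by
    refine Finset.card_le_card_of_injOn (fun a => p (q a)) ?_ ?_
    · intro a ha
      simp only [Finset.coe_range, Set.mem_Iio] at ha
      have h1 := h.q_range a (by omega)
      have h2 := h.range (q a) h1.1 h1.2
      have h3 := hm a (by omega)
      simp only [Finset.coe_Icc, Set.mem_Icc]
      omega
    · intro a ha b hb e
      simp only [Finset.coe_range, Set.mem_Iio] at ha hb
      have h1 := h.q_range a (by omega)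
      have h2 := h.q_range b (by omega)
      exact h.q_inj a (by omega) b (by omega)
        (h.inj _ _ h1.1 h1.2 h2.1 h2.2 e (hm a (by omega)))
  simp only [Finset.card_range, Int.card_Icc] at hcard
  omega

/-- Fewer than `N` columns have been scanned before `q t`, so the `t + 1` reached columns, which
include column 0, cannot exhaust the `N + 1` columns. -/
theorem Search.exists_unused {N : ℕ} {C : ℤ → ℤ → ℤ} {r : ℤ} {u v p used way : ℤ → ℤ} {t : ℕ}
    {q : ℕ → ℤ} (h : Search N C r u v p used way t q) (hr : r ≤ N) (ht : p (q t) ≠ 0) :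
    ∃ j : ℤ, 1 ≤ j ∧ j ≤ N ∧ ∀ a ≤ t, q a ≠ j := by
  by_contra! hcon
  have hlt := h.lt_of_ne ht
  have hcard : (Finset.Icc (0 : ℤ) N).card ≤ (Finset.range (t + 1)).card := by
    refine Finset.card_le_card_of_surjOn q ?_
    intro j hj
    simp only [Finset.coe_Icc, Set.mem_Icc] at hj
    rcases eq_or_lt_of_le hj.1 with rfl | hj0
    · exact ⟨0, by simp, h.zero⟩
    · obtain ⟨a, ha, e⟩ := hcon j hj0 hj.2
      exact ⟨a, by simp; omega, e⟩
  simp only [Finset.card_range, Int.card_Icc] at hcard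
  omega

/-- One step of the search: the column `q t` is scanned, the dual variables change by the minimum
slack, and the column where the minimum is attained is reached. -/
theorem Search.step {N : ℕ} {C : ℤ → ℤ → ℤ} {r : ℤ} {u v p used way u' v' used' way' : ℤ → ℤ} {t : ℕ}
    {q : ℕ → ℤ} (h : Search N C r u v p used way t q) (hr : r ≤ N) (ht : p (q t) ≠ 0)
    (hused : used' = Function.update used (q t) r) {bi bj best : ℤ}
    (hbest : IsBest (fun i j => 0 ≤ i ∧ i ≤ N ∧ 1 ≤ j ∧ j ≤ N ∧ used' i = r ∧ used' j ≠ r)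
      (fun i j => C (p i) j - u (p i) - v j) bi bj best)
    (hu : ∀ i : ℤ, (∃ j : ℤ, 0 ≤ j ∧ j ≤ N ∧ used' j = r ∧ p j = i) ∧ u' i = u i + best ∨
      (¬ ∃ j : ℤ, 0 ≤ j ∧ j ≤ N ∧ used' j = r ∧ p j = i) ∧ u' i = u i)
    (hv : ∀ j : ℤ, 0 ≤ j → j ≤ N → v' j = v j - if used' j = r then best else 0)
    (hway : way' = Function.update way bj bi) :
    Search N C r u' v' p used' way' (t + 1) (Function.update q (t + 1) bj) ∧ bj ≠ 0 := by
  have hm : ∀ a ≤ t, p (q a) ≠ 0 := fun a ha => by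
    rcases ha.lt_or_eq with ha | rfl
    exacts [h.matched a ha, ht]
  have hused_iff : ∀ j : ℤ, 0 ≤ j → j ≤ N → (used' j = r ↔ ∃ a < t + 1, q a = j) := by
    intro j hj hjN
    rw [hused, Function.update_apply]
    split_ifs with e
    · simp only [true_iff]
      exact ⟨t, by omega, e.symm⟩
    · rw [h.used_iff j hj hjN]
      constructor
      · rintro ⟨a, ha, rfl⟩
        exact ⟨a, by omega, rfl⟩
      · rintro ⟨a, ha, rfl⟩
        have : a ≠ t := by rintro rfl; exact e rfl
        exact ⟨a, by omega, rfl⟩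
  have hmark : ∀ a ≤ t, used' (q a) = r := fun a ha =>
    (hused_iff _ (h.q_range a ha).1 (h.q_range a ha).2).2 ⟨a, by omega, rfl⟩
  have hmatched : ∀ j : ℤ, 0 ≤ j → j ≤ N → used' j = r → p j ≠ 0 := by
    intro j hj hjN hj'
    obtain ⟨a, ha, rfl⟩ := (hused_iff j hj hjN).1 hj'
    exact hm a (by omega)
  obtain ⟨hbj0, ⟨hbi, hbiN, hbj, hbjN, hbiu, hbju⟩, hbesteq, hmin⟩ :
      bj ≠ 0 ∧ (0 ≤ bi ∧ bi ≤ N ∧ 1 ≤ bj ∧ bj ≤ N ∧ used' bi = r ∧ used' bj ≠ r) ∧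
        best = C (p bi) bj - u (p bi) - v bj ∧
        ∀ i j : ℤ, (0 ≤ i ∧ i ≤ N ∧ 1 ≤ j ∧ j ≤ N ∧ used' i = r ∧ used' j ≠ r) →
          best ≤ C (p i) j - u (p i) - v j := by
    -- The scan cannot come back empty: the column just marked, paired with an unreached one, is a
    -- candidate.
    rcases hbest with ⟨-, hnone⟩ | hbest
    · obtain ⟨j, hj, hjN, hq⟩ := h.exists_unused hr ht
      refine absurd ⟨(h.q_range t le_rfl).1, (h.q_range t le_rfl).2, hj, hjN, hmark t le_rfl, ?_⟩
        (hnone (q t) j)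
      rw [Ne, hused_iff j (by omega) hjN]
      rintro ⟨a, ha, e⟩
      exact hq a (by omega) e
    · exact hbest
  -- The sign matters for cells in a marked column whose row is not in the tree: only `v` changes
  -- there, and it must not increase.
  have hbest0 : 0 ≤ best := by
    have h1 := h.range bi hbi hbiN
    have h2 := hmatched bi hbi hbiN hbiu
    have := h.feasible (p bi) bj (by omega) (by omega) hbj hbjN
    omega
  have hu1 : ∀ j : ℤ, 0 ≤ j → j ≤ N → used' j = r → u' (p j) = u (p j) + best := by
    intro j hj hjN hj'
    rcases hu (p j) with ⟨-, e⟩ | ⟨hn, -⟩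
    · exact e
    · exact absurd ⟨j, hj, hjN, hj', rfl⟩ hn
  -- By injectivity of the matching, the row of an unmarked column is not shared with a marked one,
  -- so its dual variable does not move and matched cells outside the tree stay tight.
  have hu2 : ∀ j : ℤ, 0 ≤ j → j ≤ N → used' j ≠ r → p j ≠ 0 → u' (p j) = u (p j) := by
    intro j hj hjN hj' hne
    rcases hu (p j) with ⟨⟨j', h0, h1, h2, h3⟩, -⟩ | ⟨-, e⟩
    · exact absurd (h.inj j j' hj hjN h0 h1 h3.symm hne ▸ h2) hj'
    · exact e
  have hv1 : ∀ j : ℤ, 0 ≤ j → j ≤ N → used' j = r → v' j = v j - best := fun j hj hjN hj' => by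
    rw [hv j hj hjN, if_pos hj']
  have hv2 : ∀ j : ℤ, 0 ≤ j → j ≤ N → used' j ≠ r → v' j = v j := fun j hj hjN hj' => by
    rw [hv j hj hjN, if_neg hj', sub_zero]
  have hq : ∀ a ≤ t, Function.update q (t + 1) bj a = q a := fun a ha =>
    Function.update_of_ne (by omega) _ _
  have hq' : Function.update q (t + 1) bj (t + 1) = bj := Function.update_self ..
  have hnq : ∀ a ≤ t, q a ≠ bj := by
    rintro a ha rfl
    exact hbju (hmark a ha)
  refine ⟨?_, hbj0⟩
  constructor
  · intro i j hi hiN hj hjN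
    have hf := h.feasible i j hi hiN hj hjN
    by_cases hj' : used' j = r
    · rw [hv1 j (by omega) hjN hj']
      rcases hu i with ⟨-, e⟩ | ⟨-, e⟩ <;> rw [e] <;> omega
    · rw [hv2 j (by omega) hjN hj']
      rcases hu i with ⟨⟨j', h0, h1, h2, rfl⟩, e⟩ | ⟨-, e⟩ <;> rw [e]
      -- The critical cells, from a row of the tree to an unmarked column: minimality of `best` is
      -- exactly what keeps them feasible.
      · have := hmin j' j ⟨h0, h1, hj, hjN, h2, hj'⟩
        omega
      · exact hf
  · exact h.range
  · exact h.inj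
  · exact h.surj
  · intro j hj hjN hne
    have := h.tight j hj hjN hne
    by_cases hj' : used' j = r
    · rw [hv1 j (by omega) hjN hj', hu1 j (by omega) hjN hj']
      omega
    · rw [hv2 j (by omega) hjN hj', hu2 j (by omega) hjN hj' hne]
      exact this
  · rw [hq 0 (by omega), h.zero]
  · intro a ha
    rcases Nat.lt_or_eq_of_le ha with ha | rfl
    · rw [hq a (by omega)]
      exact h.q_range a (by omega)
    · rw [hq']
      omega
  · intro a ha b hb e
    rcases Nat.lt_or_eq_of_le ha with ha | rfl <;> rcases Nat.lt_or_eq_of_le hb with hb | rfl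
    · rw [hq a (by omega), hq b (by omega)] at e
      exact h.q_inj a (by omega) b (by omega) e
    · rw [hq a (by omega), hq'] at e
      exact absurd e (hnq a (by omega))
    · rw [hq b (by omega), hq'] at e
      exact absurd e.symm (hnq b (by omega))
    · rfl
  · intro j hj hjN
    rw [hused_iff j hj hjN]
    refine exists_congr fun a => and_congr_right fun ha => ?_
    rw [hq a (by omega)]
  · intro a ha
    rw [hq a (by omega)]
    exact hm a (by omega)
  -- On old tree cells the two shifts cancel. The new cell becomes tight because its slack was
  -- exactly `best`.
  · intro a ha ha'
    rcases Nat.lt_or_eq_of_le ha' with ha' | rfl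
    · obtain ⟨b, hb, e, e'⟩ := h.tree a ha (by omega)
      refine ⟨b, hb, ?_, ?_⟩
      · rw [hq a (by omega), hq b (by omega), hway, Function.update_of_ne (hnq a (by omega)), e]
      · have ha0 := h.q_range a (by omega)
        have hb0 := h.q_range b (by omega)
        rw [hq a (by omega), hq b (by omega), hu1 _ hb0.1 hb0.2 (hmark b (by omega)),
          hv1 _ ha0.1 ha0.2 (hmark a (by omega))]
        omega
    · obtain ⟨b, hb, rfl⟩ := (hused_iff bi hbi hbiN).1 hbiu
      refine ⟨b, hb, ?_, ?_⟩
      · rw [hq', hq b (by omega), hway, Function.update_self]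
      · rw [hq', hq b (by omega), hu1 _ hbi hbiN hbiu, hv2 _ (by omega) hbjN hbju]
        omega

/-- The state of the augmentation along the path: the column `q a` is waiting for a new row. -/
structure Augment (N : ℕ) (C : ℤ → ℤ → ℤ) (r : ℤ) (u v p way : ℤ → ℤ) (a : ℕ)
    (q : ℕ → ℤ) : Prop where
  feasible : ∀ i j : ℤ, 1 ≤ i → i ≤ N → 1 ≤ j → j ≤ N → u i + v j ≤ C i j
  range : ∀ j : ℤ, 0 ≤ j → j ≤ N → j ≠ q a → 0 ≤ p j ∧ p j ≤ r
  inj : ∀ j j' : ℤ, 0 ≤ j → j ≤ N → j ≠ q a → 0 ≤ j' → j' ≤ N → j' ≠ q a → p j = p j' → p j ≠ 0 →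
    j = j'
  surj : ∀ i : ℤ, 1 ≤ i → i ≤ r → ∃ j : ℤ, 0 ≤ j ∧ j ≤ N ∧ j ≠ q a ∧ p j = i
  tight : ∀ j : ℤ, 1 ≤ j → j ≤ N → j ≠ q a → p j ≠ 0 → u (p j) + v j = C (p j) j
  zero : q 0 = 0
  q_range : ∀ b ≤ a, 0 ≤ q b ∧ q b ≤ N
  q_inj : ∀ b ≤ a, ∀ c ≤ a, q b = q c → b = c
  matched : ∀ b < a, p (q b) ≠ 0
  tree : ∀ b, 1 ≤ b → b ≤ a → ∃ c < b, way (q b) = q c ∧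
    u (p (q c)) + v (q b) = C (p (q c)) (q b)

theorem Search.augment {N : ℕ} {C : ℤ → ℤ → ℤ} {r : ℤ} {u v p used way : ℤ → ℤ} {t : ℕ}
    {q : ℕ → ℤ} (h : Search N C r u v p used way t q) (ht : p (q t) = 0) :
    Augment N C r u v p way t q where
  feasible := h.feasible
  range j hj hjN _ := h.range j hj hjN
  inj j j' hj hjN _ hj' hjN' _ := h.inj j j' hj hjN hj' hjN'
  surj i hi hir := by
    obtain ⟨j, hj, hjN, e⟩ := h.surj i hi hir
    refine ⟨j, hj, hjN, ?_, e⟩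
    rintro rfl
    omega
  tight j hj hjN _ := h.tight j hj hjN
  zero := h.zero
  q_range := h.q_range
  q_inj := h.q_inj
  matched := h.matched
  tree := h.tree

/-- The column `q a` takes over the row of its predecessor `q b`, along a cell that `tree` says is
tight, and `q b` becomes the hole. That row now sits in `q a` and its old copy is exempt, so the
matching stays injective and covers the same rows. As `b < a`, the walk back ends. -/
theorem Augment.step {N : ℕ} {C : ℤ → ℤ → ℤ} {r : ℤ} {u v p way : ℤ → ℤ} {a : ℕ} {q : ℕ → ℤ}
    (h : Augment N C r u v p way a q) (ha : q a ≠ 0) :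
    ∃ b < a, way (q a) = q b ∧
      Augment N C r u v (Function.update p (q a) (p (way (q a)))) way b q := by
  have ha1 : 1 ≤ a := Nat.one_le_iff_ne_zero.2 fun e => ha (e ▸ h.zero)
  obtain ⟨b, hb, e, he⟩ := h.tree a ha1 le_rfl
  refine ⟨b, hb, e, ?_⟩
  rw [e]
  set p' := Function.update p (q a) (p (q b)) with hp'
  have hpa : p' (q a) = p (q b) := Function.update_self ..
  have hp : ∀ j, j ≠ q a → p' j = p j := fun j hj => Function.update_of_ne hj _ _
  have hba : q b ≠ q a := fun e => by
    have := h.q_inj b hb.le a le_rfl e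
    omega
  have hbr := h.q_range b hb.le
  have har := h.q_range a le_rfl
  have hpq : ∀ c < a, p' (q c) = p (q c) := fun c hc =>
    hp _ fun e => by
      have := h.q_inj c hc.le a le_rfl e
      omega
  constructor
  · exact h.feasible
  · intro j hj hjN hjb
    by_cases hja : j = q a
    · rw [hja, hpa]
      exact h.range _ hbr.1 hbr.2 hba
    · rw [hp j hja]
      exact h.range j hj hjN hja
  · intro j j' hj hjN hjb hj' hjN' hjb' e' hne
    by_cases hja : j = q a <;> by_cases hja' : j' = q a
    · rw [hja, hja']
    · rw [hja, hpa] at e' hne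
      rw [hp j' hja'] at e'
      exact absurd (h.inj _ _ hbr.1 hbr.2 hba hj' hjN' hja' e' hne).symm hjb'
    · rw [hja', hpa] at e'
      rw [hp j hja] at e' hne
      exact absurd (h.inj _ _ hj hjN hja hbr.1 hbr.2 hba e' hne) hjb
    · rw [hp j hja] at e' hne
      rw [hp j' hja'] at e'
      exact h.inj _ _ hj hjN hja hj' hjN' hja' e' hne
  · intro i hi hir
    obtain ⟨j, hj, hjN, hja, e'⟩ := h.surj i hi hir
    by_cases hjb : j = q b
    · exact ⟨q a, har.1, har.2, hba.symm, by rw [hpa, ← hjb, e']⟩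
    · exact ⟨j, hj, hjN, hjb, by rw [hp j hja, e']⟩
  · intro j hj hjN hjb hne
    by_cases hja : j = q a
    · rw [hja, hpa]
      exact he
    · rw [hp j hja] at hne ⊢
      exact h.tight j hj hjN hja hne
  · exact h.zero
  · exact fun c hc => h.q_range c (by omega)
  · exact fun c hc d hd => h.q_inj c (by omega) d (by omega)
  · intro c hc
    rw [hpq c (by omega)]
    exact h.matched c (by omega)
  · intro c hc hcb
    obtain ⟨d, hd, e1, e2⟩ := h.tree c hc (by omega)
    refine ⟨d, hd, e1, ?_⟩
    rw [hpq d (by omega)]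
    exact e2

/-- Once the hole is the virtual column 0, the exemption concerns no genuine column. -/
theorem Augment.matched_of_zero {N : ℕ} {C : ℤ → ℤ → ℤ} {r : ℤ} {u v p way : ℤ → ℤ} {a : ℕ}
    {q : ℕ → ℤ} (h : Augment N C r u v p way a q) (ha : q a = 0) : Matched N C r u v p := by
  refine ⟨h.feasible, fun j hj hjN => h.range j (by omega) hjN (by omega),
    fun j j' hj hjN hj' hjN' => h.inj j j' (by omega) hjN (by omega) (by omega) hjN' (by omega),
    fun i hi hir => ?_, fun j hj hjN => h.tight j hj hjN (by omega)⟩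
  obtain ⟨j, hj, hjN, hja, e⟩ := h.surj i hi hir
  exact ⟨j, by omega, hjN, e⟩

/-- A perfect tight matching proves that the dual objective is the minimum cost of a permutation. -/
theorem Matched.isLeast {N : ℕ} {C : ℤ → ℤ → ℤ} {u v p : ℤ → ℤ} (h : Matched N C N u v p) :
    IsLeast {c | ∃ σ : Equiv.Perm (Fin N), c = ∑ i : Fin N, C ((i : ℤ) + 1) ((σ i : ℤ) + 1)}
      (∑ i : Fin N, (u ((i : ℤ) + 1) + v ((i : ℤ) + 1))) := by
  -- Permuting the column variables does not change the dual objective, so it can be compared with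
  -- any permutation cell by cell.
  have hle : ∀ σ : Equiv.Perm (Fin N), ∑ i : Fin N, (u ((i : ℤ) + 1) + v ((i : ℤ) + 1)) =
      ∑ i : Fin N, (u ((i : ℤ) + 1) + v ((σ i : ℤ) + 1)) := by
    intro σ
    rw [Finset.sum_add_distrib, Finset.sum_add_distrib,
      Equiv.sum_comp σ fun i : Fin N => v ((i : ℤ) + 1)]
  constructor
  · have hex : ∀ i : Fin N, ∃ j : Fin N, p ((j : ℤ) + 1) = (i : ℤ) + 1 := by
      intro i
      obtain ⟨j, hj, hjN, e⟩ := h.surj ((i : ℤ) + 1) (by omega) (by omega)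
      refine ⟨⟨(j - 1).toNat, by omega⟩, ?_⟩
      rw [← e]
      congr 1
      simp only
      omega
    choose f hf using hex
    have hinj : Function.Injective f := by
      intro i j e
      have h1 := hf i
      rw [e, hf j] at h1
      exact Fin.ext (by omega)
    refine ⟨Equiv.ofBijective f (Finite.injective_iff_bijective.1 hinj), ?_⟩
    rw [hle (Equiv.ofBijective f (Finite.injective_iff_bijective.1 hinj))]
    refine Finset.sum_congr rfl fun i _ => ?_
    have := h.tight ((f i : ℤ) + 1) (by omega) (by omega) (by rw [hf i]; omega)
    rw [hf i] at this
    exact this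
  · rintro c ⟨σ, rfl⟩
    rw [hle σ]
    exact Finset.sum_le_sum fun i _ =>
      h.feasible _ _ (by omega) (by omega) (by omega) (by omega)

/-! ### The Hungarian method: the program

The arrays are: `2` the cost matrix, `3` and `4` the dual variables of rows and columns, `5` the
matching, `6` the row whose search has last scanned a column, `7` the way back. The variables are:
`20` the number of matched rows, `22` the column that has been reached, `23`, `24`, `25` the row end, the
column end and the slack of the best cell, `30` a temporary, `21`, `26`, `27`, `28`, `29` loop counters. -/

/-- The number of buyers. -/
def buyers : Expr := .get 0 (.const 0)

/-- The number of stores. -/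
def stores : Expr := .get 0 (.const 1)

/-- The number of couriers. -/
def couriers : Expr := .get 0 (.const 2)

/-- The number of rows and columns of the matrix. -/
def dim : Expr := .add (.add buyers stores) couriers

/-- The address of a cell of the matrix. -/
def cell (i j : Expr) : Expr :=
  .add (.add (.add (.mul i buyers) (.mul i stores)) (.mul i couriers)) j

/-- The number of rows and columns of the matrix. -/
def State.dim (σ : State) : ℤ := σ.arr 0 0 + σ.arr 0 1 + σ.arr 0 2

/-- The entries of the matrix. -/
def State.cellCost (σ : State) (i j : ℤ) : ℤ := σ.arr 2 (i * σ.dim + j)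

@[simp] theorem eval_buyers (σ : State) : buyers.eval σ = σ.arr 0 0 := rfl

@[simp] theorem eval_stores (σ : State) : stores.eval σ = σ.arr 0 1 := rfl

@[simp] theorem eval_couriers (σ : State) : couriers.eval σ = σ.arr 0 2 := rfl

@[simp] theorem eval_dim (σ : State) : dim.eval σ = σ.dim := rfl

-- The product with the dimension is written as three products in `cell`, since a tame product needs
-- an input entry as its second factor.
@[simp] theorem eval_cell (i j : Expr) (σ : State) :
    (cell i j).eval σ = i.eval σ * σ.dim + j.eval σ := by
  simp only [cell, Expr.eval, eval_buyers, eval_stores, eval_couriers, State.dim]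
  ring

@[simp] theorem eval_incr (x : ℕ) (σ : State) : (incr x).eval σ = σ.var x + 1 := rfl

theorem State.dim_congr {σ τ : State} (h : τ.arr 0 = σ.arr 0) : τ.dim = σ.dim := by
  simp [State.dim, h]

theorem State.cellCost_congr {σ τ : State} (h : τ.arr 0 = σ.arr 0) (h2 : τ.arr 2 = σ.arr 2) :
    τ.cellCost = σ.cellCost := by
  ext i j
  simp [State.cellCost, State.dim, h, h2]

/-- The row whose search is going on. -/
def root : Expr := incr 20

/-- The slack of a cell. -/
def slackExpr (i j : Expr) : Expr :=
  .sub (.sub (.get 2 (cell (.get 5 i) j)) (.get 3 (.get 5 i))) (.get 4 j)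

/-- The slack of a cell whose row is given by its matched column. -/
def State.slack (σ : State) (i j : ℤ) : ℤ :=
  σ.cellCost (σ.arr 5 i) j - σ.arr 3 (σ.arr 5 i) - σ.arr 4 j

@[simp] theorem eval_slackExpr (i j : Expr) (σ : State) :
    (slackExpr i j).eval σ = σ.slack (i.eval σ) (j.eval σ) := by
  simp [slackExpr, Expr.eval, State.slack, State.cellCost]

theorem State.slack_congr {σ τ : State} (h : τ.arr = σ.arr) : τ.slack = σ.slack := by
  ext i j
  simp [State.slack, State.cellCost, State.dim, h]

/-- Compare the best cell with the current one. -/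
def scanStep : Cmd :=
  .cond (.and (.eq (.get 6 (.var 26)) root) (.not (.eq (.get 6 (incr 27)) root)))
    (.seq (.assign 30 (slackExpr (.var 26) (incr 27)))
      (.cond (.and (.not (.eq (.var 24) (.const 0))) (.le (.var 25) (.var 30))) .skip
        (.seq (.assign 25 (.var 30)) (.seq (.assign 23 (.var 26)) (.assign 24 (incr 27))))))
    .skip

/-- Find the best cell. -/
def scan : Cmd :=
  .seq (.assign 24 (.const 0)) (.rep 26 (.add dim (.const 1)) (.rep 27 dim scanStep))

/-- Change the dual variables. -/
def updateDuals : Cmd :=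
  .rep 28 (.add dim (.const 1)) (.cond (.eq (.get 6 (.var 28)) root)
    (.seq (.store 3 (.get 5 (.var 28)) (.add (.get 3 (.get 5 (.var 28))) (.var 25)))
      (.store 4 (.var 28) (.sub (.get 4 (.var 28)) (.var 25))))
    .skip)

/-- Scan the column that has been reached, unless it is free. -/
def searchStep : Cmd :=
  .cond (.eq (.get 5 (.var 22)) (.const 0)) .skip
    (.seq (.store 6 (.var 22) root) (.seq scan (.seq updateDuals
      (.seq (.store 7 (.var 24) (.var 23)) (.assign 22 (.var 24))))))

/-- Move one step back on the augmenting path. -/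
def augmentStep : Cmd :=
  .cond (.eq (.var 22) (.const 0)) .skip
    (.seq (.assign 30 (.get 7 (.var 22)))
      (.seq (.store 5 (.var 22) (.get 5 (.var 30))) (.assign 22 (.var 30))))

/-- Match one more row. -/
def phase : Cmd :=
  .seq (.store 5 (.const 0) root) (.seq (.assign 22 (.const 0))
    (.seq (.rep 21 dim searchStep) (.rep 29 dim augmentStep)))

/-- The Hungarian method. -/
def hungarian : Cmd := .rep 20 dim phase

/-! ### Correctness of the Hungarian program. -/

theorem IsBest.congr {P P' : ℤ → ℤ → Prop} {slack : ℤ → ℤ → ℤ} {bi bj best : ℤ}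
    (h : IsBest P slack bi bj best) (hP : ∀ i j, P i j ↔ P' i j) : IsBest P' slack bi bj best := by
  have : P = P' := by ext i j; exact hP i j
  exact this ▸ h

theorem IsBest.keep {P : ℤ → ℤ → Prop} {slack : ℤ → ℤ → ℤ} {bi bj best : ℤ}
    (h : IsBest P slack bi bj best) {x y : ℤ} (hbj : bj ≠ 0) (hle : best ≤ slack x y) :
    IsBest (fun i j => P i j ∨ i = x ∧ j = y) slack bi bj best := by
  rcases h with ⟨h, -⟩ | ⟨h1, h2, h3, h4⟩
  · exact absurd h hbj
  · refine .inr ⟨h1, .inl h2, h3, ?_⟩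
    rintro i j (h | ⟨rfl, rfl⟩)
    exacts [h4 i j h, hle]

theorem IsBest.replace {P : ℤ → ℤ → Prop} {slack : ℤ → ℤ → ℤ} {bi bj best : ℤ}
    (h : IsBest P slack bi bj best) {x y : ℤ} (hy : y ≠ 0) (hlt : bj ≠ 0 → slack x y < best) :
    IsBest (fun i j => P i j ∨ i = x ∧ j = y) slack x y (slack x y) := by
  refine .inr ⟨hy, .inr ⟨rfl, rfl⟩, rfl, ?_⟩
  rintro i j (hP | ⟨rfl, rfl⟩)
  · rcases h with ⟨-, h⟩ | ⟨h1, -, -, h4⟩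
    · exact absurd hP (h i j)
    · exact (hlt h1).le.trans (h4 i j hP)
  · exact le_rfl

theorem scanStep_spec {τ : State} {P : ℤ → ℤ → Prop} {slack : ℤ → ℤ → ℤ}
    (hs : slack = τ.slack) (hy : 0 ≤ τ.var 27)
    (h : IsBest P slack (τ.var 23) (τ.var 24) (τ.var 25)) :
    IsBest (fun i j => P i j ∨ (i = τ.var 26 ∧ j = τ.var 27 + 1) ∧
        τ.arr 6 i = τ.var 20 + 1 ∧ τ.arr 6 j ≠ τ.var 20 + 1) slack
      ((scanStep.exec τ).var 23) ((scanStep.exec τ).var 24) ((scanStep.exec τ).var 25) := by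
  subst hs
  by_cases h1 : τ.arr 6 (τ.var 26) = τ.var 20 + 1 ∧ ¬ τ.arr 6 (τ.var 27 + 1) = τ.var 20 + 1
  · have hP : ∀ i j, (P i j ∨ i = τ.var 26 ∧ j = τ.var 27 + 1) ↔
        (P i j ∨ (i = τ.var 26 ∧ j = τ.var 27 + 1) ∧
        τ.arr 6 i = τ.var 20 + 1 ∧ τ.arr 6 j ≠ τ.var 20 + 1) := by
      intro i j
      refine or_congr_right ⟨?_, fun h => h.1⟩
      rintro ⟨rfl, rfl⟩
      exact ⟨⟨rfl, rfl⟩, h1⟩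
    by_cases h2 : ¬ τ.var 24 = 0 ∧ τ.var 25 ≤ τ.slack (τ.var 26) (τ.var 27 + 1)
    · have := (h.keep h2.1 h2.2).congr hP
      simpa [scanStep, Cmd.exec, Test.Holds, Expr.eval, root, h1, h2] using this
    · have := (h.replace (x := τ.var 26) (y := τ.var 27 + 1) (by omega) (by
        intro h3
        by_contra h4
        exact h2 ⟨h3, by omega⟩)).congr hP
      have h3 : ¬ τ.var 24 = 0 → ¬ τ.var 25 ≤ τ.slack (τ.var 26) (τ.var 27 + 1) :=
        fun a b => h2 ⟨a, b⟩
      by_cases h4 : τ.var 24 = 0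
      · simpa [scanStep, Cmd.exec, Test.Holds, Expr.eval, root, h1, h4] using this
      · have h5 := h3 h4
        simpa [scanStep, Cmd.exec, Test.Holds, Expr.eval, root, h1, h4, h5] using this
  · have hP : ∀ i j, P i j ↔
        (P i j ∨ (i = τ.var 26 ∧ j = τ.var 27 + 1) ∧
        τ.arr 6 i = τ.var 20 + 1 ∧ τ.arr 6 j ≠ τ.var 20 + 1) := by
      intro i j
      refine ⟨.inl, ?_⟩
      rintro (h | ⟨⟨rfl, rfl⟩, h⟩)
      exacts [h, absurd h h1]
    have := h.congr hP
    have hex : scanStep.exec τ = τ := by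
      simp only [scanStep, Cmd.exec]
      rw [if_neg]
      simpa [Test.Holds, Expr.eval, root] using h1
    rwa [hex]

theorem scan_spec {σ : State} {N : ℕ} (hN : σ.dim = N) :
    IsBest (fun i j => 0 ≤ i ∧ i ≤ N ∧ 1 ≤ j ∧ j ≤ N ∧ σ.arr 6 i = σ.var 20 + 1 ∧
        σ.arr 6 j ≠ σ.var 20 + 1) σ.slack
      ((scan.exec σ).var 23) ((scan.exec σ).var 24) ((scan.exec σ).var 25) := by
  have key := Cmd.rep_induction (x := 26) (c := .add dim (.const 1)) (p := .rep 27 dim scanStep)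
    (σ := (Cmd.assign 24 (.const 0)).exec σ) (n := N + 1)
    (fun a τ => τ.arr = σ.arr ∧ τ.var 20 = σ.var 20 ∧
      IsBest (fun i j => (0 ≤ i ∧ i < a ∧ 1 ≤ j ∧ j ≤ N) ∧ σ.arr 6 i = σ.var 20 + 1 ∧
        σ.arr 6 j ≠ σ.var 20 + 1) σ.slack (τ.var 23) (τ.var 24) (τ.var 25))
    (by simpa [Expr.eval, Cmd.exec, State.dim] using hN) ?_ ?_
  · refine key.2.2.congr fun i j => ?_
    push_cast
    constructor
    · rintro ⟨⟨h1, h2, h3, h4⟩, h5⟩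
      exact ⟨h1, by omega, h3, h4, h5⟩
    · rintro ⟨h1, h2, h3, h4, h5⟩
      exact ⟨⟨h1, by omega, h3, h4⟩, h5⟩
  · refine ⟨rfl, rfl, .inl ⟨rfl, ?_⟩⟩
    push_cast
    rintro i j ⟨⟨h1, h2, -⟩, -⟩
    omega
  · rintro a ha τ hτ ⟨harr, h20, hbest⟩
    have inner := Cmd.rep_induction (x := 27) (c := dim) (p := scanStep) (σ := τ) (n := N)
      (fun b υ => υ.arr = σ.arr ∧ υ.var 20 = σ.var 20 ∧ υ.var 26 = a ∧
        IsBest (fun i j => ((0 ≤ i ∧ i < a ∧ 1 ≤ j ∧ j ≤ N) ∨ (i = a ∧ 1 ≤ j ∧ j ≤ b)) ∧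
          σ.arr 6 i = σ.var 20 + 1 ∧ σ.arr 6 j ≠ σ.var 20 + 1) σ.slack
            (υ.var 23) (υ.var 24) (υ.var 25))
      (by rw [eval_dim, State.dim_congr (congrFun harr 0), hN]) ?_ ?_
    · obtain ⟨h1, h2, -, h3⟩ := inner
      refine ⟨h1, h2, h3.congr fun i j => and_congr_left fun _ => ?_⟩
      push_cast
      omega
    · refine ⟨harr, h20, hτ, hbest.congr fun i j => and_congr_left fun _ => ?_⟩
      push_cast
      omega
    · rintro b hb υ hυ ⟨harr', h20', h26, hbest'⟩
      refine ⟨?_, ?_, ?_, ?_⟩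
      · rw [State.setVar_arr, ← harr']
        funext c
        exact Cmd.exec_arr (by rfl) υ
      · rw [State.setVar_var, if_neg (by decide), Cmd.exec_var (by rfl), h20']
      · rw [State.setVar_var, if_neg (by decide), Cmd.exec_var (by rfl), h26]
      · have := scanStep_spec (State.slack_congr harr').symm (by omega) hbest'
        simp only [State.setVar_var, harr', h20', h26, hυ] at this ⊢
        refine this.congr fun i j => ?_
        push_cast
        rw [← or_and_right]
        refine and_congr_left fun _ => ?_
        omega

/-- The loop runs over marked columns but changes the variables of their rows. Injectivity on marked
columns ensures that no row is raised twice. -/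
theorem updateDuals_spec {σ : State} {N : ℕ} (hN : σ.dim = N)
    (hinj : ∀ j j' : ℤ, 0 ≤ j → j ≤ N → 0 ≤ j' → j' ≤ N → σ.arr 6 j = σ.var 20 + 1 →
      σ.arr 6 j' = σ.var 20 + 1 → σ.arr 5 j = σ.arr 5 j' → j = j') :
    (∀ i, (∃ j : ℤ, 0 ≤ j ∧ j ≤ N ∧ σ.arr 6 j = σ.var 20 + 1 ∧ σ.arr 5 j = i) ∧
        (updateDuals.exec σ).arr 3 i = σ.arr 3 i + σ.var 25 ∨
      (¬ ∃ j : ℤ, 0 ≤ j ∧ j ≤ N ∧ σ.arr 6 j = σ.var 20 + 1 ∧ σ.arr 5 j = i) ∧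
        (updateDuals.exec σ).arr 3 i = σ.arr 3 i) ∧
    ∀ j : ℤ, 0 ≤ j → j ≤ N → (updateDuals.exec σ).arr 4 j =
      σ.arr 4 j - if σ.arr 6 j = σ.var 20 + 1 then σ.var 25 else 0 := by
  have key := Cmd.rep_induction (x := 28) (c := .add dim (.const 1)) (σ := σ) (n := N + 1)
    (p := .cond (.eq (.get 6 (.var 28)) root)
      (.seq (.store 3 (.get 5 (.var 28)) (.add (.get 3 (.get 5 (.var 28))) (.var 25)))
        (.store 4 (.var 28) (.sub (.get 4 (.var 28)) (.var 25)))) .skip)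
    (fun a τ => τ.arr 5 = σ.arr 5 ∧ τ.arr 6 = σ.arr 6 ∧ τ.var 20 = σ.var 20 ∧
      τ.var 25 = σ.var 25 ∧
      (∀ i, (∃ j : ℤ, 0 ≤ j ∧ j < a ∧ σ.arr 6 j = σ.var 20 + 1 ∧ σ.arr 5 j = i) ∧
          τ.arr 3 i = σ.arr 3 i + σ.var 25 ∨
        (¬ ∃ j : ℤ, 0 ≤ j ∧ j < a ∧ σ.arr 6 j = σ.var 20 + 1 ∧ σ.arr 5 j = i) ∧
          τ.arr 3 i = σ.arr 3 i) ∧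
      ∀ j : ℤ, 0 ≤ j → τ.arr 4 j =
        σ.arr 4 j - if j < a ∧ σ.arr 6 j = σ.var 20 + 1 then σ.var 25 else 0)
    (by simpa [Expr.eval, State.dim] using hN) ?_ ?_
  · obtain ⟨-, -, -, -, h3, h4⟩ := key
    have hlt : ∀ j : ℤ, j < ((N + 1 : ℕ) : ℤ) ↔ j ≤ N := fun j => by push_cast; omega
    simp only [hlt] at h3 h4
    refine ⟨h3, fun j hj hjN => ?_⟩
    have := h4 j hj
    simp only [hjN, true_and] at this
    exact this
  · refine ⟨rfl, rfl, rfl, rfl, fun i => .inr ⟨?_, rfl⟩, fun j hj => ?_⟩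
    · rintro ⟨j, h1, h2, -⟩
      push_cast at h2
      omega
    · rw [if_neg (by push_cast; omega), sub_zero]
      rfl
  · rintro a ha τ hτ ⟨h5, h6, h20, h25, h3, h4⟩
    have hsucc : ∀ j : ℤ, j < ((a + 1 : ℕ) : ℤ) ↔ j < a ∨ j = a := fun j => by push_cast; omega
    by_cases hmark : σ.arr 6 a = σ.var 20 + 1
    · have hnot : ¬ ∃ j : ℤ, 0 ≤ j ∧ j < a ∧ σ.arr 6 j = σ.var 20 + 1 ∧ σ.arr 5 j = σ.arr 5 a := by
        rintro ⟨j, hj, hja, hj', e⟩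
        have := hinj j a hj (by omega) (by omega) (by omega) hj' hmark e
        omega
      refine ⟨?_, ?_, ?_, ?_, ?_, ?_⟩
      · simpa [Cmd.exec, Test.Holds, Expr.eval, root, h6, hτ, h20, hmark] using h5
      · simp [Cmd.exec, Test.Holds, Expr.eval, root, h6, hτ, h20, hmark]
      · simp [Cmd.exec, Test.Holds, Expr.eval, root, h6, hτ, h20, hmark]
      · simp [Cmd.exec, Test.Holds, Expr.eval, root, h6, hτ, h20, hmark, h25]
      · intro i
        simp only [hsucc, Cmd.exec, Test.Holds, Expr.eval, root, h6, hτ, h20, hmark, eval_incr,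
          if_true, State.setVar_arr, State.setArr_arr, h5, h25, State.setArr_var,
          Function.update_apply, if_false, Nat.reduceEqDiff]
        by_cases hi : i = σ.arr 5 a
        · refine .inl ⟨⟨a, by omega, .inr rfl, hmark, hi.symm⟩, ?_⟩
          rw [if_pos hi, hi]
          rcases h3 (σ.arr 5 a) with ⟨h, -⟩ | ⟨-, h⟩
          · exact absurd h hnot
          · rw [h]
        · rw [if_neg hi]
          rcases h3 i with ⟨⟨j, h⟩, e⟩ | ⟨h, e⟩
          · exact .inl ⟨⟨j, h.1, .inl h.2.1, h.2.2⟩, e⟩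
          · refine .inr ⟨?_, e⟩
            rintro ⟨j, h1, h2 | rfl, h3⟩
            · exact h ⟨j, h1, h2, h3⟩
            · exact hi h3.2.symm
      · intro j hj
        simp only [hsucc, Cmd.exec, Test.Holds, Expr.eval, root, h6, hτ, h20, hmark, eval_incr,
          if_true, State.setVar_arr, State.setArr_arr, h25, State.setArr_var,
          Function.update_apply, if_false, Nat.reduceEqDiff]
        by_cases hja : j = a
        · have := h4 j hj
          simp [hja, hmark] at this ⊢
          rw [this]
        · simp [hja, h4 j hj]
    · refine ⟨?_, ?_, ?_, ?_, ?_, ?_⟩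
      · simpa [Cmd.exec, Test.Holds, Expr.eval, root, h6, hτ, h20, hmark] using h5
      · simp [Cmd.exec, Test.Holds, Expr.eval, root, h6, hτ, h20, hmark]
      · simp [Cmd.exec, Test.Holds, Expr.eval, root, h6, hτ, h20, hmark]
      · simp [Cmd.exec, Test.Holds, Expr.eval, root, h6, hτ, h20, hmark, h25]
      · intro i
        simp only [hsucc, Cmd.exec, Test.Holds, Expr.eval, root, h6, hτ, h20, hmark, eval_incr,
          if_false, State.setVar_arr]
        refine (h3 i).imp ?_ ?_
        · rintro ⟨⟨j, h⟩, e⟩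
          exact ⟨⟨j, h.1, .inl h.2.1, h.2.2⟩, e⟩
        · rintro ⟨h, e⟩
          refine ⟨?_, e⟩
          rintro ⟨j, h1, h2 | rfl, h3⟩
          · exact h ⟨j, h1, h2, h3⟩
          · exact hmark h3.1
      · intro j hj
        simp only [hsucc, Cmd.exec, Test.Holds, Expr.eval, root, h6, hτ, h20, hmark, eval_incr,
          if_false, State.setVar_arr]
        rw [h4 j hj]
        by_cases hja : j = a
        · simp [hja, hmark]
        · simp [hja]

theorem searchStep_of_free {τ : State} (h : τ.arr 5 (τ.var 22) = 0) : searchStep.exec τ = τ := by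
  simp [searchStep, Cmd.exec, Test.Holds, Expr.eval, h]

/-- This casts one round of the program into the form of `Search.step`. The new marks are also given
explicitly, so that their bound can be carried through the phase. -/
theorem searchStep_spec {τ : State} {N : ℕ} (hN : τ.dim = N) (hr : τ.var 20 + 1 ≤ N)
    {t : ℕ} {q : ℕ → ℤ}
    (h : Search N τ.cellCost (τ.var 20 + 1) (τ.arr 3) (τ.arr 4) (τ.arr 5) (τ.arr 6) (τ.arr 7) t q)
    (hq : τ.var 22 = q t) (ht : τ.arr 5 (q t) ≠ 0) :
    (∃ q' : ℕ → ℤ, Search N τ.cellCost (τ.var 20 + 1) ((searchStep.exec τ).arr 3)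
      ((searchStep.exec τ).arr 4) (τ.arr 5) ((searchStep.exec τ).arr 6)
      ((searchStep.exec τ).arr 7) (t + 1) q' ∧ (searchStep.exec τ).var 22 = q' (t + 1)) ∧
    (searchStep.exec τ).arr 6 = Function.update (τ.arr 6) (q t) (τ.var 20 + 1) := by
  set τ₁ := (Cmd.store 6 (.var 22) root).exec τ with h1
  set τ₂ := scan.exec τ₁ with h2
  set τ₃ := updateDuals.exec τ₂ with h3
  have hexec : searchStep.exec τ =
      (τ₃.setArr 7 (τ₃.var 24) (τ₃.var 23)).setVar 22 (τ₃.var 24) := by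
    simp only [searchStep, Cmd.exec, Test.Holds, Expr.eval, hq, if_neg ht]
    rw [h3, h2, h1]
    simp [Cmd.exec, Expr.eval, hq]
  have a1 : ∀ a, a ≠ 6 → τ₁.arr a = τ.arr a := fun a ha => by simp [h1, Cmd.exec, ha]
  have a16 : τ₁.arr 6 = Function.update (τ.arr 6) (q t) (τ.var 20 + 1) := by
    simp [h1, Cmd.exec, Expr.eval, hq, root]
  have v1 : ∀ x, τ₁.var x = τ.var x := fun x => by simp [h1, Cmd.exec]
  have a2 : τ₂.arr = τ₁.arr := by
    funext c
    exact Cmd.exec_arr (by rfl) τ₁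
  have v2 : τ₂.var 20 = τ.var 20 := by rw [h2, Cmd.exec_var (by rfl), v1]
  have a3 : ∀ a, (updateDuals.setsArr a) = false → τ₃.arr a = τ₁.arr a := fun a ha => by
    rw [h3, Cmd.exec_arr ha, a2]
  have v3 : ∀ x, updateDuals.setsVar x = false → τ₃.var x = τ₂.var x := fun x hx => by
    rw [h3, Cmd.exec_var hx]
  have hd1 : τ₁.dim = N := by rw [State.dim_congr (a1 0 (by decide)), hN]
  have hd2 : τ₂.dim = N := by rw [State.dim_congr (congrFun a2 0), hd1]
  have hc1 : τ₁.cellCost = τ.cellCost := State.cellCost_congr (a1 0 (by decide)) (a1 2 (by decide))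
  have hbest := scan_spec hd1
  rw [← h2, v1] at hbest
  have hmarked : ∀ j : ℤ, 0 ≤ j → j ≤ N → τ₁.arr 6 j = τ.var 20 + 1 → τ.arr 5 j ≠ 0 := by
    intro j hj hjN hj'
    rw [a16, Function.update_apply] at hj'
    split_ifs at hj' with e
    · rwa [e]
    · obtain ⟨a, ha, rfl⟩ := (h.used_iff j hj hjN).1 hj'
      exact h.matched a ha
  obtain ⟨hu, hv⟩ := updateDuals_spec hd2 (by
    intro j j' hj hjN hj' hjN' hm hm' e
    rw [a2, v2] at hm hm'
    rw [a2, a1 5 (by decide)] at e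
    exact h.inj j j' hj hjN hj' hjN' e (hmarked j hj hjN hm))
  rw [← h3, a2, v2] at hu hv
  rw [a1 3 (by decide), a1 5 (by decide)] at hu
  rw [a1 4 (by decide)] at hv
  obtain ⟨hs, -⟩ := h.step (u' := τ₃.arr 3) (v' := τ₃.arr 4) (used' := τ₁.arr 6)
    (way' := Function.update (τ.arr 7) (τ₂.var 24) (τ₂.var 23)) hr ht a16
    (bi := τ₂.var 23) (bj := τ₂.var 24) (best := τ₂.var 25) (by
      have : (fun i j => τ.cellCost (τ.arr 5 i) j - τ.arr 3 (τ.arr 5 i) - τ.arr 4 j) =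
          τ₁.slack := by
        ext i j
        simp [State.slack, hc1, a1 3, a1 4, a1 5]
      rw [this]
      exact hbest) hu hv rfl
  refine ⟨⟨Function.update q (t + 1) (τ₂.var 24), ?_, ?_⟩, ?_⟩
  rotate_left
  · rw [hexec, State.setVar_var, if_pos rfl, v3 24 (by rfl), Function.update_self]
  · rw [hexec, State.setVar_arr, State.setArr_arr, if_neg (by decide), a3 6 (by rfl), a16]
  · rw [hexec]
    simpa [a3 6 (by rfl), a3 7 (by rfl), a1 7 (by decide), v3 23 (by rfl), v3 24 (by rfl)] using hs

theorem phase_spec {σ : State} {N : ℕ} (hN : σ.dim = N) (hk : 0 ≤ σ.var 20)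
    (hr : σ.var 20 + 1 ≤ N)
    (h : Matched N σ.cellCost (σ.var 20) (σ.arr 3) (σ.arr 4) (σ.arr 5))
    (hused : ∀ j : ℤ, 0 ≤ j → j ≤ N → σ.arr 6 j ≤ σ.var 20) :
    Matched N σ.cellCost (σ.var 20 + 1) ((phase.exec σ).arr 3) ((phase.exec σ).arr 4)
        ((phase.exec σ).arr 5) ∧
      ∀ j : ℤ, 0 ≤ j → j ≤ N → (phase.exec σ).arr 6 j ≤ σ.var 20 + 1 := by
  set σ₁ := (Cmd.assign 22 (.const 0)).exec ((Cmd.store 5 (.const 0) root).exec σ) with hσ₁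
  set σ₂ := (Cmd.rep 21 dim searchStep).exec σ₁ with hσ₂
  have hexec : phase.exec σ = (Cmd.rep 29 dim augmentStep).exec σ₂ := rfl
  have a1 : ∀ a, a ≠ 5 → σ₁.arr a = σ.arr a := fun a ha => by simp [hσ₁, Cmd.exec, ha]
  have a15 : σ₁.arr 5 = Function.update (σ.arr 5) 0 (σ.var 20 + 1) := by
    simp [hσ₁, Cmd.exec, Expr.eval, root]
  have v1 : σ₁.var 20 = σ.var 20 := by simp [hσ₁, Cmd.exec]
  have hd1 : σ₁.dim = N := by rw [State.dim_congr (a1 0 (by decide)), hN]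
  have search := Cmd.rep_induction (x := 21) (c := dim) (p := searchStep) (σ := σ₁) (n := N)
    (fun i τ => τ.var 20 = σ.var 20 ∧ τ.arr 0 = σ.arr 0 ∧ τ.arr 2 = σ.arr 2 ∧
      (∀ j : ℤ, 0 ≤ j → j ≤ N → τ.arr 6 j ≤ σ.var 20 + 1) ∧
      ∃ t q, Search N σ.cellCost (σ.var 20 + 1) (τ.arr 3) (τ.arr 4) (τ.arr 5) (τ.arr 6) (τ.arr 7)
        t q ∧ τ.var 22 = q t ∧ (t = i ∨ τ.arr 5 (q t) = 0))
    (by rw [eval_dim, hd1]) ?_ ?_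
  · rw [← hσ₂] at search
    obtain ⟨v2, a20, a22, hused2, t, q, hs, hq, ht⟩ := search
    -- Otherwise all `N` rounds made progress and `t = N`, although the reached columns being
    -- matched forces `t` below the number of the root, which is at most `N`.
    have hfree : σ₂.arr 5 (q t) = 0 := by
      by_contra hne
      have h1 := hs.lt_of_ne hne
      have h2 := ht.resolve_right hne
      omega
    -- The reached columns are distinct and lie between 0 and `N`, so `N` steps back along the path
    -- suffice.
    have htN : t ≤ N := by
      by_contra! hlt
      have hcard : (Finset.range (t + 1)).card ≤ (Finset.Icc (0 : ℤ) N).card := by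
        refine Finset.card_le_card_of_injOn q ?_ ?_
        · intro a ha
          simp only [Finset.coe_range, Set.mem_Iio] at ha
          simpa using hs.q_range a (by omega)
        · intro a ha b hb e
          simp only [Finset.coe_range, Set.mem_Iio] at ha hb
          exact hs.q_inj a (by omega) b (by omega) e
      simp only [Finset.card_range, Int.card_Icc] at hcard
      omega
    -- The loop count is fixed in advance, so the invariant has two cases: either each round so far
    -- has lowered the path index, or the root has been reached and the remaining rounds are idle.
    have augment := Cmd.rep_induction (x := 29) (c := dim) (p := augmentStep) (σ := σ₂) (n := N)
      (fun i τ => τ.arr 3 = σ₂.arr 3 ∧ τ.arr 4 = σ₂.arr 4 ∧ τ.arr 6 = σ₂.arr 6 ∧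
        τ.arr 7 = σ₂.arr 7 ∧ ∃ a, Augment N σ.cellCost (σ.var 20 + 1) (σ₂.arr 3) (σ₂.arr 4)
          (τ.arr 5) (σ₂.arr 7) a q ∧ τ.var 22 = q a ∧ a + i ≤ N ∨
            Augment N σ.cellCost (σ.var 20 + 1) (σ₂.arr 3) (σ₂.arr 4)
          (τ.arr 5) (σ₂.arr 7) a q ∧ τ.var 22 = q a ∧ q a = 0)
      (by rw [eval_dim, State.dim_congr a20, hN]) ?_ ?_
    · obtain ⟨h3, h4, h6, -, a, ⟨ha, hv, haN⟩ | ⟨ha, hv, haN⟩⟩ := augment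
      · obtain rfl : a = 0 := by omega
        have := ha.matched_of_zero ha.zero
        rw [hexec, h3, h4, h6]
        exact ⟨this, hused2⟩
      · have := ha.matched_of_zero haN
        rw [hexec, h3, h4, h6]
        exact ⟨this, hused2⟩
    · refine ⟨rfl, rfl, rfl, rfl, t, .inl ⟨hs.augment hfree, ?_, by omega⟩⟩
      simpa using hq
    · rintro i hi τ hτ ⟨h3, h4, h6, h7, a, ha⟩
      by_cases h0 : τ.var 22 = 0
      · have hstep : augmentStep.exec τ = τ := by
          simp [augmentStep, Cmd.exec, Test.Holds, Expr.eval, h0]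
        simp only [hstep, State.setVar_arr, State.setVar_var]
        refine ⟨h3, h4, h6, h7, a, .inr ?_⟩
        rcases ha with ⟨ha, hv, -⟩ | ⟨ha, hv, -⟩ <;>
        exact ⟨ha, by simpa using hv, by omega⟩
      · rcases ha with ⟨ha, hv, haN⟩ | ⟨ha, hv, ha0⟩
        · obtain ⟨b, hb, hway, hstep⟩ := ha.step (by omega)
          have h0' : q a ≠ 0 := by omega
          simp only [augmentStep, Cmd.exec, Test.Holds, Expr.eval]
          refine ⟨by simpa [h0] using h3, by simpa [h0] using h4, by simpa [h0] using h6,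
            by simpa [h0] using h7, b, .inl ⟨?_, ?_, by omega⟩⟩
          · simpa [h7, hv, h0'] using hstep
          · simpa [h7, hv, h0'] using hway
        · omega
  · refine ⟨v1, a1 0 (by decide), a1 2 (by decide), ?_, 0, fun _ => 0, ?_, ?_, .inl rfl⟩
    · intro j hj hjN
      have := hused j hj hjN
      simp only [State.setVar_arr, a1 6 (by decide)]
      omega
    · have := h.search (way := σ.arr 7) hk hused
      simpa [a15, a1 3, a1 4, a1 6, a1 7] using this
    · simp [hσ₁, Cmd.exec, Expr.eval]
  · rintro i hi τ hτ ⟨v, a0, a2, hu, t, q, hs, hq, ht⟩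
    have hc : τ.cellCost = σ.cellCost := State.cellCost_congr a0 a2
    by_cases hfree : τ.arr 5 (q t) = 0
    · rw [searchStep_of_free (by rw [hq, hfree])]
      exact ⟨by simpa using v, a0, a2, hu, t, q, hs, by simpa using hq, .inr hfree⟩
    · obtain ⟨⟨q', hs', hq'⟩, h6⟩ := searchStep_spec (τ := τ) (N := N)
        (by rw [State.dim_congr a0, hN]) (by omega) (by rwa [hc, v]) hq hfree
      refine ⟨?_, ?_, ?_, ?_, t + 1, q', ?_, ?_, .inl ?_⟩
      · rw [State.setVar_var, if_neg (by decide), Cmd.exec_var (by rfl), v]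
      · rw [State.setVar_arr, Cmd.exec_arr (by rfl), a0]
      · rw [State.setVar_arr, Cmd.exec_arr (by rfl), a2]
      · intro j hj hjN
        rw [State.setVar_arr, h6, Function.update_apply]
        split_ifs
        · omega
        · exact hu j hj hjN
      · rw [hc, v] at hs'
        rw [State.setVar_arr, Cmd.exec_arr (a := 5) (by rfl)]
        exact hs'
      · simpa using hq'
      · have := ht.resolve_right hfree
        omega

/-- Zero dual variables are feasible because the entries are nonnegative. Zero marks are harmless
because the rows are numbered from 1. -/
theorem hungarian_spec {σ : State} {N : ℕ} (hN : σ.dim = N)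
    (h0 : ∀ i j : ℤ, 1 ≤ i → i ≤ N → 1 ≤ j → j ≤ N → 0 ≤ σ.cellCost i j)
    (h3 : ∀ i, σ.arr 3 i = 0) (h4 : ∀ i, σ.arr 4 i = 0) (h5 : ∀ i, σ.arr 5 i = 0)
    (h6 : ∀ i, σ.arr 6 i = 0) :
    Matched N σ.cellCost N ((hungarian.exec σ).arr 3) ((hungarian.exec σ).arr 4)
      ((hungarian.exec σ).arr 5) := by
  have key := Cmd.rep_induction (x := 20) (c := dim) (p := phase) (σ := σ) (n := N)
    (fun k τ => τ.arr 0 = σ.arr 0 ∧ τ.arr 2 = σ.arr 2 ∧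
      Matched N σ.cellCost k (τ.arr 3) (τ.arr 4) (τ.arr 5) ∧
      ∀ j : ℤ, 0 ≤ j → j ≤ N → τ.arr 6 j ≤ k)
    (by rw [eval_dim, hN]) ?_ ?_
  · exact key.2.2.1
  · refine ⟨rfl, rfl, ⟨?_, ?_, ?_, ?_, ?_⟩, ?_⟩
    · intro i j hi hiN hj hjN
      simpa [h3, h4] using h0 i j hi hiN hj hjN
    · intro j _ _
      simp [h5]
    · intro j j' _ _ _ _ _ hne
      exact absurd (h5 j) hne
    · intro i hi hi'
      push_cast at hi'
      omega
    · intro j _ _ hne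
      exact absurd (h5 j) hne
    · intro j _ _
      simp [h6]
  · rintro k hk τ hτ ⟨a0, a2, hm, hu⟩
    have hc : τ.cellCost = σ.cellCost := State.cellCost_congr a0 a2
    obtain ⟨h1, h2⟩ := phase_spec (σ := τ) (N := N) (by rw [State.dim_congr a0, hN]) (by omega)
      (by omega) (by rwa [hc, hτ]) (by rwa [hτ])
    rw [hc, hτ] at h1
    rw [hτ] at h2
    refine ⟨?_, ?_, ?_, ?_⟩
    · rw [State.setVar_arr, Cmd.exec_arr (by rfl), a0]
    · rw [State.setVar_arr, Cmd.exec_arr (by rfl), a2]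
    · push_cast
      exact h1
    · push_cast
      exact h2

/-! ### Preparing the cost matrix

The array `1` holds the valuations and the costs, multiplied by a common denominator. The variables are:
`1` the common denominator, `2` an address, `5` a flag which is `0` if the costs have a courier–store
part, `6` the sum of all entries of the array `1`, `10` and `11` the sizes of the first two layers, `12` the
cost of a forbidden step, `15` an entry of the matrix, `16`, `17`, `18` a buyer, a store and a courier, `19`
the dual objective, `3`, `4`, `7`, `8`, `9`, `13`, `14` loop counters. -/

/-- The input array `a` describes a market with `m` buyers, `n` stores and `l` couriers, whose valuations are
`r 0, …, r (m * n - 1)` and whose costs are `r (m * n), …, r (m * n + m * n * l - 1)`. -/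
structure Encodes (a : ℤ → ℤ) (m n l : ℕ) (r : ℕ → ℚ) : Prop where
  buyers : a 0 = m
  stores : a 1 = n
  couriers : a 2 = l
  val_num : ∀ k : ℕ, k < m * n → a (3 + k) = (r k).num
  val_den : ∀ k : ℕ, k < m * n → a (3 + m * n + k) = (r k).den
  cost_num : ∀ k : ℕ, m * n ≤ k → k < m * n + m * n * l → a (3 + m * n + k) = (r k).num
  cost_den : ∀ k : ℕ, m * n ≤ k → k < m * n + m * n * l →
    a (3 + (m * n + m * n * l) + k) = (r k).den

/-- The number of valuations. -/
def valCount : Expr := .mul buyers stores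

/-- The number of valuations and costs. -/
def entryCount : Expr := .add valCount (.mul valCount couriers)

/-- Copy the numerators into the array `1`. -/
def loadNumerators : Cmd :=
  .rep 3 entryCount (.seq
    (.cond (.le valCount (.var 3))
      (.assign 2 (.add (.add (.const 3) valCount) (.var 3)))
      (.assign 2 (.add (.const 3) (.var 3))))
    (.store 1 (.var 3) (.get 0 (.var 2))))

/-- Multiply all entries but one by the denominator of that one. -/
def multiplyOthers : Cmd :=
  .rep 4 entryCount (.cond (.eq (.var 4) (.var 3)) .skip
    (.store 1 (.var 4) (.mul (.get 1 (.var 4)) (.get 0 (.var 2)))))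

/-- Multiply by all denominators. -/
def clearDenominators : Cmd :=
  .seq (.assign 1 (.const 1)) (.rep 3 entryCount (.seq
    (.cond (.le valCount (.var 3))
      (.assign 2 (.add (.add (.const 3) entryCount) (.var 3)))
      (.assign 2 (.add (.add (.const 3) valCount) (.var 3))))
    (.seq multiplyOthers (.assign 1 (.mul (.var 1) (.get 0 (.var 2)))))))

@[simp] theorem eval_valCount (σ : State) : valCount.eval σ = σ.arr 0 0 * σ.arr 0 1 := rfl

@[simp] theorem eval_entryCount (σ : State) : entryCount.eval σ =
    σ.arr 0 0 * σ.arr 0 1 + σ.arr 0 0 * σ.arr 0 1 * σ.arr 0 2 := rfl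

theorem Encodes.eval_entryCount {m n l : ℕ} {r : ℕ → ℚ} {σ : State}
    (h : Encodes (σ.arr 0) m n l r) : entryCount.eval σ = (m * n + m * n * l : ℕ) := by
  simp [h.buyers, h.stores, h.couriers]

theorem loadNumerators_spec {m n l : ℕ} {r : ℕ → ℚ} {σ : State} (h : Encodes (σ.arr 0) m n l r) :
    ∀ k < m * n + m * n * l, (loadNumerators.exec σ).arr 1 k = (r k).num := by
  have key := Cmd.rep_induction (x := 3) (c := entryCount) (σ := σ) (n := m * n + m * n * l)
    (p := .seq (.cond (.le valCount (.var 3))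
      (.assign 2 (.add (.add (.const 3) valCount) (.var 3)))
      (.assign 2 (.add (.const 3) (.var 3))))
    (.store 1 (.var 3) (.get 0 (.var 2))))
    (fun t τ => τ.arr 0 = σ.arr 0 ∧ ∀ k < t, τ.arr 1 k = (r k).num) h.eval_entryCount ?_ ?_
  · exact key.2
  · exact ⟨rfl, fun k hk => absurd hk (by omega)⟩
  · rintro t ht τ hτ ⟨h0, hk⟩
    refine ⟨?_, ?_⟩
    · rw [State.setVar_arr, Cmd.exec_arr (by rfl), h0]
    · intro k hkt
      -- The valuations' denominators stand between the two lists of numerators. Hence the numerator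
      -- of a cost is displaced by a further `m * n`, beyond the `m * n` contained in its index.
      have hnum : (r t).num = σ.arr 0 (if (m * n : ℤ) ≤ t then 3 + m * n + t else 3 + t) := by
        split_ifs with hle
        · exact (h.cost_num t (by exact_mod_cast hle) ht).symm
        · exact (h.val_num t (by zify; omega)).symm
      by_cases hle : (m * n : ℤ) ≤ t <;>
      simp only [hle, if_true, if_false] at hnum <;>
      rcases Nat.lt_succ_iff_lt_or_eq.1 hkt with hkt | rfl
      · have : (k : ℤ) ≠ t := by omega
        simp [Cmd.exec, Test.Holds, Expr.eval, h0, h.buyers, h.stores, hτ, hle, this, hk k hkt]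
      · simp [Cmd.exec, Test.Holds, Expr.eval, h0, h.buyers, h.stores, hτ, hle, hnum]
      · have : (k : ℤ) ≠ t := by omega
        simp [Cmd.exec, Test.Holds, Expr.eval, h0, h.buyers, h.stores, hτ, hle, this, hk k hkt]
      · simp [Cmd.exec, Test.Holds, Expr.eval, h0, h.buyers, h.stores, hτ, hle, hnum]

theorem multiplyOthers_spec {m n l : ℕ} {r : ℕ → ℚ} {σ : State} (h : Encodes (σ.arr 0) m n l r) :
    ∀ k : ℕ, k < m * n + m * n * l → (multiplyOthers.exec σ).arr 1 k =
      σ.arr 1 k * if (k : ℤ) = σ.var 3 then 1 else σ.arr 0 (σ.var 2) := by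
  have key := Cmd.rep_induction (x := 4) (c := entryCount) (σ := σ) (n := m * n + m * n * l)
    (p := .cond (.eq (.var 4) (.var 3)) .skip
      (.store 1 (.var 4) (.mul (.get 1 (.var 4)) (.get 0 (.var 2)))))
    (fun t τ => τ.arr 0 = σ.arr 0 ∧ τ.var 3 = σ.var 3 ∧ τ.var 2 = σ.var 2 ∧
      (∀ k < t, τ.arr 1 k = σ.arr 1 k * if (k : ℤ) = σ.var 3 then 1 else σ.arr 0 (σ.var 2)) ∧
      ∀ k ≥ t, τ.arr 1 k = σ.arr 1 k) h.eval_entryCount ?_ ?_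
  · exact key.2.2.2.1
  · exact ⟨rfl, rfl, rfl, fun k hk => absurd hk (by omega), fun _ _ => rfl⟩
  · rintro t ht τ hτ ⟨h0, h3, h2, hlt, hge⟩
    have hex : ((Cmd.cond (.eq (.var 4) (.var 3)) .skip
        (.store 1 (.var 4) (.mul (.get 1 (.var 4)) (.get 0 (.var 2))))).exec τ).arr 1 =
        Function.update (τ.arr 1) t
          (τ.arr 1 t * if (t : ℤ) = σ.var 3 then 1 else σ.arr 0 (σ.var 2)) := by
      by_cases e : (t : ℤ) = σ.var 3
      · simp [Cmd.exec, Test.Holds, Expr.eval, hτ, h3, e]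
      · simp [Cmd.exec, Test.Holds, Expr.eval, hτ, h3, e, h0, h2]
    refine ⟨?_, ?_, ?_, ?_, ?_⟩
    · rw [State.setVar_arr, Cmd.exec_arr (by rfl), h0]
    · rw [State.setVar_var, if_neg (by decide), Cmd.exec_var (by rfl), h3]
    · rw [State.setVar_var, if_neg (by decide), Cmd.exec_var (by rfl), h2]
    · intro k hk
      rw [State.setVar_arr, hex]
      rcases Nat.lt_succ_iff_lt_or_eq.1 hk with hk | rfl
      · rw [Function.update_of_ne (by omega), hlt k hk]
      · rw [Function.update_self, hge k le_rfl]
    · intro k hk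
      rw [State.setVar_arr, hex, Function.update_of_ne (by omega), hge k (by omega)]

/-- After `t` rounds, `var 1` is the product of the first `t` denominators. An entry with index at
least `t` still carries its own denominator as an additional factor. Round `t` skips entry `t`, for
which this factor is absorbed into `var 1`. -/
theorem clearDenominators_spec {m n l : ℕ} {r : ℕ → ℚ} {σ : State}
    (h : Encodes (σ.arr 0) m n l r)
    (hnum : ∀ k < m * n + m * n * l, σ.arr 1 k = (r k).num) :
    0 < (clearDenominators.exec σ).var 1 ∧ ∀ k < m * n + m * n * l,
      ((clearDenominators.exec σ).arr 1 k : ℚ) = r k * (clearDenominators.exec σ).var 1 := by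
  have key := Cmd.rep_induction (x := 3) (c := entryCount) (n := m * n + m * n * l)
    (σ := (Cmd.assign 1 (.const 1)).exec σ)
    (p := .seq (.cond (.le valCount (.var 3))
        (.assign 2 (.add (.add (.const 3) entryCount) (.var 3)))
        (.assign 2 (.add (.add (.const 3) valCount) (.var 3))))
      (.seq multiplyOthers (.assign 1 (.mul (.var 1) (.get 0 (.var 2))))))
    (fun t τ => τ.arr 0 = σ.arr 0 ∧ 0 < τ.var 1 ∧ ∀ k < m * n + m * n * l,
      (τ.arr 1 k : ℚ) = r k * τ.var 1 * if t ≤ k then ((r k).den : ℚ) else 1)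
    h.eval_entryCount ?_ ?_
  · refine ⟨key.2.1, fun k hk => ?_⟩
    have := key.2.2 k hk
    rwa [if_neg (by omega), mul_one] at this
  · refine ⟨rfl, by simp [Cmd.exec, Expr.eval], fun k hk => ?_⟩
    simp [Cmd.exec, Expr.eval, hnum k hk, Rat.mul_den_eq_num]
  · rintro t ht τ hτ ⟨h0, hpos, hk⟩
    set τ₁ := (Cmd.cond (.le valCount (.var 3))
      (.assign 2 (.add (.add (.const 3) entryCount) (.var 3)))
      (.assign 2 (.add (.add (.const 3) valCount) (.var 3)))).exec τ with hτ₁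
    have a1 : τ₁.arr = τ.arr := by
      funext c
      exact Cmd.exec_arr (by rfl) τ
    have v1 : ∀ x, x ≠ 2 → τ₁.var x = τ.var x := fun x hx => by
      rw [hτ₁, Cmd.exec_var]
      simp [Cmd.setsVar, hx.symm]
    have hden : τ₁.arr 0 (τ₁.var 2) = (r t).den := by
      rw [a1, h0]
      by_cases hle : (m * n : ℤ) ≤ t
      · rw [← h.cost_den t (by exact_mod_cast hle) ht]
        simp [hτ₁, Cmd.exec, Test.Holds, Expr.eval, h0, h.buyers, h.stores, h.couriers, hτ, hle]
      · rw [← h.val_den t (by zify; omega)]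
        simp [hτ₁, Cmd.exec, Test.Holds, Expr.eval, h0, h.buyers, h.stores, hτ, hle]
    have hmul := multiplyOthers_spec (σ := τ₁) (by rw [a1, h0]; exact h)
    rw [hden, v1 3 (by decide), hτ, a1] at hmul
    set τ₂ := multiplyOthers.exec τ₁ with hτ₂
    have hD : τ₂.var 1 * τ₂.arr 0 (τ₂.var 2) = τ.var 1 * (r t).den := by
      rw [hτ₂, Cmd.exec_var (by rfl), Cmd.exec_var (by rfl), Cmd.exec_arr (by rfl),
        Cmd.exec_var (by rfl), hden]
    have hden0 : (0 : ℤ) < (r t).den := by exact_mod_cast (r t).den_pos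
    refine ⟨?_, ?_, ?_⟩
    · rw [State.setVar_arr, Cmd.exec_arr (by rfl), h0]
    · change 0 < (((Cmd.assign 1 (.mul (.var 1) (.get 0 (.var 2)))).exec τ₂).setVar 3 _).var 1
      simp only [Cmd.exec, Expr.eval, State.setVar_var, hD]
      simpa using by positivity
    · intro k hkK
      change (((((Cmd.assign 1 (.mul (.var 1) (.get 0 (.var 2)))).exec τ₂).setVar 3 _).arr 1 k : ℤ)
        : ℚ) = r k * ((((Cmd.assign 1 (.mul (.var 1) (.get 0 (.var 2)))).exec τ₂).setVar 3 _).var 1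
        : ℤ) * _
      simp only [Cmd.exec, Expr.eval, State.setVar_var, State.setVar_arr, hD, hmul k hkK]
      have := hk k hkK
      push_cast
      rw [this]
      rcases lt_trichotomy k t with hlt | rfl | hlt
      · have e : (k : ℤ) ≠ t := by omega
        simp [e, show ¬ t ≤ k by omega, show ¬ t + 1 ≤ k by omega]
        ring
      · simp
        ring
      · have e : (k : ℤ) ≠ t := by omega
        simp [e, show t ≤ k by omega, show t + 1 ≤ k by omega]
        ring

/-! ### Scaled data and the test for a courier–store part. -/

/-- Read the scaled valuation of a store by a buyer. -/
def readVal (b s : Expr) : Expr := .get 1 (.add (.mul b stores) s)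

/-- Read a scaled delivery cost. -/
def readCost (d b s : Expr) : Expr :=
  .get 1 (.add valCount (.add (.mul (.mul d buyers) stores) (.add (.mul b stores) s)))

/-- The scaled valuations. -/
def State.val (σ : State) (b s : ℤ) : ℤ := σ.arr 1 (b * σ.arr 0 1 + s)

/-- The scaled costs. -/
def State.cost (σ : State) (d b s : ℤ) : ℤ :=
  σ.arr 1 (σ.arr 0 0 * σ.arr 0 1 + (d * σ.arr 0 0 * σ.arr 0 1 + (b * σ.arr 0 1 + s)))

@[simp] theorem eval_readVal (b s : Expr) (σ : State) :
    (readVal b s).eval σ = σ.val (b.eval σ) (s.eval σ) := rfl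

@[simp] theorem eval_readCost (d b s : Expr) (σ : State) :
    (readCost d b s).eval σ = σ.cost (d.eval σ) (b.eval σ) (s.eval σ) := rfl

theorem State.val_congr {σ τ : State} (h0 : τ.arr 0 = σ.arr 0) (h1 : τ.arr 1 = σ.arr 1) :
    τ.val = σ.val := by
  ext b s
  simp [State.val, h0, h1]

theorem State.cost_congr {σ τ : State} (h0 : τ.arr 0 = σ.arr 0) (h1 : τ.arr 1 = σ.arr 1) :
    τ.cost = σ.cost := by
  ext d b s
  simp [State.cost, h0, h1]

/-- Raise the flag if the costs do not have a courier–store part, as seen at one entry. -/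
def checkEntry : Cmd :=
  .cond (.eq
      (.add (readCost (.var 7) (.var 8) (.var 9)) (readCost (.const 0) (.const 0) (.var 9)))
      (.add (readCost (.const 0) (.var 8) (.var 9)) (readCost (.var 7) (.const 0) (.var 9))))
    .skip (.assign 5 (.const 1))

/-- Raise the flag if the costs do not have a courier–store part. -/
def checkCosts : Cmd := .rep 7 couriers (.rep 8 buyers (.rep 9 stores checkEntry))

/-- One level of the nested loops. It is used three times, with the test of the inner loops as `Q`
and an invariant `I` that freezes the arrays and the outer counters. -/
theorem rep_flag_iff {x : ℕ} {c : Expr} {p : Cmd} {σ : State} {n : ℕ} (Q : ℤ → Prop)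
    (I : State → Prop) (hx : x ≠ 5) (hc : c.eval σ = n) (hσ : ∀ i, I (σ.setVar x i))
    (hI : ∀ τ i, I τ → I ((p.exec τ).setVar x i))
    (hp : ∀ τ, I τ → ((p.exec τ).var 5 = 0 ↔ τ.var 5 = 0 ∧ Q (τ.var x))) :
    ((Cmd.rep x c p).exec σ).var 5 = 0 ↔ σ.var 5 = 0 ∧ ∀ i < n, Q (i : ℕ) := by
  have key := Cmd.rep_induction (x := x) (c := c) (p := p) (σ := σ) (n := n)
    (fun t τ => I τ ∧ (τ.var 5 = 0 ↔ σ.var 5 = 0 ∧ ∀ i < t, Q (i : ℕ))) hc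
    ⟨hσ 0, by simp [hx.symm]⟩ ?_
  · exact key.2
  · rintro t ht τ hτ ⟨hi, h⟩
    refine ⟨hI τ _ hi, ?_⟩
    rw [State.setVar_var, if_neg hx.symm, hp τ hi, h, hτ, and_assoc, Nat.forall_lt_succ_right]

theorem checkCosts_spec {m n l : ℕ} {σ : State} (hm : σ.arr 0 0 = m) (hn : σ.arr 0 1 = n)
    (hl : σ.arr 0 2 = l) :
    (checkCosts.exec σ).var 5 = 0 ↔ σ.var 5 = 0 ∧ ∀ d < l, ∀ b < m, ∀ s < n,
      σ.cost d b s + σ.cost 0 0 s = σ.cost 0 b s + σ.cost d 0 s := by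
  have harr : ∀ (p : Cmd) (τ : State), (∀ c, p.setsArr c = false) → (p.exec τ).arr = τ.arr :=
    fun p τ hp => funext fun c => Cmd.exec_arr (hp c) τ
  refine rep_flag_iff (fun d => ∀ b < m, ∀ s < n,
      σ.cost d b s + σ.cost 0 0 s = σ.cost 0 b s + σ.cost d 0 s) (fun τ => τ.arr = σ.arr)
    (by decide) hl (fun _ => rfl) ?_ ?_
  · intro τ i hτ
    rw [State.setVar_arr, harr _ _ fun c => by rfl, hτ]
  intro τ hτ
  refine rep_flag_iff (fun b => ∀ s < n,
      σ.cost (τ.var 7) b s + σ.cost 0 0 s = σ.cost 0 b s + σ.cost (τ.var 7) 0 s)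
    (fun υ => υ.arr = σ.arr ∧ υ.var 7 = τ.var 7)
    (by decide) (by rw [eval_buyers, hτ, hm]) (fun _ => ⟨hτ, by simp⟩) ?_ ?_
  · rintro υ i ⟨hυ, h7⟩
    exact ⟨by rw [State.setVar_arr, harr _ _ fun c => by rfl, hυ],
      by rw [State.setVar_var, if_neg (by decide), Cmd.exec_var (by rfl), h7]⟩
  rintro υ ⟨hυ, h7⟩
  refine rep_flag_iff (fun s => σ.cost (τ.var 7) (υ.var 8) s + σ.cost 0 0 s =
      σ.cost 0 (υ.var 8) s + σ.cost (τ.var 7) 0 s)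
    (fun ω => ω.arr = σ.arr ∧ ω.var 7 = τ.var 7 ∧ ω.var 8 = υ.var 8)
    (by decide) (by rw [eval_stores, hυ, hn]) (fun _ => ⟨hυ, by simpa using h7, by simp⟩) ?_ ?_
  · rintro ω i ⟨hω, h7, h8⟩
    exact ⟨by rw [State.setVar_arr, harr _ _ fun c => by rfl, hω],
      by rw [State.setVar_var, if_neg (by decide), Cmd.exec_var (by rfl), h7],
      by rw [State.setVar_var, if_neg (by decide), Cmd.exec_var (by rfl), h8]⟩
  rintro ω ⟨hω, h7, h8⟩
  have hc : ω.cost = σ.cost := State.cost_congr (by rw [hω]) (by rw [hω])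
  by_cases e : σ.cost (τ.var 7) (υ.var 8) (ω.var 9) + σ.cost 0 0 (ω.var 9) =
      σ.cost 0 (υ.var 8) (ω.var 9) + σ.cost (τ.var 7) 0 (ω.var 9) <;>
  simp [checkEntry, Cmd.exec, Test.Holds, Expr.eval, hc, h7, h8, e]

/-- Sum up the scaled valuations and costs. -/
def sumEntries : Cmd :=
  .seq (.assign 6 (.const 0)) (.rep 3 entryCount (.assign 6 (.add (.var 6) (.get 1 (.var 3)))))

theorem sumEntries_spec {m n l : ℕ} {r : ℕ → ℚ} {σ : State} (h : Encodes (σ.arr 0) m n l r) :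
    (sumEntries.exec σ).var 6 = ∑ k ∈ Finset.range (m * n + m * n * l), σ.arr 1 k := by
  have key := Cmd.rep_induction (x := 3) (c := entryCount) (n := m * n + m * n * l)
    (σ := (Cmd.assign 6 (.const 0)).exec σ) (p := .assign 6 (.add (.var 6) (.get 1 (.var 3))))
    (fun t τ => τ.arr = σ.arr ∧ τ.var 6 = ∑ k ∈ Finset.range t, σ.arr 1 k)
    h.eval_entryCount ?_ ?_
  · exact key.2
  · exact ⟨rfl, by simp [Cmd.exec, Expr.eval]⟩
  · rintro t ht τ hτ ⟨ha, hs⟩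
    refine ⟨ha, ?_⟩
    simp [Cmd.exec, Expr.eval, hs, Finset.sum_range_succ, hτ, ha]

/-! ### Filling the cost matrix. -/

/-- The sizes of the first two layers and the cost of a forbidden step. -/
def prepareLayers : Cmd :=
  .seq (.cond (.eq (.var 5) (.const 0))
      (.seq (.assign 10 buyers) (.assign 11 stores))
      (.seq (.assign 10 stores) (.assign 11 buyers)))
    (.assign 12 (.add (.add (.add (.mul (.var 6) buyers) (.mul (.var 6) stores))
      (.mul (.var 6) couriers)) (.const 1)))

/-- The buyer and the store from the positions in the first two layers. -/
def orient (i j : Expr) : Cmd :=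
  .cond (.eq (.var 5) (.const 0))
    (.seq (.assign 16 i) (.assign 17 j)) (.seq (.assign 16 j) (.assign 17 i))

/-- The entry for a step from the first layer to the second one. -/
def firstStep : Cmd :=
  .cond (.and (.le (incr 13) (.var 10))
      (.and (.le (.var 10) (.var 14)) (.le (incr 14) (.add (.var 10) (.var 11)))))
    (.seq (orient (.var 13) (.sub (.var 14) (.var 10)))
      (.assign 15 (.sub (.var 6) (.sub (readVal (.var 16) (.var 17))
        (readCost (.const 0) (.var 16) (.var 17))))))
    .skip

/-- The entry for a step from the second layer to the third one. -/
def secondStep : Cmd :=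
  .cond (.and (.le (.var 10) (.var 13))
      (.and (.le (incr 13) (.add (.var 10) (.var 11)))
        (.le (.add (.var 10) (.var 11)) (.var 14))))
    (.seq (orient (.const 0) (.sub (.var 13) (.var 10)))
      (.seq (.assign 18 (.sub (.var 14) (.add (.var 10) (.var 11))))
        (.assign 15 (.sub (.var 6) (.sub (readCost (.const 0) (.var 16) (.var 17))
          (readCost (.var 18) (.var 16) (.var 17)))))))
    .skip

/-- The entry for a step from the third layer to the first one. -/
def thirdStep : Cmd :=
  .cond (.and (.le (.add (.var 10) (.var 11)) (.var 13)) (.le (incr 14) (.var 10)))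
    (.assign 15 (.var 6)) .skip

/-- The entry for a trivial step. -/
def trivialStep : Cmd := .cond (.eq (.var 13) (.var 14)) (.assign 15 (.var 6)) .skip

/-- Compute an entry of the matrix. -/
def entry : Cmd :=
  .seq (.assign 15 (.var 12)) (.seq trivialStep (.seq firstStep (.seq secondStep thirdStep)))

/-- Fill the matrix. -/
def fillMatrix : Cmd :=
  .rep 13 dim (.rep 14 dim (.seq entry (.store 2 (cell (incr 13) (incr 14)) (.var 15))))

/-- The scaled weights of the steps from the first layer to the second one. -/
def State.firstWeight (σ : State) (i j : ℤ) : ℤ :=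
  if σ.var 5 = 0 then σ.val i j - σ.cost 0 i j else σ.val j i - σ.cost 0 j i

/-- The scaled weights of the steps from the second layer to the third one. -/
def State.secondWeight (σ : State) (j d : ℤ) : ℤ :=
  if σ.var 5 = 0 then σ.cost 0 0 j - σ.cost d 0 j else σ.cost 0 j 0 - σ.cost d j 0

/-- The entries of the matrix, where `p` and `q` are the sizes of the first two layers. -/
def entryValue (V F p q : ℤ) (A B : ℤ → ℤ → ℤ) (x y : ℤ) : ℤ :=
  if p + q ≤ x ∧ y + 1 ≤ p then V
  else if p ≤ x ∧ x + 1 ≤ p + q ∧ p + q ≤ y then V - B (x - p) (y - (p + q))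
  else if x + 1 ≤ p ∧ p ≤ y ∧ y + 1 ≤ p + q then V - A x (y - p)
  else if x = y then V else F

theorem Cmd.exec_cond_pos {b : Test} {σ : State} (h : b.Holds σ) (p q : Cmd) :
    (Cmd.cond b p q).exec σ = p.exec σ := if_pos h

theorem Cmd.exec_cond_neg {b : Test} {σ : State} (h : ¬ b.Holds σ) (p q : Cmd) :
    (Cmd.cond b p q).exec σ = q.exec σ := if_neg h

theorem thirdStep_var (τ : State) : (thirdStep.exec τ).var 15 =
    if τ.var 10 + τ.var 11 ≤ τ.var 13 ∧ τ.var 14 + 1 ≤ τ.var 10 then τ.var 6 else τ.var 15 := by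
  rw [thirdStep]
  split_ifs with h
  · rw [Cmd.exec_cond_pos]
    · simp [Cmd.exec, Expr.eval]
    · exact h
  · rw [Cmd.exec_cond_neg, Cmd.exec]
    exact h

theorem secondStep_var (τ : State) : (secondStep.exec τ).var 15 =
    if τ.var 10 ≤ τ.var 13 ∧ τ.var 13 + 1 ≤ τ.var 10 + τ.var 11 ∧ τ.var 10 + τ.var 11 ≤ τ.var 14
    then τ.var 6 - τ.secondWeight (τ.var 13 - τ.var 10) (τ.var 14 - (τ.var 10 + τ.var 11))
    else τ.var 15 := by
  rw [secondStep]
  split_ifs with h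
  · rw [Cmd.exec_cond_pos]
    · by_cases h5 : τ.var 5 = 0 <;>
      simp [orient, Cmd.exec, Test.Holds, Expr.eval, State.secondWeight, h5, State.cost]
    · exact h
  · rw [Cmd.exec_cond_neg, Cmd.exec]
    exact h

theorem firstStep_var (τ : State) : (firstStep.exec τ).var 15 =
    if τ.var 13 + 1 ≤ τ.var 10 ∧ τ.var 10 ≤ τ.var 14 ∧ τ.var 14 + 1 ≤ τ.var 10 + τ.var 11
    then τ.var 6 - τ.firstWeight (τ.var 13) (τ.var 14 - τ.var 10) else τ.var 15 := by
  rw [firstStep]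
  split_ifs with h
  · rw [Cmd.exec_cond_pos]
    · by_cases h5 : τ.var 5 = 0 <;>
      simp [orient, Cmd.exec, Test.Holds, Expr.eval, State.firstWeight, h5, State.cost, State.val]
    · exact h
  · rw [Cmd.exec_cond_neg, Cmd.exec]
    exact h

theorem trivialStep_var (τ : State) : (trivialStep.exec τ).var 15 =
    if τ.var 13 = τ.var 14 then τ.var 6 else τ.var 15 := by
  rw [trivialStep]
  split_ifs with h
  · rw [Cmd.exec_cond_pos]
    · simp [Cmd.exec, Expr.eval]
    · exact h
  · rw [Cmd.exec_cond_neg, Cmd.exec]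
    exact h

theorem State.firstWeight_congr {σ τ : State} (h : τ.arr 0 = σ.arr 0) (h1 : τ.arr 1 = σ.arr 1)
    (h5 : τ.var 5 = σ.var 5) : τ.firstWeight = σ.firstWeight := by
  ext i j
  simp [State.firstWeight, State.val_congr h h1, State.cost_congr h h1, h5]

theorem State.secondWeight_congr {σ τ : State} (h : τ.arr 0 = σ.arr 0) (h1 : τ.arr 1 = σ.arr 1)
    (h5 : τ.var 5 = σ.var 5) : τ.secondWeight = σ.secondWeight := by
  ext i j
  simp [State.secondWeight, State.cost_congr h h1, h5]

/-- A later assignment overrides an earlier one, so the cases of `entryValue` are nested in the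
reverse of the order of execution. -/
theorem entry_var (τ : State) : (entry.exec τ).var 15 =
    entryValue (τ.var 6) (τ.var 12) (τ.var 10) (τ.var 11) τ.firstWeight τ.secondWeight
      (τ.var 13) (τ.var 14) := by
  set τ₁ := (Cmd.assign 15 (.var 12)).exec τ with h1
  set τ₂ := trivialStep.exec τ₁ with h2
  set τ₃ := firstStep.exec τ₂ with h3
  set τ₄ := secondStep.exec τ₃ with h4
  have hexec : entry.exec τ = thirdStep.exec τ₄ := rfl
  have v1 : ∀ x, x ≠ 15 → τ₁.var x = τ.var x := fun x hx => by simp [h1, Cmd.exec, hx]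
  have v2 : ∀ x, x ≠ 15 → τ₂.var x = τ.var x := fun x hx => by
    rw [h2, Cmd.exec_var (by simp [trivialStep, Cmd.setsVar, hx.symm]), v1 x hx]
  have v3 : ∀ x, x ≠ 15 → x ≠ 16 → x ≠ 17 → τ₃.var x = τ.var x := fun x hx hx' hx'' => by
    rw [h3, Cmd.exec_var (by
      simp [firstStep, orient, Cmd.setsVar, hx.symm, hx'.symm, hx''.symm]), v2 x hx]
  have v4 : ∀ x, x ≠ 15 → x ≠ 16 → x ≠ 17 → x ≠ 18 → τ₄.var x = τ.var x := fun x a b c d => by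
    rw [h4, Cmd.exec_var (by
      simp [secondStep, orient, Cmd.setsVar, a.symm, b.symm, c.symm, d.symm]), v3 x a b c]
  have a2 : ∀ c, τ₂.arr c = τ.arr c := fun c => Cmd.exec_arr (by rfl) τ₁
  have a3 : ∀ c, τ₃.arr c = τ.arr c := fun c => (Cmd.exec_arr (by rfl) τ₂).trans (a2 c)
  rw [hexec, thirdStep_var, h4, secondStep_var, ← h4, h3, firstStep_var, ← h3, h2,
    trivialStep_var, ← h2, State.firstWeight_congr (a2 0) (a2 1) (v2 5 (by decide)),
    State.secondWeight_congr (a3 0) (a3 1) (v3 5 (by decide) (by decide) (by decide))]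
  have e : τ₁.var 15 = τ.var 12 := by simp [h1, Cmd.exec, Expr.eval]
  simp [v1, v2, v3, v4, e, entryValue]

/-- After the shifts by one cancel, this is uniqueness of quotient and remainder. It guarantees that
filling one cell does not destroy another. -/
theorem cell_injective {N : ℕ} {x y x' y' : ℕ} (hy : y < N) (hy' : y' < N)
    (h : ((x : ℤ) + 1) * N + (y + 1) = ((x' : ℤ) + 1) * N + (y' + 1)) : x = x' ∧ y = y' := by
  have h' : x * N + y = x' * N + y' := by
    zify
    linarith
  have hN : 0 < N := by omega
  constructor
  · have := congrArg (· / N) h'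
    simpa [Nat.mul_comm _ N, Nat.mul_add_div hN, Nat.div_eq_of_lt hy, Nat.div_eq_of_lt hy']
      using this
  · have := congrArg (· % N) h'
    simpa [Nat.mul_comm _ N, Nat.mul_add_mod, Nat.mod_eq_of_lt hy, Nat.mod_eq_of_lt hy'] using this

theorem fillMatrix_spec {σ : State} {N : ℕ} (hN : σ.dim = N) :
    ∀ x < N, ∀ y < N, (fillMatrix.exec σ).cellCost ((x : ℕ) + 1) ((y : ℕ) + 1) =
      entryValue (σ.var 6) (σ.var 12) (σ.var 10) (σ.var 11) σ.firstWeight σ.secondWeight x y := by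
  set f : ℕ → ℕ → ℤ := fun x y =>
    entryValue (σ.var 6) (σ.var 12) (σ.var 10) (σ.var 11) σ.firstWeight σ.secondWeight x y with hf
  let body : Cmd := .seq entry (.store 2 (cell (incr 13) (incr 14)) (.var 15))
  let I : State → Prop := fun τ => τ.arr 0 = σ.arr 0 ∧ τ.arr 1 = σ.arr 1 ∧ τ.var 5 = σ.var 5 ∧
    τ.var 6 = σ.var 6 ∧ τ.var 10 = σ.var 10 ∧ τ.var 11 = σ.var 11 ∧ τ.var 12 = σ.var 12
  have hI : ∀ τ, I τ → I (body.exec τ) := by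
    rintro τ ⟨h0, h1, h5, h6, h10, h11, h12⟩
    refine ⟨?_, ?_, ?_, ?_, ?_, ?_, ?_⟩ <;>
    first
    | rw [Cmd.exec_arr (by rfl)]; assumption
    | rw [Cmd.exec_var (by rfl)]; assumption
  have hbody : ∀ τ (x y : ℕ), I τ → τ.var 13 = x → τ.var 14 = y → (body.exec τ).arr 2 =
      Function.update (τ.arr 2) (((x : ℤ) + 1) * N + (y + 1)) (f x y) := by
    rintro τ x y ⟨h0, h1, h5, h6, h10, h11, h12⟩ hx hy
    have hd : (entry.exec τ).dim = N := by
      rw [State.dim_congr (Cmd.exec_arr (by rfl) τ), State.dim_congr h0, hN]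
    simp only [body, Cmd.exec.eq_4, Cmd.exec.eq_3, State.setArr_arr, if_true, eval_cell, eval_incr, hd]
    rw [Cmd.exec_arr (by rfl), Cmd.exec_var (by rfl), Cmd.exec_var (by rfl), hx, hy]
    congr 1
    rw [Expr.eval, entry_var, h6, h12, h10, h11, State.firstWeight_congr h0 h1 h5,
      State.secondWeight_congr h0 h1 h5, hx, hy]
  have key := Cmd.rep_induction (x := 13) (c := dim) (p := .rep 14 dim body) (σ := σ) (n := N)
    (fun a τ => I τ ∧ ∀ x < a, ∀ y < N, τ.arr 2 (((x : ℤ) + 1) * N + ((y : ℕ) + 1)) = f x y)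
    (by rw [eval_dim, hN]) ⟨⟨rfl, rfl, rfl, rfl, rfl, rfl, rfl⟩, by simp⟩ ?_
  · intro x hx y hy
    have hd : (fillMatrix.exec σ).dim = N := by
      rw [State.dim_congr (Cmd.exec_arr (by rfl) σ), hN]
    rw [State.cellCost, hd]
    exact key.2 x hx y hy
  · rintro a ha τ hτ ⟨hi, hx⟩
    have inner := Cmd.rep_induction (x := 14) (c := dim) (p := body) (σ := τ) (n := N)
      (fun b υ => I υ ∧ υ.var 13 = a ∧
        (∀ x < a, ∀ y < N, υ.arr 2 (((x : ℤ) + 1) * N + ((y : ℕ) + 1)) = f x y) ∧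
        ∀ y < b, υ.arr 2 (((a : ℤ) + 1) * N + ((y : ℕ) + 1)) = f a y)
      (by rw [eval_dim, State.dim_congr hi.1, hN]) ⟨hi, by simpa using hτ, hx, by simp⟩ ?_
    · obtain ⟨hi', -, hx', hy'⟩ := inner
      refine ⟨hi', fun x hxa y hy => ?_⟩
      rcases Nat.lt_succ_iff_lt_or_eq.1 hxa with hxa | rfl
      exacts [hx' x hxa y hy, hy' y hy]
    · rintro b hb υ hυ ⟨hi', h13, hx', hy'⟩
      refine ⟨hI υ hi', ?_, ?_, ?_⟩
      · rw [State.setVar_var, if_neg (by decide), Cmd.exec_var (by rfl), h13]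
      · intro x hxa y hy
        rw [State.setVar_arr, hbody υ a b hi' h13 hυ, Function.update_of_ne, hx' x hxa y hy]
        intro e
        have := (cell_injective hy hb e).1
        omega
      · intro y hy
        rw [State.setVar_arr, hbody υ a b hi' h13 hυ]
        rcases Nat.lt_succ_iff_lt_or_eq.1 hy with hy | rfl
        · rw [Function.update_of_ne, hy' y hy]
          intro e
          have := (cell_injective (by omega) hb e).2
          omega
        · rw [Function.update_self]

/-! ### Reading off the result. -/

/-- Compute the dual objective and the result. -/
def output : Cmd :=
  .seq (.assign 19 (.const 0)) (.seq
    (.rep 3 dim (.assign 19 (.add (.var 19) (.add (.get 3 (incr 3)) (.get 4 (incr 3))))))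
    (.assign 0 (.sub (.add (.add (.mul (.var 6) buyers) (.mul (.var 6) stores))
      (.mul (.var 6) couriers)) (.var 19))))

theorem output_spec {σ : State} {N : ℕ} (hN : σ.dim = N) :
    (output.exec σ).var 0 = N * σ.var 6 -
      ∑ i : Fin N, (σ.arr 3 ((i : ℤ) + 1) + σ.arr 4 ((i : ℤ) + 1)) := by
  have key := Cmd.rep_induction (x := 3) (c := dim) (n := N)
    (p := .assign 19 (.add (.var 19) (.add (.get 3 (incr 3)) (.get 4 (incr 3)))))
    (σ := (Cmd.assign 19 (.const 0)).exec σ)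
    (fun t τ => τ.arr = σ.arr ∧ τ.var 6 = σ.var 6 ∧
      τ.var 19 = ∑ i ∈ Finset.range t, (σ.arr 3 ((i : ℤ) + 1) + σ.arr 4 ((i : ℤ) + 1)))
    hN ?_ ?_
  · obtain ⟨ha, h6, h19⟩ := key
    rw [← Fin.sum_univ_eq_sum_range
      (fun i => σ.arr 3 ((i : ℤ) + 1) + σ.arr 4 ((i : ℤ) + 1))] at h19
    have hexec : output.exec σ = (Cmd.assign 0 (.sub (.add (.add (.mul (.var 6) buyers)
        (.mul (.var 6) stores)) (.mul (.var 6) couriers)) (.var 19))).exec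
          ((Cmd.rep 3 dim (.assign 19 (.add (.var 19) (.add (.get 3 (incr 3))
            (.get 4 (incr 3)))))).exec ((Cmd.assign 19 (.const 0)).exec σ)) := rfl
    rw [hexec, ← hN, State.dim]
    generalize (Cmd.rep 3 dim (.assign 19 (.add (.var 19) (.add (.get 3 (incr 3))
            (.get 4 (incr 3)))))).exec ((Cmd.assign 19 (.const 0)).exec σ) = τ at ha h6 h19 ⊢
    simp only [Cmd.exec, Expr.eval, State.setVar_var, if_true, h6, h19, eval_buyers, eval_stores,
      eval_couriers, ha]
    ring
  · exact ⟨rfl, rfl, by simp [Cmd.exec, Expr.eval]⟩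
  · rintro t ht τ hτ ⟨ha, h6, h19⟩
    refine ⟨ha, by simpa [Cmd.exec] using h6, ?_⟩
    simp [Cmd.exec, Expr.eval, h19, Finset.sum_range_succ, hτ, ha]

/-! ### The whole program -/

/-- The position of a node in the matrix. -/
def nodeEquiv {p q l N : ℕ} (h : p + q + l = N) : Fin p ⊕ Fin q ⊕ Fin l ≃ Fin N :=
  ((Equiv.sumCongr (Equiv.refl (Fin p)) finSumFinEquiv).trans finSumFinEquiv).trans
    (finCongr (by omega))

theorem nodeEquiv_inl {p q l N : ℕ} (h : p + q + l = N) (i : Fin p) :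
    (nodeEquiv h (.inl i) : ℕ) = i := by
  simp [nodeEquiv]

theorem nodeEquiv_mid {p q l N : ℕ} (h : p + q + l = N) (j : Fin q) :
    (nodeEquiv h (.inr (.inl j)) : ℕ) = p + j := by
  simp [nodeEquiv]

theorem nodeEquiv_right {p q l N : ℕ} (h : p + q + l = N) (d : Fin l) :
    (nodeEquiv h (.inr (.inr d)) : ℕ) = p + q + d := by
  simp [nodeEquiv, add_assoc]

/-- The layers occupy consecutive intervals of positions, so the interval tests of `entryValue`
recognise the cases of `stepCost`. -/
theorem entryValue_nodeEquiv {p q l N : ℕ} (h : p + q + l = N) (V F : ℤ) (A B : ℤ → ℤ → ℤ)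
    (x y : Fin p ⊕ Fin q ⊕ Fin l) :
    entryValue V F p q A B (nodeEquiv h x : ℕ) (nodeEquiv h y : ℕ) =
      stepCost V F (fun (i : Fin p) (j : Fin q) => A (i : ℕ) (j : ℕ))
        (fun (j : Fin q) (d : Fin l) => B (j : ℕ) (d : ℕ)) x y := by
  rcases x with i | j | d <;> rcases y with i' | j' | d' <;>
  simp only [nodeEquiv_inl, nodeEquiv_mid, nodeEquiv_right, entryValue, stepCost, Fin.ext_iff] <;>
  split_ifs <;> first | rfl | omega | skip
  all_goals push_cast at *
  all_goals first | omega | simp only [add_sub_cancel_left]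

/-- Solve the assignment problem. -/
def solve : Cmd := .seq fillMatrix (.seq hungarian output)

theorem solve_spec {σ : State} {p q l N : ℕ} (hN : σ.dim = N) (hpq : p + q + l = N)
    (hp : σ.var 10 = p) (hq : σ.var 11 = q) (hV : 0 ≤ σ.var 6) (hF : σ.var 12 = N * σ.var 6 + 1)
    (hA : ∀ i < p, ∀ j < q, σ.firstWeight (i : ℕ) (j : ℕ) ≤ σ.var 6)
    (hB : ∀ j < q, ∀ d < l, σ.secondWeight (j : ℕ) (d : ℕ) ≤ σ.var 6)
    (h3 : ∀ i, σ.arr 3 i = 0) (h4 : ∀ i, σ.arr 4 i = 0) (h5 : ∀ i, σ.arr 5 i = 0)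
    (h6 : ∀ i, σ.arr 6 i = 0) :
    IsGreatest {w | ∃ x : Fin p → Fin q → Fin l → Bool, DisjointTriples x ∧
      w = tripleWeight (fun (i : Fin p) (j : Fin q) => σ.firstWeight (i : ℕ) (j : ℕ))
        (fun (j : Fin q) (d : Fin l) => σ.secondWeight (j : ℕ) (d : ℕ)) x}
      ((solve.exec σ).var 0) := by
  set σ₁ := fillMatrix.exec σ with hσ₁
  set σ₂ := hungarian.exec σ₁ with hσ₂
  have hfill := fillMatrix_spec hN
  rw [← hσ₁] at hfill
  set A : Fin p → Fin q → ℤ := fun i j => σ.firstWeight (i : ℕ) (j : ℕ)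
  set B : Fin q → Fin l → ℤ := fun j d => σ.secondWeight (j : ℕ) (d : ℕ)
  set e := nodeEquiv hpq
  have hcost : ∀ x y, σ₁.cellCost ((e x : ℕ) + 1) ((e y : ℕ) + 1) =
      stepCost (σ.var 6) (σ.var 12) A B x y := fun x y => by
    rw [hfill _ (e x).2 _ (e y).2, hp, hq, entryValue_nodeEquiv hpq]
  have hA' : ∀ i j, A i j ≤ σ.var 6 := fun i j => hA i i.2 j j.2
  have hB' : ∀ j d, B j d ≤ σ.var 6 := fun j d => hB j j.2 d d.2
  have hcard : (Fintype.card (Fin p ⊕ Fin q ⊕ Fin l) : ℤ) = N := by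
    rw [Fintype.card_congr e, Fintype.card_fin]
  have hd1 : σ₁.dim = N := by rw [State.dim_congr (Cmd.exec_arr (by rfl) σ), hN]
  have hd2 : σ₂.dim = N := by rw [State.dim_congr (Cmd.exec_arr (by rfl) σ₁), hd1]
  have hm := hungarian_spec hd1 (by
    intro i j hi hiN hj hjN
    obtain ⟨x, hx⟩ := e.surjective ⟨(i - 1).toNat, by omega⟩
    obtain ⟨y, hy⟩ := e.surjective ⟨(j - 1).toNat, by omega⟩
    have hx' : i = ((e x : ℕ) : ℤ) + 1 := by rw [hx]; simp; omega
    have hy' : j = ((e y : ℕ) : ℤ) + 1 := by rw [hy]; simp; omega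
    rw [hx', hy', hcost]
    exact stepCost_nonneg hV (by rw [hF]; positivity) hA' hB' x y)
    (fun i => by rw [hσ₁, Cmd.exec_arr (by rfl), h3])
    (fun i => by rw [hσ₁, Cmd.exec_arr (by rfl), h4])
    (fun i => by rw [hσ₁, Cmd.exec_arr (by rfl), h5])
    (fun i => by rw [hσ₁, Cmd.exec_arr (by rfl), h6])
  have hout : (solve.exec σ).var 0 = Fintype.card (Fin p ⊕ Fin q ⊕ Fin l) * σ.var 6 -
      ∑ i : Fin N, (σ₂.arr 3 ((i : ℤ) + 1) + σ₂.arr 4 ((i : ℤ) + 1)) := by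
    change (output.exec σ₂).var 0 = _
    rw [output_spec hd2, hcard, hσ₂, Cmd.exec_var (y := 6) (by rfl), hσ₁,
      Cmd.exec_var (y := 6) (by rfl)]
  rw [hout]
  refine isGreatest_tripleWeight (F := σ.var 12) hV hA' hB' (by rw [hcard, hF]; omega) ?_
  -- Conjugation by `e` matches permutations of the nodes with permutations of the matrix indices,
  -- at equal cost.
  convert hm.isLeast using 1
  ext c
  constructor
  · rintro ⟨ρ, rfl⟩
    refine ⟨e.permCongr ρ, ?_⟩
    rw [← Equiv.sum_comp e]
    refine Finset.sum_congr rfl fun x _ => ?_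
    rw [Equiv.permCongr_apply, Equiv.symm_apply_apply, hcost]
  · rintro ⟨ρ, rfl⟩
    refine ⟨e.symm.permCongr ρ, ?_⟩
    rw [← Equiv.sum_comp e]
    refine Finset.sum_congr rfl fun x _ => ?_
    rw [← hcost, Equiv.permCongr_apply, Equiv.symm_symm, Equiv.apply_symm_apply]

/-- The program for markets with at least one buyer, store and courier. -/
def main : Cmd :=
  .seq loadNumerators (.seq clearDenominators (.seq checkCosts (.seq sumEntries
    (.seq prepareLayers solve))))

/-! ### Decoding the input. -/

/-- The entries of the input: the valuations, then the costs. -/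
def Market.entry (M : Market) (k : ℕ) : ℚ :=
  if h : k < M.m * M.n then M.val (Fin.divNat ⟨k, h⟩) (Fin.modNat ⟨k, h⟩)
  else if h : k - M.m * M.n < M.l * (M.m * M.n) then
    M.cost (Fin.divNat ⟨_, h⟩) (Fin.modNat ⟨_, h⟩).divNat (Fin.modNat ⟨_, h⟩).modNat
  else 0

theorem initialState_arr (L : List ℤ) (k : ℕ) : (initialState L).arr 0 k = L.getD k 0 := by
  simp [initialState]

theorem Market.entry_nonneg (M : Market) (k : ℕ) : 0 ≤ M.entry k := by
  unfold Market.entry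
  split_ifs
  exacts [M.val_nonneg _ _, M.cost_nonneg _ _ _, le_rfl]

theorem divNat_add {m n : ℕ} (b : Fin m) (s : Fin n) (h : (b : ℕ) * n + s < m * n) :
    (⟨b * n + s, h⟩ : Fin (m * n)).divNat = b ∧ (⟨b * n + s, h⟩ : Fin (m * n)).modNat = s := by
  have hn : 0 < n := s.pos
  constructor
  · ext
    simp [Fin.divNat, Nat.mul_comm _ n, Nat.mul_add_div hn, Nat.div_eq_of_lt s.2]
  · ext
    simp [Fin.modNat, Nat.mul_comm _ n, Nat.mod_eq_of_lt s.2]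

theorem mul_add_lt {m n b s : ℕ} (hb : b < m) (hs : s < n) : b * n + s < m * n := by
  calc b * n + s < b * n + n := by omega
    _ = (b + 1) * n := by ring
    _ ≤ m * n := Nat.mul_le_mul_right n hb

theorem Market.entry_val (M : Market) (b : Fin M.m) (s : Fin M.n) :
    M.entry (b * M.n + s) = M.val b s := by
  have h := mul_add_lt b.2 s.2
  rw [Market.entry, dif_pos h, (divNat_add b s h).1, (divNat_add b s h).2]

theorem Market.entry_cost (M : Market) (d : Fin M.l) (b : Fin M.m) (s : Fin M.n) :
    M.entry (M.m * M.n + (d * (M.m * M.n) + (b * M.n + s))) = M.cost d b s := by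
  have h := mul_add_lt b.2 s.2
  have h' := mul_add_lt d.2 h
  have e := divNat_add d (⟨b * M.n + s, h⟩ : Fin (M.m * M.n)) h'
  rw [Market.entry, dif_neg (by omega), dif_pos (by simpa using h')]
  simp only [Nat.add_sub_cancel_left]
  rw [e.1, e.2, (divNat_add b s h).1, (divNat_add b s h).2]

theorem Market.length_encode (M : Market) :
    M.encode.length = 3 + 2 * (M.m * M.n) + 2 * (M.m * M.n * M.l) := by
  simp [Market.encode]
  ring

theorem Market.encodes (M : Market) :
    Encodes ((initialState M.encode).arr 0) M.m M.n M.l M.entry := by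
  constructor
  · exact initialState_arr _ 0
  · exact initialState_arr _ 1
  · exact initialState_arr _ 2
  · intro k hk
    rw [show (3 : ℤ) + k = ((3 + k : ℕ) : ℤ) by push_cast; ring, initialState_arr, Market.encode,
      List.getD_append _ _ _ _ (by simp; omega), List.getD_append _ _ _ _ (by simp; omega),
      List.getD_append _ _ _ _ (by simp; omega), List.getD_append_right _ _ _ _ (by simp)]
    simp [List.getD_eq_getElem?_getD, Market.entry, hk]
  · intro k hk
    rw [show (3 : ℤ) + M.m * M.n + k = ((3 + M.m * M.n + k : ℕ) : ℤ) by push_cast; ring,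
      initialState_arr, Market.encode,
      List.getD_append _ _ _ _ (by simp; omega), List.getD_append _ _ _ _ (by simp; omega),
      List.getD_append_right _ _ _ _ (by simp; omega)]
    have : 3 + M.m * M.n + k - (M.m * M.n + 3) = k := by omega
    simp [List.getD_eq_getElem?_getD, Market.entry, hk, this]
  · intro k hk hk'
    have hk2 : k - M.m * M.n < M.l * (M.m * M.n) := by rw [Nat.mul_comm M.l]; omega
    rw [show (3 : ℤ) + M.m * M.n + k = ((3 + M.m * M.n + k : ℕ) : ℤ) by push_cast; ring,
      initialState_arr, Market.encode, List.getD_append _ _ _ _ (by simp; omega),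
      List.getD_append_right _ _ _ _ (by simp; omega)]
    have : 3 + M.m * M.n + k - (M.m * M.n + M.m * M.n + 1 + 1 + 1) = k - M.m * M.n := by omega
    simp [List.getD_eq_getElem?_getD, Market.entry, hk.not_gt, hk2, this]
  · intro k hk hk'
    have hk2 : k - M.m * M.n < M.l * (M.m * M.n) := by rw [Nat.mul_comm M.l]; omega
    rw [show (3 : ℤ) + (M.m * M.n + M.m * M.n * M.l) + k =
        ((3 + (M.m * M.n + M.m * M.n * M.l) + k : ℕ) : ℤ) by push_cast; ring,
      initialState_arr, Market.encode, Nat.mul_comm (M.m * M.n) M.l,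
      List.getD_append_right _ _ _ _ (by simp; omega)]
    have : 3 + (M.m * M.n + M.l * (M.m * M.n)) + k -
        (M.m * M.n + (M.m * M.n + M.l * (M.m * M.n)) + 1 + 1 + 1) = k - M.m * M.n := by omega
    simp [List.getD_eq_getElem?_getD, Market.entry, hk.not_gt, hk2, this]

/-! ### From weights of triples to welfare. -/

theorem tripleWeight_swap {I J D : Type} [Fintype I] [Fintype J] [Fintype D] (A : J → I → ℤ)
    (B : I → D → ℤ) (x : I → J → D → Bool) :
    tripleWeight A B (fun j i d => x i j d) =
      ∑ i, ∑ j, ∑ d, ((x i j d).toNat : ℤ) * (A j i + B i d) := by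
  rw [tripleWeight, Finset.sum_comm]

theorem disjointTriples_swap {I J D : Type} [Fintype I] [Fintype J] [Fintype D]
    {x : I → J → D → Bool} (h : DisjointTriples x) : DisjointTriples fun j i d => x i j d :=
  ⟨h.2.1, h.1, fun d => by rw [Finset.sum_comm]; exact h.2.2 d⟩

/-- Scaling by a positive number preserves maximisers. `DisjointTriples` unfolds to the feasibility
of the market, so its witnesses serve directly. -/
theorem Market.isOptimalWelfare_div {M : Market} {D z : ℤ} (hD : 0 < D)
    {w : (Fin M.m → Fin M.n → Fin M.l → Bool) → ℤ} (hw : ∀ x, (w x : ℚ) = D * M.welfare x)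
    (hz : IsGreatest {a | ∃ x : Fin M.m → Fin M.n → Fin M.l → Bool, DisjointTriples x ∧ a = w x} z) :
    M.IsOptimalWelfare ((z : ℚ) / (D : ℚ)) := by
  have hD' : (0 : ℚ) < D := by exact_mod_cast hD
  obtain ⟨⟨x, hx, rfl⟩, hmax⟩ := hz
  refine ⟨⟨x, hx, by rw [hw, mul_div_cancel_left₀ _ hD'.ne']⟩, ?_⟩
  rintro a ⟨y, hy, rfl⟩
  have : ((w y : ℤ) : ℚ) ≤ w x := by exact_mod_cast hmax ⟨y, hy, rfl⟩
  rw [le_div_iff₀ hD', mul_comm, ← hw]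
  exact this

theorem Market.isOptimalWelfare_of_store {M : Market} {D z : ℤ} (hD : 0 < D)
    {A : Fin M.m → Fin M.n → ℤ} {B : Fin M.n → Fin M.l → ℤ}
    (hAB : ∀ b s d, (A b s : ℚ) + B s d = D * (M.val b s - M.cost d b s))
    (hz : IsGreatest {w | ∃ x : Fin M.m → Fin M.n → Fin M.l → Bool, DisjointTriples x ∧
      w = tripleWeight A B x} z) : M.IsOptimalWelfare ((z : ℚ) / (D : ℚ)) := by
  refine Market.isOptimalWelfare_div hD (fun x => ?_) hz
  simp only [tripleWeight, Market.welfare, Finset.mul_sum]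
  push_cast
  refine Finset.sum_congr rfl fun b _ => Finset.sum_congr rfl fun s _ =>
    Finset.sum_congr rfl fun d _ => ?_
  rw [hAB]
  ring

theorem Market.isOptimalWelfare_of_buyer {M : Market} {D z : ℤ} (hD : 0 < D)
    {A : Fin M.n → Fin M.m → ℤ} {B : Fin M.m → Fin M.l → ℤ}
    (hAB : ∀ b s d, (A s b : ℚ) + B b d = D * (M.val b s - M.cost d b s))
    (hz : IsGreatest {w | ∃ x : Fin M.n → Fin M.m → Fin M.l → Bool, DisjointTriples x ∧
      w = tripleWeight A B x} z) : M.IsOptimalWelfare ((z : ℚ) / (D : ℚ)) := by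
  refine Market.isOptimalWelfare_div hD (w := fun x => tripleWeight A B fun s b d => x b s d)
    (fun x => ?_) ?_
  · simp only [tripleWeight_swap, Market.welfare, Finset.mul_sum]
    push_cast
    refine Finset.sum_congr rfl fun b _ => Finset.sum_congr rfl fun s _ =>
      Finset.sum_congr rfl fun d _ => ?_
    rw [hAB]
    ring
  · convert hz using 1
    ext a
    constructor
    · rintro ⟨x, hx, rfl⟩
      exact ⟨_, disjointTriples_swap hx, rfl⟩
    · rintro ⟨x, hx, rfl⟩
      exact ⟨_, disjointTriples_swap hx, rfl⟩

/-- The parts of the decomposition cancel in this mixed difference, which is all the program can see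
and all it needs. -/
theorem Market.cost_eq_of_store {M : Market} (h : M.DecomposesCourierStore) (d d' : Fin M.l)
    (b b' : Fin M.m) (s : Fin M.n) :
    M.cost d b s + M.cost d' b' s = M.cost d' b s + M.cost d b' s := by
  obtain ⟨f, g, h⟩ := h
  simp only [h]
  ring

theorem Market.cost_eq_of_buyer {M : Market} (h : M.DecomposesCourierBuyer) (d d' : Fin M.l)
    (b : Fin M.m) (s s' : Fin M.n) :
    M.cost d b s + M.cost d' b s' = M.cost d' b s + M.cost d b s' := by
  obtain ⟨f, g, h⟩ := h
  simp only [h]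
  ring

theorem main_spec {M : Market} (hM : M.DecomposesCourierStore ∨ M.DecomposesCourierBuyer)
    (hm : 0 < M.m) (hn : 0 < M.n) (hl : 0 < M.l) :
    0 < (main.exec (initialState M.encode)).var 1 ∧
      M.IsOptimalWelfare (((main.exec (initialState M.encode)).var 0 : ℚ) /
        ((main.exec (initialState M.encode)).var 1 : ℚ)) := by
  set σ := initialState M.encode with hσ
  set σ₁ := loadNumerators.exec σ with hσ₁
  set σ₂ := clearDenominators.exec σ₁ with hσ₂
  set σ₃ := checkCosts.exec σ₂ with hσ₃
  set σ₄ := sumEntries.exec σ₃ with hσ₄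
  set σ₅ := prepareLayers.exec σ₄ with hσ₅
  have henc : Encodes (σ.arr 0) M.m M.n M.l M.entry := M.encodes
  have a1 : σ₁.arr 0 = σ.arr 0 := Cmd.exec_arr (by rfl) σ
  have a2 : σ₂.arr 0 = σ.arr 0 := (Cmd.exec_arr (by rfl) σ₁).trans a1
  have a3 : σ₃.arr = σ₂.arr := funext fun c => Cmd.exec_arr (by rfl) σ₂
  have a4 : σ₄.arr = σ₂.arr := (funext fun c => Cmd.exec_arr (by rfl) σ₃).trans a3
  have a5 : σ₅.arr = σ₂.arr := (funext fun c => Cmd.exec_arr (by rfl) σ₄).trans a4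
  have a50 : σ₅.arr 0 = σ.arr 0 := by rw [a5, a2]
  -- The preparation writes only to array 1, so the Hungarian method finds its own arrays still at
  -- their initial value 0.
  have hzero : ∀ c, c ≠ 0 → c ≠ 1 → ∀ i, σ₅.arr c i = 0 := by
    intro c h0 h1 i
    rw [a5, hσ₂, Cmd.exec_arr, hσ₁, Cmd.exec_arr]
    · simp [hσ, initialState, h0]
    · simp [loadNumerators, Cmd.setsArr, h1.symm]
    · simp [clearDenominators, multiplyOthers, Cmd.setsArr, h1.symm]
  obtain ⟨hD, hX⟩ := clearDenominators_spec (σ := σ₁) (by rwa [a1]) (loadNumerators_spec henc)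
  rw [← hσ₂] at hD hX
  set D := σ₂.var 1 with hDdef
  have hD' : (0 : ℚ) < D := by exact_mod_cast hD
  have hXnonneg : ∀ k < M.m * M.n + M.m * M.n * M.l, 0 ≤ σ₂.arr 1 k := by
    intro k hk
    have : (0 : ℚ) ≤ (σ₂.arr 1 k : ℤ) := by
      rw [hX k hk]
      exact mul_nonneg (M.entry_nonneg k) hD'.le
    exact_mod_cast this
  have hV : σ₄.var 6 = ∑ k ∈ Finset.range (M.m * M.n + M.m * M.n * M.l), σ₂.arr 1 k := by
    rw [hσ₄, sumEntries_spec (σ := σ₃) (by rw [a3, a2]; exact henc), a3]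
  have v56 : σ₅.var 6 = σ₄.var 6 := Cmd.exec_var (by rfl) σ₄
  have v55 : σ₅.var 5 = σ₃.var 5 := by
    rw [hσ₅, Cmd.exec_var (by rfl), hσ₄, Cmd.exec_var (by rfl)]
  have v45 : σ₄.var 5 = σ₅.var 5 := (Cmd.exec_var (by rfl) σ₄).symm
  -- The scaled entries are nonnegative, so their sum dominates each of them. Each weight is at most
  -- one entry, since it subtracts a nonnegative cost; so the sum can serve as `V`.
  have hVle : ∀ k < M.m * M.n + M.m * M.n * M.l, σ₂.arr 1 k ≤ σ₅.var 6 := by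
    intro k hk
    rw [v56, hV]
    exact Finset.single_le_sum (f := fun k : ℕ => σ₂.arr 1 k)
      (fun j hj => hXnonneg j (Finset.mem_range.1 hj)) (Finset.mem_range.2 hk)
  have hV0 : 0 ≤ σ₅.var 6 := by
    rw [v56, hV]
    exact Finset.sum_nonneg fun j hj => hXnonneg j (Finset.mem_range.1 hj)
  have hval : ∀ b < M.m, ∀ s < M.n, ∃ k < M.m * M.n + M.m * M.n * M.l,
      k = b * M.n + s ∧ σ₅.val (b : ℕ) (s : ℕ) = σ₂.arr 1 k := by
    intro b hb s hs
    have := mul_add_lt hb hs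
    refine ⟨_, by omega, rfl, ?_⟩
    rw [State.val, a50, a5, henc.stores]
    push_cast
    rfl
  have hcost : ∀ d < M.l, ∀ b < M.m, ∀ s < M.n, ∃ k < M.m * M.n + M.m * M.n * M.l,
      k = M.m * M.n + (d * (M.m * M.n) + (b * M.n + s)) ∧
        σ₅.cost (d : ℕ) (b : ℕ) (s : ℕ) = σ₂.arr 1 k := by
    intro d hd b hb s hs
    have := mul_add_lt hd (mul_add_lt hb hs)
    refine ⟨_, by rw [Nat.mul_comm _ M.l]; omega, rfl, ?_⟩
    rw [State.cost, a50, a5, henc.buyers, henc.stores]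
    push_cast
    rw [mul_assoc (d : ℤ)]
  have hvalle : ∀ b < M.m, ∀ s < M.n, σ₅.val (b : ℕ) (s : ℕ) ≤ σ₅.var 6 := by
    intro b hb s hs
    obtain ⟨k, hk, -, e⟩ := hval b hb s hs
    exact e ▸ hVle k hk
  have hcostle : ∀ d < M.l, ∀ b < M.m, ∀ s < M.n, σ₅.cost (d : ℕ) (b : ℕ) (s : ℕ) ≤ σ₅.var 6 := by
    intro d hd b hb s hs
    obtain ⟨k, hk, -, e⟩ := hcost d hd b hb s hs
    exact e ▸ hVle k hk
  have hcostnn : ∀ d < M.l, ∀ b < M.m, ∀ s < M.n, 0 ≤ σ₅.cost (d : ℕ) (b : ℕ) (s : ℕ) := by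
    intro d hd b hb s hs
    obtain ⟨k, hk, -, e⟩ := hcost d hd b hb s hs
    exact e ▸ hXnonneg k hk
  have hvalq : ∀ (b : Fin M.m) (s : Fin M.n), ((σ₅.val (b : ℕ) (s : ℕ) : ℤ) : ℚ) =
      M.val b s * D := by
    intro b s
    obtain ⟨k, hk, e, e'⟩ := hval b b.2 s s.2
    rw [e', hX k hk, e, M.entry_val]
  have hcostq : ∀ (d : Fin M.l) (b : Fin M.m) (s : Fin M.n),
      ((σ₅.cost (d : ℕ) (b : ℕ) (s : ℕ) : ℤ) : ℚ) = M.cost d b s * D := by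
    intro d b s
    obtain ⟨k, hk, e, e'⟩ := hcost d d.2 b b.2 s s.2
    rw [e', hX k hk, e, M.entry_cost]
  have hflag : σ₅.var 5 = 0 ↔ ∀ d < M.l, ∀ b < M.m, ∀ s < M.n,
      σ₅.cost (d : ℕ) (b : ℕ) (s : ℕ) + σ₅.cost 0 0 (s : ℕ) =
        σ₅.cost 0 (b : ℕ) (s : ℕ) + σ₅.cost (d : ℕ) 0 (s : ℕ) := by
    rw [v55, hσ₃, checkCosts_spec (m := M.m) (n := M.n) (l := M.l) (by rw [a2, henc.buyers])
      (by rw [a2, henc.stores]) (by rw [a2, henc.couriers]),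
      State.cost_congr (σ := σ₂) (τ := σ₅) (by rw [a5]) (by rw [a5])]
    have : σ₂.var 5 = 0 := by
      rw [hσ₂, Cmd.exec_var (by rfl), hσ₁, Cmd.exec_var (by rfl)]
      rfl
    simp only [this, true_and]
  have hdim : σ₅.dim = (M.m + M.n + M.l : ℕ) := by
    rw [State.dim, a50, henc.buyers, henc.stores, henc.couriers]
    push_cast
    rfl
  have hF : σ₅.var 12 = (M.m + M.n + M.l : ℕ) * σ₅.var 6 + 1 := by
    rw [← hdim, State.dim, a5, ← a4, v56, hσ₅]
    simp only [prepareLayers, Cmd.exec, Expr.eval, State.setVar_var, if_true]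
    split_ifs <;> simp <;> ring
  have hout1 : (main.exec σ).var 1 = D := by
    change (solve.exec σ₅).var 1 = D
    rw [Cmd.exec_var (by rfl), hσ₅, Cmd.exec_var (by rfl), hσ₄, Cmd.exec_var (by rfl), hσ₃,
      Cmd.exec_var (by rfl)]
  have hout0 : (main.exec σ).var 0 = (solve.exec σ₅).var 0 := rfl
  rw [hout1, hout0]
  refine ⟨hD, ?_⟩
  by_cases h5 : σ₅.var 5 = 0
  · have h10 : σ₅.var 10 = M.m := by
      rw [hσ₅]
      simp [prepareLayers, Cmd.exec, Test.Holds, Expr.eval, v45, h5, a4, a2, henc.buyers]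
    have h11 : σ₅.var 11 = M.n := by
      rw [hσ₅]
      simp [prepareLayers, Cmd.exec, Test.Holds, Expr.eval, v45, h5, a4, a2, henc.stores]
    have hs := solve_spec (l := M.l) hdim rfl h10 h11 hV0 hF ?_ ?_ (hzero 3 (by decide) (by decide))
      (hzero 4 (by decide) (by decide)) (hzero 5 (by decide) (by decide))
      (hzero 6 (by decide) (by decide))
    · refine Market.isOptimalWelfare_of_store hD (fun b s d => ?_) hs
      have e := hflag.1 h5 d d.2 b b.2 s s.2
      have e' : ((σ₅.cost (d : ℕ) (b : ℕ) (s : ℕ) : ℤ) : ℚ) + (σ₅.cost 0 0 (s : ℕ) : ℤ) =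
        (σ₅.cost 0 (b : ℕ) (s : ℕ) : ℤ) + (σ₅.cost (d : ℕ) 0 (s : ℕ) : ℤ) := by exact_mod_cast e
      rw [hcostq] at e'
      simp only [State.firstWeight, State.secondWeight, h5, if_true]
      push_cast
      rw [hvalq]
      linarith
    · intro i hi j hj
      rw [State.firstWeight, if_pos h5]
      have h1 := hvalle i hi j hj
      have h2 := hcostnn 0 hl i hi j hj
      push_cast at h2
      omega
    · intro j hj d hd
      rw [State.secondWeight, if_pos h5]
      have h1 := hcostle 0 hl 0 hm j hj
      have h2 := hcostnn d hd 0 hm j hj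
      push_cast at h1 h2
      omega
  -- A raised flag exhibits a violation of the mixed-difference identity among the scaled costs; as
  -- the scaling is by the common factor `D`, the original costs violate it too.
  · have hstore : ¬ M.DecomposesCourierStore := by
      intro h
      refine h5 (hflag.2 fun d hd b hb s hs => ?_)
      have e := Market.cost_eq_of_store h ⟨d, hd⟩ ⟨0, hl⟩ ⟨b, hb⟩ ⟨0, hm⟩ ⟨s, hs⟩
      have e1 := hcostq ⟨d, hd⟩ ⟨b, hb⟩ ⟨s, hs⟩
      have e2 := hcostq ⟨0, hl⟩ ⟨0, hm⟩ ⟨s, hs⟩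
      have e3 := hcostq ⟨0, hl⟩ ⟨b, hb⟩ ⟨s, hs⟩
      have e4 := hcostq ⟨d, hd⟩ ⟨0, hm⟩ ⟨s, hs⟩
      push_cast at e1 e2 e3 e4
      have : ((σ₅.cost (d : ℕ) (b : ℕ) (s : ℕ) : ℤ) : ℚ) + (σ₅.cost 0 0 (s : ℕ) : ℤ) =
          (σ₅.cost 0 (b : ℕ) (s : ℕ) : ℤ) + (σ₅.cost (d : ℕ) 0 (s : ℕ) : ℤ) := by
        rw [e1, e2, e3, e4, ← add_mul, ← add_mul, e]
      exact_mod_cast this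
    have hbuyer := hM.resolve_left hstore
    have h10 : σ₅.var 10 = M.n := by
      rw [hσ₅]
      simp [prepareLayers, Cmd.exec, Test.Holds, Expr.eval, v45, h5, a4, a2, henc.stores]
    have h11 : σ₅.var 11 = M.m := by
      rw [hσ₅]
      simp [prepareLayers, Cmd.exec, Test.Holds, Expr.eval, v45, h5, a4, a2, henc.buyers]
    have hs := solve_spec (l := M.l) hdim (by omega) h10 h11 hV0 hF ?_ ?_
      (hzero 3 (by decide) (by decide)) (hzero 4 (by decide) (by decide))
      (hzero 5 (by decide) (by decide)) (hzero 6 (by decide) (by decide))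
    · refine Market.isOptimalWelfare_of_buyer hD (fun b s d => ?_) hs
      -- The analogous identity, now with reference store 0; the program does not test it, it comes
      -- from the hypothesis.
      have e := Market.cost_eq_of_buyer hbuyer d ⟨0, hl⟩ b s ⟨0, hn⟩
      have e2 := hcostq ⟨0, hl⟩ b ⟨0, hn⟩
      have e3 := hcostq ⟨0, hl⟩ b s
      have e4 := hcostq d b ⟨0, hn⟩
      push_cast at e2 e3 e4
      simp only [State.firstWeight, State.secondWeight, h5, if_false]
      push_cast
      rw [hvalq, e2, e3, e4]
      linear_combination (D : ℚ) * e
    · intro i hi j hj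
      rw [State.firstWeight, if_neg h5]
      have h1 := hvalle j hj i hi
      have h2 := hcostnn 0 hl j hj i hi
      push_cast at h2
      omega
    · intro j hj d hd
      rw [State.secondWeight, if_neg h5]
      have h1 := hcostle 0 hl j hj 0 hn
      have h2 := hcostnn d hd j hj 0 hn
      push_cast at h1 h2
      omega

/-! ### Polynomial time -/

theorem length_le_inputSize (L : List ℤ) : L.length ≤ inputSize L := by
  induction L with
  | nil => simp
  | cons z L ih =>
    simp only [List.length_cons, inputSize, List.map_cons, List.sum_cons] at ih ⊢
    have : 1 ≤ bitLength z := Nat.succ_le_succ (Nat.zero_le _)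
    omega

theorem initialState_bounded (L : List ℤ) :
    (initialState L).Bounded (inputSize L) (inputSize L) := by
  have h : ∀ a i, ((initialState L).arr a i).natAbs < 2 ^ inputSize L := by
    intro a i
    simp only [initialState]
    split_ifs
    · rw [List.getD_eq_getElem?_getD]
      rcases hz : L[i.toNat]? with - | z
      · simp
      · have hmem : z ∈ L := List.mem_of_getElem? hz
        have hle : bitLength z ≤ inputSize L := List.le_sum_of_mem (List.mem_map_of_mem hmem)
        refine (Nat.lt_size_self _).trans_le (Nat.pow_le_pow_right (by norm_num) ?_)
        exact (Nat.le_succ _).trans hle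
    · simp
  exact ⟨fun x => by simp [initialState], h, h 0⟩

/-- The input lists two tables of `m * n` numbers and two of `m * n * l`, each number taking at
least one bit. As all sides are nonempty, `m`, `n` and `l` are bounded by these table sizes. -/
theorem main_bounds {M : Market} (hm : 0 < M.m) (hn : 0 < M.n) (hl : 0 < M.l) :
    ∀ c ∈ main.bounds, c.eval (initialState M.encode) ≤ inputSize M.encode := by
  have henc := M.encodes
  have hlen := length_le_inputSize M.encode
  rw [M.length_encode] at hlen
  have h1 : M.m ≤ M.m * M.n := Nat.le_mul_of_pos_right _ hn
  have h2 : M.n ≤ M.m * M.n := Nat.le_mul_of_pos_left _ hm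
  have h3 : M.l ≤ M.m * M.n * M.l := Nat.le_mul_of_pos_left _ (Nat.mul_pos hm hn)
  have hd : (initialState M.encode).dim = (M.m + M.n + M.l : ℕ) := by
    simp [State.dim, henc.buyers, henc.stores, henc.couriers]
  simp only [main, loadNumerators, clearDenominators, multiplyOthers, checkCosts, checkEntry,
    sumEntries, prepareLayers, solve, fillMatrix, entry, trivialStep, firstStep, secondStep,
    thirdStep, orient, hungarian, phase, searchStep, scan, scanStep, updateDuals, augmentStep,
    output, Cmd.bounds, List.append_nil, List.nil_append, List.cons_append, List.mem_cons,
    List.not_mem_nil, or_false, forall_eq_or_imp, forall_eq, henc.eval_entryCount, eval_dim, hd,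
    eval_buyers, eval_stores, eval_couriers, henc.buyers, henc.stores, henc.couriers, Expr.eval]
  norm_cast
  omega

/-- Is one of the three sides of the market empty? -/
def emptyTest : Test := .eq (.mul valCount couriers) (.const 0)

open Polynomial in
/-- The work of the whole program. -/
noncomputable def totalWork : Polynomial ℕ :=
  C (emptyTest.weight + ((Expr.const 1).weight + 1)) + main.work

theorem RunsWithin.exists_run {s S : ℕ} {p : Program} {σ τ : State} {w : ℕ}
    (h : RunsWithin s S p σ τ w) : ∃ t, Run p σ τ t ∧ t ≤ w * (S + w * (s + 1) + 1) := by
  obtain ⟨-, t, hr, ht⟩ := h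
  exact ⟨t, hr, ht _ le_rfl⟩

theorem emptyTest_holds_iff (M : Market) :
    emptyTest.Holds (initialState M.encode) ↔ M.m = 0 ∨ M.n = 0 ∨ M.l = 0 := by
  have h : (((M.m * M.n * M.l : ℕ) : ℤ)) = 0 ↔ M.m = 0 ∨ M.n = 0 ∨ M.l = 0 := by
    simp [or_assoc]
  rw [← h]
  simp only [emptyTest, Test.Holds, Expr.eval, eval_valCount, eval_couriers, M.encodes.buyers,
    M.encodes.stores, M.encodes.couriers]
  push_cast
  rfl

theorem Market.isOptimalWelfare_zero {M : Market} (h : M.m = 0 ∨ M.n = 0 ∨ M.l = 0) :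
    M.IsOptimalWelfare 0 := by
  have hw : ∀ x, M.welfare x = 0 := fun x =>
    Finset.sum_eq_zero fun b _ => Finset.sum_eq_zero fun s _ => Finset.sum_eq_zero fun d _ => by
      have := b.pos
      have := s.pos
      have := d.pos
      omega
  refine ⟨⟨fun _ _ _ => false, ?_, (hw _).symm⟩, ?_⟩
  · simp [Market.Feasible]
  · rintro w ⟨x, -, rfl⟩
    exact (hw x).le

end Delivery

theorem mainTheorem10 :
    Delivery.PolyTimeComputableOn Delivery.Market.encode
      {M | M.DecomposesCourierStore ∨ M.DecomposesCourierBuyer}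
      Delivery.Market.IsOptimalWelfare := by
  open Delivery in
  -- The bound `w * (S + w * (s + 1) + 1)` of `RunsWithin.exists_run`, with `s` and `S` both the
  -- input size and `w` the total work, which covers either branch.
  refine ⟨.cond emptyTest (.assign 1 (.const 1)) main.toProgram,
    totalWork * (Polynomial.X + totalWork * (Polynomial.X + 1) + 1), fun M hM => ?_⟩
  set L := M.encode with hL
  have hbound := initialState_bounded L
  have htest : emptyTest.tame := rfl
  simp only [Polynomial.eval_mul, Polynomial.eval_add, Polynomial.eval_X, Polynomial.eval_one]
  by_cases h : emptyTest.Holds (initialState L)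
  · have h0 := (emptyTest_holds_iff M).1 h
    have hrun := (RunsWithin.cond_true hbound htest (q := main.toProgram) h
      (RunsWithin.assign hbound 1 (e := .const 1) rfl)).mono
      (w' := totalWork.eval (inputSize L)) (by simp [totalWork])
    obtain ⟨t, hr, ht⟩ := hrun.exists_run
    refine ⟨_, t, hr, ht, by simp [Expr.eval], ?_⟩
    simpa [Expr.eval, initialState] using Market.isOptimalWelfare_zero h0
  · have h0 := mt (emptyTest_holds_iff M).2 h
    simp only [not_or, ← Nat.pos_iff_ne_zero] at h0
    obtain ⟨hm, hn, hl⟩ := h0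
    have hrun := (RunsWithin.cond_false hbound htest (p := .assign 1 (.const 1)) h
      (Cmd.runsWithin (N := inputSize L) (p := main) rfl hbound (main_bounds hm hn hl))).mono
      (w' := totalWork.eval (inputSize L)) (by simp [totalWork])
    obtain ⟨t, hr, ht⟩ := hrun.exists_run
    obtain ⟨h1, hopt⟩ := main_spec hM hm hn hl
    exact ⟨_, t, hr, ht, h1, hopt⟩
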